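/- Setting. Let $\mathcal K$ be a separable Hilbert space and let $\mathcal E(t)\subseteq\mathcal K\subseteq\mathcal E'(t)$, $t>0$, be a measurable field of Gelfand triples with $\|\cdot\|_+\ge\|\cdot\|\ge\|\cdot\|_-$ (for instance $\mathcal E(t)=\mathcal K=\mathcal E'(t)$), presented by orthonormal bases $(e_j(t))_{j\in J}$ of $\mathcal E(t)$ ($J$ countable) and the dual bases of $\mathcal E'(t)$, by which the fibres are identified with $\ell^2(J)$. Let $\mathrm d\tau$ be the measure $\mathrm dt_1\cdots\mathrm dt_n$ on the finite chains $\tau=\{t_1<\dots<t_n\}\subset\,]0,\infty[$, $n=0,1,\dots$. For $\eta>1$ let $\mathcal G(\eta)$ be the space of functions $\varphi(\tau)\in\bigotimes_{t\in\tau}\mathcal E(t)$ with $\|\varphi\|^2(\eta)=\int\eta^{|\tau|}\|\varphi(\tau)\|_+^2\,\mathrm d\tau<\infty$, and for $0<\eta<1$ the same with $\mathcal E'(t)$, $\|\cdot\|_-$. Put $\mathcal G^+=\bigcap_{\eta>1}\mathcal G(\eta)$, $\mathcal G_-=\bigcap_{0<\eta<1}\mathcal G(\eta)$, and $\|T\|_\zeta^\xi=\sup_\varphi\|T\varphi\|(\xi)/\|\varphi\|(\zeta)$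 for operators $T$ on $\mathcal G^+$ with values in $\mathcal G_-$ (likewise with an additional factor $\mathcal E(t)$ or $\mathcal E'(t)$). A process $\mathbf C(t)$ consists of operators $C^-_+(t):\mathcal G^+\to\mathcal G_-$, $C^\circ_+(t):\mathcal G^+\to\mathcal G_-\otimes\mathcal E'(t)$, $C^-_\circ(t):\mathcal G^+\otimes\mathcal E(t)\to\mathcal G_-$, $C^\circ_\circ(t):\mathcal G^+\otimes\mathcal E(t)\to\mathcal G_-\otimes\mathcal E'(t)$. Write $\|C^\mu_\nu\|_{\zeta,t}^{\xi,p}$ for the $L^p$-norm on $]0,t]$ of $s\mapsto\|C^\mu_\nu(s)\|_\zeta^\xi$, with $p=1$ for $C^-_+$, $p=2$ for $C^\circ_+$ and $C^-_\circ$, and $p=\infty$ for $C^\circ_\circ$. $\mathbf C$ is locally QS-integrable if it is weakly measurable and for all $\xi\in\,]0,1[$, $t>0$ there is $\zeta>1$ such that these four functions of $s$ belong to the respective $L^p(]0,t])$. The QS-integral is the operator $\mathcal G^+\to\mathcal G_-$ with, for almost every $\tau$, $$\Big(\int_0^tA(\mathbf C,\mathrm ds)\varphi\Big)(\tau)=\int_0^t\big(C^-_+(s)\varphi+C^-_\circ(s)\varphi^\circ_s\big)(\tau)\,\mathrm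 ds+\sum_{s\in\tau,\,s\le t}\big(C^\circ_+(s)\varphi+C^\circ_\circ(s)\varphi^\circ_s\big)(\tau\setminus s),\qquad \varphi^\circ_s(\tau)=\varphi(\tau\sqcup s).\tag{1}$$ $\mathbf C$ is simple and adapted if there are $0\le t_0<\dots<t_n$ such that on each $[t_l,t_{l+1}[$ it is constant (in the above identification of the fibres), with continuous values of the form $C^{t_l}\otimes I_{t_l}$, where $C^{t_l}$ acts on functions of the chains in $]0,t_l]$ and $I_{t_l}$ is the inclusion of the plus-space into the minus-space over the chains in $]t_l,\infty[$, and $\mathbf C$ vanishes outside $[t_0,t_n[$. Its Itô sum on $]0,t]$ is $$\sum_l\Big[C^{t_l\,-}_{\ \ +}\otimes\Delta_l\,tI+\sum_kC^{t_l\,-}_{\ \ k}\otimes\Delta_lA^k_-+\sum_jC^{t_l\,j}_{\ \ +}\otimes\Delta_lA^+_j+\sum_{i,k}C^{t_l\,i}_{\ \ k}\otimes\Delta_lN^k_i\Big],\qquad\Delta_lA=A(t_{l+1}\wedge t)-A(t_l\wedge t),$$ where in coordinates $A^k_-(t)\varphi(\tau)=\int_0^t\varphi(\tau\sqcup(s,k))\,\mathrm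 ds$, $A^+_j(t)\varphi(\tau)=\sum_{(s,j)\in\tau,\,s\le t}\varphi(\tau\setminus(s,j))$, $N^k_i(t)\varphi(\tau)=\sum_{(s,i)\in\tau,\,s\le t}\varphi((\tau\setminus(s,i))\sqcup(s,k))$ (acting in the future factor, from the plus-space to the minus-space). Statement. Let $t>0$. (i) If $\mathbf C$ is simple and adapted, then there is exactly one operator $\mathcal G^+\to\mathcal G_-$ satisfying (1), the Itô sum of $\mathbf C$ on $]0,t]$ is a well-defined operator $\mathcal G^+\to\mathcal G_-$, and the two coincide. (ii) Let $\mathbf C$ be locally QS-integrable and let $\mathbf C_n$ be simple adapted processes with Itô sums $T_n$ on $]0,t]$. There is exactly one operator $L=\int_0^tA(\mathbf C,\mathrm ds):\mathcal G^+\to\mathcal G_-$ satisfying (1). If $\xi\in\,]0,1[$ and $\zeta>1$ are such that the four norms of $\mathbf C-\mathbf C_n$ for $(\xi,\zeta)$ on $]0,t]$ tend to $0$, then $\|T_n-L\|_{\eta^+}^{\eta_-}\to0$ for all $0<\varepsilon<\xi$, $0<\eta_-\le\xi-\varepsilon$, $\eta^+\ge\zeta+\varepsilon$. In particular, if for every $\xi\in\,]0,1[$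 there is such a $\zeta>1$, then $T_n\to L$ in the inductive operator topology: for every $\eta_-\in\,]0,1[$ there is $\eta^+>1$ with $\|T_n-L\|_{\eta^+}^{\eta_-}\to0$. -/

import Mathlib

open MeasureTheory Set Filter Topology
open scoped ENNReal Classical

noncomputable section

/-! ### Chains -/

/-- A (marked) chain: a finite set of pairs `(s, j)`, with `s` an instant and `j` an index of a
basis of the multiplicity space of the noise.  Functions of marked chains are the coordinates of
functions of chains `τ = {s₁ < ⋯ < sₙ}` with values in the `n`-fold tensor product. -/
structure Chain (J : Type*) where
  points : Finset (ℝ × J)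

namespace Chain

variable {J : Type*}

/-- The chain of the values of a tuple. -/
def ofTuple {n : ℕ} (v : Fin n → ℝ × J) : Chain J := ⟨Finset.univ.image v⟩

/-- `τ ⊔ p`. -/
def insert (τ : Chain J) (p : ℝ × J) : Chain J := ⟨Insert.insert p τ.points⟩

/-- `τ \ p`. -/
def erase (τ : Chain J) (p : ℝ × J) : Chain J := ⟨τ.points.erase p⟩

/-- `σ ⊔ ρ`. -/
def union (σ ρ : Chain J) : Chain J := ⟨σ.points ∪ ρ.points⟩

/-- `|τ|`. -/
def card (τ : Chain J) : ℕ := τ.points.card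

/-- A set of chains is measurable iff, for every `n`, the `n`-tuples whose chain of values belongs
to it form a measurable set. -/
instance [MeasurableSpace J] : MeasurableSpace (Chain J) :=
  ⨅ n : ℕ, MeasurableSpace.map (fun v : Fin n → ℝ × J => ofTuple v) inferInstance

end Chain

/-- The measure `dτ` on the chains with instants in `B`.  On the `n`-point chains it is the image
of `ds₁ ⋯ dsₙ` (times the counting measure on the marks), divided by `n!` because every chain is
obtained from `n!` tuples; this is `ds₁ ⋯ dsₙ` on `s₁ < ⋯ < sₙ`.  The empty chain has mass `1`. -/
def chainMeasure (J : Type*) [MeasurableSpace J] (B : Set ℝ) : Measure (Chain J) :=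
  Measure.sum fun n : ℕ => ((n.factorial : ℝ≥0∞)⁻¹) •
    (Measure.pi fun _ : Fin n => (volume.restrict B).prod (Measure.count : Measure J)).map
      (fun v => Chain.ofTuple v)

/-- `dτ` times the counting measure on an index set `I`, used for functions of a chain with an
additional index (`I = Unit`: no additional index; `I = J`: an additional tensor factor). -/
def fockMeasure (J : Type*) [MeasurableSpace J] (B : Set ℝ) (I : Type*) [MeasurableSpace I] :
    Measure (Chain J × I) :=
  (chainMeasure J B).prod (Measure.count : Measure I)

/-! ### The Fock scale -/

section Scale

variable (J : Type*) [MeasurableSpace J] (B : Set ℝ) (I : Type*) [MeasurableSpace I]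

/-- The classes of measurable functions of a chain with instants in `B` and of an index in `I`,
up to equality almost everywhere. -/
def FockFun := Chain J × I →ₘ[fockMeasure J B I] ℂ

instance : AddCommGroup (FockFun J B I) :=
  inferInstanceAs (AddCommGroup (Chain J × I →ₘ[fockMeasure J B I] ℂ))

instance : Module ℂ (FockFun J B I) :=
  (AEEqFun.instModule : Module ℂ (Chain J × I →ₘ[fockMeasure J B I] ℂ))

instance : CoeFun (FockFun J B I) fun _ => Chain J × I → ℂ := ⟨fun f => AEEqFun.cast f⟩

/-- The norm `‖f‖(η)`, `‖f‖²(η) = ∫ η ^ |τ| ‖f(τ)‖² dτ`. -/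
def scaleNorm (η : ℝ) (f : Chain J × I → ℂ) : ℝ≥0∞ :=
  eLpNorm f 2 ((fockMeasure J B I).withDensity fun x => ENNReal.ofReal (η ^ x.1.card))

theorem scaleNorm_lt_top_iff (η : ℝ) (f : FockFun J B I) :
    scaleNorm J B I η f < ⊤ ↔
      MemLp f 2 ((fockMeasure J B I).withDensity fun x => ENNReal.ofReal (η ^ x.1.card)) :=
  ⟨fun h => ⟨(AEEqFun.aestronglyMeasurable _).mono_ac (withDensity_absolutelyContinuous _ _), h⟩,
    fun h => h.2⟩

/-- The functions whose norms `‖f‖(η)` are finite for all `η ∈ S`. -/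
def scaleSpace (S : Set ℝ) : Submodule ℂ (FockFun J B I) where
  carrier := {f | ∀ η ∈ S, scaleNorm J B I η f < ⊤}
  zero_mem' := by
    intro η _
    rw [scaleNorm_lt_top_iff]
    exact (memLp_congr_ae ((withDensity_absolutelyContinuous _ _).ae_eq
      AEEqFun.coeFn_zero)).2 MemLp.zero
  add_mem' := by
    intro f g hf hg η hη
    have h₁ := (scaleNorm_lt_top_iff J B I η f).1 (hf η hη)
    have h₂ := (scaleNorm_lt_top_iff J B I η g).1 (hg η hη)
    rw [scaleNorm_lt_top_iff]
    exact (memLp_congr_ae ((withDensity_absolutelyContinuous _ _).ae_eq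
      (AEEqFun.coeFn_add f g))).2 (h₁.add h₂)
  smul_mem' := by
    intro c f hf η hη
    have h₁ := (scaleNorm_lt_top_iff J B I η f).1 (hf η hη)
    rw [scaleNorm_lt_top_iff]
    exact (memLp_congr_ae ((withDensity_absolutelyContinuous _ _).ae_eq
      (AEEqFun.coeFn_smul c f))).2 (h₁.const_smul c)

/-- `𝒢⁺ = ⋂_{η > 1} 𝒢(η)` (for `I = Unit`) and `𝒢⁺ ⊗ ℰ(t)` (for `I = J`), in the coordinates of
the orthonormal bases of the spaces `ℰ(s)`. -/
abbrev FockPlus := scaleSpace J B I (Ioi 1)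

/-- `𝒢₋ = ⋂_{η < 1} 𝒢(η)` (for `I = Unit`) and `𝒢₋ ⊗ ℰ'(t)` (for `I = J`), in the coordinates of
the dual orthonormal bases of the spaces `ℰ'(s)`. -/
abbrev FockMinus := scaleSpace J B I (Ioo 0 1)

/-- The operators from `𝒢⁺` or `𝒢⁺ ⊗ ℰ(t)` to `𝒢₋` or `𝒢₋ ⊗ ℰ'(t)`. -/
abbrev FockOp (I' : Type*) [MeasurableSpace I'] := FockPlus J B I →ₗ[ℂ] FockMinus J B I'

variable {J B I}

/-- The norm `‖T‖_ζ^ξ = sup_φ ‖T φ‖(ξ) / ‖φ‖(ζ)`. -/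
def opNorm {I' : Type*} [MeasurableSpace I'] (ζ ξ : ℝ) (T : FockOp J B I I') : ℝ≥0∞ :=
  ⨆ φ : FockPlus J B I, scaleNorm J B I' ξ (T φ).1 / scaleNorm J B I ζ φ.1

/-- The pairing `⟨χ | ψ⟩` of `𝒢⁺` with `𝒢₋` (or of `𝒢⁺ ⊗ ℰ(t)` with `𝒢₋ ⊗ ℰ'(t)`). -/
def pairing (χ : FockPlus J B I) (ψ : FockMinus J B I) : ℂ :=
  ∫ x, starRingEnd ℂ (χ.1 x) * ψ.1 x ∂(fockMeasure J B I)

end Scale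

/-! ### Gelfand triples -/

/-- A measurable field of Gelfand triples `ℰ(t) ⊆ 𝒦 ⊆ ℰ'(t)` with `‖·‖₊ ≥ ‖·‖ ≥ ‖·‖₋`, presented
by the coordinates of an orthonormal basis of each `ℰ(t)`: the sequence `x ∈ ℓ²(J)` stands for
the element `incl t x ∈ 𝒦` of `ℰ(t)`, of norm `‖x‖₊ = ‖x‖`.  The space `ℰ'(t)` is the dual of
`ℰ(t)`, the completion of `𝒦` in `‖k‖₋ = ‖(incl t)* k‖`, and has the coordinates `(incl t)* k`
in the dual basis.  The case `ℰ(t) = 𝒦 = ℰ'(t)` is that of a unitary `incl`. -/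
structure GelfandField (J : Type*) (K : Type*) [NormedAddCommGroup K] [InnerProductSpace ℂ K]
    [CompleteSpace K] where
  incl : ℝ → (lp (fun _ : J => ℂ) 2 →L[ℂ] K)
  injective : ∀ t, Function.Injective (incl t)
  denseRange : ∀ t, DenseRange (incl t)
  norm_le : ∀ t x, ‖incl t x‖ ≤ ‖x‖
  measurable : ∀ x k, Measurable fun t => inner ℂ k (incl t x)

section Processes

variable {J : Type*} [MeasurableSpace J]
variable {K : Type*} [NormedAddCommGroup K] [InnerProductSpace ℂ K] [CompleteSpace K]

/-- The matrix, in the coordinates above, of the inclusion `ℰ(t) ⊆ ℰ'(t)`: the scalar products in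
`𝒦` of the basis vectors of `ℰ(t)`. -/
def GelfandField.gram (G : GelfandField J K) (t : ℝ) (j k : J) : ℂ :=
  inner ℂ (G.incl t (lp.single 2 j 1)) (G.incl t (lp.single 2 k 1))

/-- `I ⊗ I_r`, the inclusion `⊗ ℰ(s) ⊆ ⊗ ℰ'(s)` in the factors that belong to the instants `s > r`
of the chain, the past factors being left as they are.  If `ℰ(t) = 𝒦 = ℰ'(t)` this is the
identity. -/
def GelfandField.embed (G : GelfandField J K) (r : ℝ) {I : Type*} (φ : Chain J × I → ℂ)
    (x : Chain J × I) : ℂ :=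
  ∑' k : {p // p ∈ x.1.points.filter fun p => r < p.1} → J,
    (∏ p, G.gram p.1.1 p.1.2 (k p)) *
      φ (⟨(x.1.points.filter fun p => p.1 ≤ r) ∪ Finset.univ.image fun p => (p.1.1, k p)⟩, x.2)

/-! ### Quantum stochastic processes and their integral -/

/-- A matrix `𝐂 = (C^μ_ν)`, `μ ∈ {-, ∘}`, `ν ∈ {∘, +}`, of operators over the chains in `B`. -/
structure QSMatrix (J : Type*) [MeasurableSpace J] (B : Set ℝ) where
  /-- `C⁻₊ : 𝒢⁺ → 𝒢₋` -/
  drift : FockOp J B Unit Unit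
  /-- `C°₊ : 𝒢⁺ → 𝒢₋ ⊗ ℰ'(t)` -/
  creation : FockOp J B Unit J
  /-- `C⁻∘ : 𝒢⁺ ⊗ ℰ(t) → 𝒢₋` -/
  annihilation : FockOp J B J Unit
  /-- `C°∘ : 𝒢⁺ ⊗ ℰ(t) → 𝒢₋ ⊗ ℰ'(t)` -/
  number : FockOp J B J J

/-- A matrix quantum process `t ↦ 𝐂(t)`, not necessarily adapted (only its values at `t > 0`
matter). -/
abbrev QSProcess (J : Type*) [MeasurableSpace J] := ℝ → QSMatrix J (Ioi 0)

/-- The entrywise difference. -/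
def QSProcess.sub (C D : QSProcess J) : QSProcess J := fun s =>
  { drift := (C s).drift - (D s).drift
    creation := (C s).creation - (D s).creation
    annihilation := (C s).annihilation - (D s).annihilation
    number := (C s).number - (D s).number }

/-- `t ↦ T(t)` is weakly (Lebesgue) measurable. -/
def WeaklyMeasurableOp {I I' : Type*} [MeasurableSpace I] [MeasurableSpace I']
    (T : ℝ → FockOp J (Ioi 0) I I') : Prop :=
  ∀ φ χ, AEMeasurable (fun s => pairing χ (T s φ)) (volume.restrict (Ioi 0))

def QSProcess.WeaklyMeasurable (C : QSProcess J) : Prop :=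
  WeaklyMeasurableOp (fun s => (C s).drift) ∧ WeaklyMeasurableOp (fun s => (C s).creation) ∧
    WeaklyMeasurableOp (fun s => (C s).annihilation) ∧ WeaklyMeasurableOp (fun s => (C s).number)

/-- The norm `‖T‖_{ζ,t}^{ξ,p}`, the `L^p`-norm on `]0, t]` of `s ↦ ‖T(s)‖_ζ^ξ`:
`∫₀ᵗ ‖T(s)‖_ζ^ξ ds` for `p = 1`, `(∫₀ᵗ (‖T(s)‖_ζ^ξ)² ds)^{1/2}` for `p = 2`, and
`ess sup_{s ≤ t} ‖T(s)‖_ζ^ξ` for `p = ∞`. -/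
def opLpNorm {I I' : Type*} [MeasurableSpace I] [MeasurableSpace I'] (p : ℝ≥0∞) (t ζ ξ : ℝ)
    (T : ℝ → FockOp J (Ioi 0) I I') : ℝ≥0∞ :=
  eLpNorm (fun s => opNorm ζ ξ (T s)) p (volume.restrict (Ioc 0 t))

/-- `s ↦ ‖T(s)‖_ζ^ξ` is measurable and its `L^p`-norm `‖T‖_{ζ,t}^{ξ,p}` is finite. -/
def MemOpLp {I I' : Type*} [MeasurableSpace I] [MeasurableSpace I'] (p : ℝ≥0∞) (t ζ ξ : ℝ)
    (T : ℝ → FockOp J (Ioi 0) I I') : Prop :=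
  MemLp (fun s => opNorm ζ ξ (T s)) p (volume.restrict (Ioc 0 t))

/-- Local QS-integrability. -/
def QSProcess.LocallyQSIntegrable (C : QSProcess J) : Prop :=
  C.WeaklyMeasurable ∧ ∀ ξ ∈ Ioo (0 : ℝ) 1, ∀ t > 0, ∃ ζ > 1,
    MemOpLp 1 t ζ ξ (fun s => (C s).drift) ∧ MemOpLp 2 t ζ ξ (fun s => (C s).creation) ∧
      MemOpLp 2 t ζ ξ (fun s => (C s).annihilation) ∧ MemOpLp ⊤ t ζ ξ (fun s => (C s).number)

/-- `φs` is the tensor-function `φ°_s(τ) = φ(τ ⊔ s)`, in coordinates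
`φ°_s(τ, j) = φ(τ ⊔ (s, j))`. -/
def IsSlice (φ : FockPlus J (Ioi 0) Unit) (s : ℝ) (φs : FockPlus J (Ioi 0) J) : Prop :=
  φs.1 =ᵐ[fockMeasure J (Ioi 0) J] fun x => φ.1 (x.1.insert (s, x.2), ())

/-- `ψ = (∫₀ᵗ A(𝐂, ds)) φ`, that is, for almost every chain `τ`,
`ψ(τ) = ∫₀ᵗ (C⁻₊(s) φ + C⁻∘(s) φ°_s)(τ) ds + ∑_{s ∈ τ, s ≤ t} (C°₊(s) φ + C°∘(s) φ°_s)(τ \ s)`.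
Here `f` and `g` are versions, measurable in `s` and `τ` jointly, of the classes of functions of `τ`
under the integral and under the sum. -/
def QSProcess.IsIntegralAt (C : QSProcess J) (t : ℝ) (φ : FockPlus J (Ioi 0) Unit)
    (ψ : FockMinus J (Ioi 0) Unit) : Prop :=
  ∃ (f : ℝ → Chain J × Unit → ℂ) (g : ℝ → Chain J × J → ℂ),
    Measurable (Function.uncurry f) ∧ Measurable (Function.uncurry g) ∧
    (∀ᵐ s ∂(volume.restrict (Ioc 0 t)), ∃ φs, IsSlice φ s φs ∧
      f s =ᵐ[fockMeasure J (Ioi 0) Unit] ((C s).drift φ + (C s).annihilation φs).1 ∧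
      g s =ᵐ[fockMeasure J (Ioi 0) J] ((C s).creation φ + (C s).number φs).1) ∧
    ∀ᵐ τ ∂(chainMeasure J (Ioi 0)), IntegrableOn (fun s => f s (τ, ())) (Ioc 0 t) ∧
      ψ.1 (τ, ()) = (∫ s in Ioc 0 t, f s (τ, ())) +
        ∑ p ∈ τ.points with p.1 ≤ t, g p.1 (τ.erase p, p.2)

/-- The operator `T` is the QS-integral `∫₀ᵗ A(𝐂, ds)`. -/
def QSProcess.IsIntegral (C : QSProcess J) (t : ℝ) (T : FockOp J (Ioi 0) Unit Unit) : Prop :=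
  ∀ φ, C.IsIntegralAt t φ (T φ)

/-! ### Adapted simple processes and their Itô sums -/

/-- `Ψ = (X ⊗ I) Φ` for an operator `X` over the chains in `]0, r]`: for almost every chain `ρ` in
`]r, ∞[`, the function `σ ↦ Ψ(σ ⊔ ρ)` of the chains in `]0, r]` is the image under `X` of the
function `σ ↦ Φ(σ ⊔ ρ)`. -/
def IsTensor (r : ℝ) {I I' : Type*} [MeasurableSpace I] [MeasurableSpace I']
    (X : FockOp J (Ioc 0 r) I I') (Φ : Chain J × I → ℂ)
    (Ψ : FockFun J (Ioi 0) I') : Prop :=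
  ∀ᵐ ρ ∂(chainMeasure J (Ioi r)), ∃ u : FockPlus J (Ioc 0 r) I,
    u.1 =ᵐ[fockMeasure J (Ioc 0 r) I] (fun x => Φ (x.1.union ρ, x.2)) ∧
    (X u).1 =ᵐ[fockMeasure J (Ioc 0 r) I'] (fun x => Ψ (x.1.union ρ, x.2))

/-- `C = C^r ⊗ I_r`, where `C^r = X` is an operator over the chains in `]0, r]`. -/
def IsAmpliation (G : GelfandField J K) (r : ℝ) {I I' : Type*} [MeasurableSpace I]
    [MeasurableSpace I'] (X : FockOp J (Ioc 0 r) I I') (C : FockOp J (Ioi 0) I I') : Prop :=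
  ∀ φ, IsTensor r X (G.embed r φ.1) (C φ).1

/-- `𝐂 = 𝐗 ⊗ I_r`, entrywise. -/
def QSMatrix.IsAmpliationOf (C : QSMatrix J (Ioi 0)) (G : GelfandField J K) (r : ℝ)
    (X : QSMatrix J (Ioc 0 r)) : Prop :=
  IsAmpliation G r X.drift C.drift ∧ IsAmpliation G r X.creation C.creation ∧
    IsAmpliation G r X.annihilation C.annihilation ∧ IsAmpliation G r X.number C.number

/-- The operator is continuous from `𝒢⁺` (or `𝒢⁺ ⊗ ℰ(t)`) to `𝒢₋` (or `𝒢₋ ⊗ ℰ'(t)`). -/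
def IsContinuousOp {B : Set ℝ} {I I' : Type*} [MeasurableSpace I] [MeasurableSpace I']
    (T : FockOp J B I I') : Prop :=
  ∀ ξ ∈ Ioo (0 : ℝ) 1, ∃ ζ > 1, opNorm ζ ξ T < ⊤

/-- The entries of `𝐂` are continuous operators. -/
def QSMatrix.IsContinuous {B : Set ℝ} (C : QSMatrix J B) : Prop :=
  IsContinuousOp C.drift ∧ IsContinuousOp C.creation ∧ IsContinuousOp C.annihilation ∧
    IsContinuousOp C.number

/-- A simple adapted process: it is equal to `value l = past l ⊗ I` on `[t_l, t_{l+1}[`, with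
`past l` a matrix of operators over the chains in `]0, t_l]`, for `0 ≤ t_0 < t_1 < ⋯ < t_n`, and
vanishes elsewhere. -/
structure SimpleAdapted (G : GelfandField J K) where
  n : ℕ
  time : Fin (n + 1) → ℝ
  time_nonneg : 0 ≤ time 0
  time_strictMono : StrictMono time
  value : Fin n → QSMatrix J (Ioi 0)
  past : (l : Fin n) → QSMatrix J (Ioc 0 (time l.castSucc))
  continuous : ∀ l, (value l).IsContinuous
  adapted : ∀ l, (value l).IsAmpliationOf G (time l.castSucc) (past l)

/-- The simple adapted process as a function of `s`. -/
def SimpleAdapted.process {G : GelfandField J K} (S : SimpleAdapted G) : QSProcess J := fun s =>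
  { drift := ∑ l, if s ∈ Ico (S.time l.castSucc) (S.time l.succ) then (S.value l).drift else 0
    creation :=
      ∑ l, if s ∈ Ico (S.time l.castSucc) (S.time l.succ) then (S.value l).creation else 0
    annihilation :=
      ∑ l, if s ∈ Ico (S.time l.castSucc) (S.time l.succ) then (S.value l).annihilation else 0
    number := ∑ l, if s ∈ Ico (S.time l.castSucc) (S.time l.succ) then (S.value l).number else 0 }

/-- The annihilation processes: `(A₋ᵏ(t) φ)(τ) = ∫₀ᵗ φ(τ ⊔ (s, k)) ds`, as a function of `τ`
and `k`. -/
def annihilationProc (t : ℝ) (φ : Chain J × Unit → ℂ) (x : Chain J × J) : ℂ :=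
  ∫ s in Ioc 0 t, φ (x.1.insert (s, x.2), ())

/-- The creation process of the mark `j`: `(A⁺_j(t) φ)(τ) = ∑_{(s, j) ∈ τ, s ≤ t} φ(τ \ (s, j))`. -/
def creationProc (t : ℝ) (j : J) (φ : Chain J × Unit → ℂ) (x : Chain J × Unit) : ℂ :=
  ∑ p ∈ x.1.points with p.1 ≤ t ∧ p.2 = j, φ (x.1.erase p, ())

/-- The number (exchange) processes from the mark `k` to the mark `i`:
`(N_iᵏ(t) φ)(τ) = ∑_{(s, i) ∈ τ, s ≤ t} φ((τ \ (s, i)) ⊔ (s, k))`, as a function of `τ` and `k`,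
followed by the inclusion `⊗ ℰ(s') ⊆ ⊗ ℰ'(s')` in the other factors of instants `s' > r`.
For one mark and `ℰ(t) = 𝒦` this is `|τ^t| φ(τ)`. -/
def numberProc (G : GelfandField J K) (r t : ℝ) (i : J) (φ : Chain J × Unit → ℂ)
    (x : Chain J × J) : ℂ :=
  ∑ p ∈ x.1.points with p.1 ≤ t ∧ p.2 = i,
    G.embed r (fun y => φ (y.1.insert (p.1, x.2), ())) (x.1.erase p, ())

/-- `ψ = (P⁻₊ ⊗ (b - a) + ∑_k P⁻_k ⊗ ΔA₋ᵏ + ∑_j P^j₊ ⊗ ΔA⁺_j + ∑_{i,k} P^i_k ⊗ ΔN_iᵏ) φ`, the term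
of an Itô sum with the coefficients `P` over the chains in `]0, r]` and the increments
`ΔA = A(b) - A(a)` of the basic processes. -/
def IsItoTerm (G : GelfandField J K) (r : ℝ) (P : QSMatrix J (Ioc 0 r)) (a b : ℝ)
    (φ : FockPlus J (Ioi 0) Unit) (ψ : FockFun J (Ioi 0) Unit) : Prop :=
  ∃ (ψ₀ ψ₁ : FockFun J (Ioi 0) Unit)
    (ψ₂ ψ₃ : J → FockFun J (Ioi 0) J),
    IsTensor r P.drift (fun x => ((b - a : ℝ) : ℂ) * G.embed r φ.1 x) ψ₀ ∧
    IsTensor r P.annihilation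
      (G.embed r fun x => annihilationProc b φ.1 x - annihilationProc a φ.1 x) ψ₁ ∧
    (∀ j, IsTensor r P.creation
      (fun x => creationProc b j (G.embed r φ.1) x - creationProc a j (G.embed r φ.1) x) (ψ₂ j)) ∧
    (∀ i, IsTensor r P.number
      (fun x => numberProc G r b i φ.1 x - numberProc G r a i φ.1 x) (ψ₃ i)) ∧
    ∀ᵐ τ ∂(chainMeasure J (Ioi 0)),
      ψ (τ, ()) = ψ₀ (τ, ()) + ψ₁ (τ, ()) + (∑' j, ψ₂ j (τ, j)) + ∑' i, ψ₃ i (τ, i)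

/-- The operator `T` is the Itô sum of the simple adapted process on `]0, t]`,
`∑_l C^μ_ν(t_l) (A^ν_μ(t_{l+1} ∧ t) - A^ν_μ(t_l ∧ t))`. -/
def SimpleAdapted.IsItoSum {G : GelfandField J K} (S : SimpleAdapted G) (t : ℝ)
    (T : FockOp J (Ioi 0) Unit Unit) : Prop :=
  ∀ φ, ∃ ψ : Fin S.n → FockFun J (Ioi 0) Unit,
    (∀ l, IsItoTerm G (S.time l.castSucc) (S.past l) (min (S.time l.castSucc) t)
      (min (S.time l.succ) t) φ (ψ l)) ∧
    (T φ).1 = ∑ l, ψ l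

/-! ### Convergence -/

/-- The processes `D n` approximate `C` in the four `L^p`-norms on `]0, t]`, for the pair
`(ξ, ζ)`. -/
def ApproximatesAt (D : ℕ → QSProcess J) (C : QSProcess J) (t ξ ζ : ℝ) : Prop :=
  Tendsto (fun n => opLpNorm 1 t ζ ξ fun s => (C.sub (D n) s).drift) atTop (𝓝 0) ∧
  Tendsto (fun n => opLpNorm 2 t ζ ξ fun s => (C.sub (D n) s).creation) atTop (𝓝 0) ∧
  Tendsto (fun n => opLpNorm 2 t ζ ξ fun s => (C.sub (D n) s).annihilation) atTop (𝓝 0) ∧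
  Tendsto (fun n => opLpNorm ⊤ t ζ ξ fun s => (C.sub (D n) s).number) atTop (𝓝 0)

/-- Convergence of operators `𝒢⁺ → 𝒢₋` in the inductive operator topology: for every `η₋ < 1`
convergence in one of the norms `‖·‖_{η₊}^{η₋}`, `η₊ > 1`. -/
def TendstoInductive (T : ℕ → FockOp J (Ioi 0) Unit Unit) (L : FockOp J (Ioi 0) Unit Unit) :
    Prop :=
  ∀ η₁ ∈ Ioo (0 : ℝ) 1, ∃ η₂ > 1, Tendsto (fun n => opNorm η₂ η₁ (T n - L)) atTop (𝓝 0)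

end Processes

end

/-! Everything rests on one estimate: for `0 < ε < ξ` and `ζ > 1`, the right-hand side of (1) has
norm at `ξ - ε` at most a finite constant times the sum of the four norms of `𝐂` for `(ξ, ζ)` times
the norm of `φ` at `ζ + ε` (`QSProcess.IsParts.estimate`). Its source is the identity `∫ ∑_{p ∈ τ}
G(p, τ \ p) dτ = ∫∫ G(p, τ) dτ dp` (`lintegral_sum_erase`). It bounds the sum over the points of `τ`
by the norms of the integrands, and the square integral over `s` of `‖φ°_s‖` by the norm of `φ`.
Each use produces a factor `|τ|`, which a loss of `ε` in the scale absorbs, since `n ηⁿ ≤ (η/ε)(η +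
ε)ⁿ` (`natCast_mul_pow_le`). The time integral is handled by Minkowski's inequality.

The estimate shows that the right-hand side of (1) belongs to `𝒢₋`, so the integral exists;
uniqueness and linearity hold because two versions of the integrands give the same right-hand side
almost everywhere. Applied to `𝐂 - 𝐂ₙ`, it gives the convergence in (ii), once the Itô sums of `𝐂ₙ`
are known to be QS-integrals.

For that identification, the integral of a simple process telescopes over the intervals of
constancy. On one interval the drift is constant in `s`; the annihilation coefficient, being
continuous, passes under the integral of `φ°_s` (`IsContinuousOp.apply_integral`). In the creation
and number terms the summation runs over points after `t_l`, hence over the future part `ρ` of the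
chain only, on whose fibres `X ⊗ I` acts as `X` (`isTensor_sum`). The splitting into past and future
is the factorization of `dτ` (`lintegral_chainMeasure_union`).

The rest is measurability. Separability of the spaces `𝒢(η)` yields jointly measurable versions of
weakly measurable integrands (`exists_version`), and makes the graph relation of a bounded operator
a measurable condition (`measurableSet_graph_apply`). Statements for almost every instant and almost
every chain can then be transferred to all points of almost every chain (`ae_forall_erase`). -/

set_option linter.unusedSectionVars false

noncomputable section

/-! ### Measurability on the space of chains -/

namespace Chain

variable {J : Type*}

theorem ext_points {σ τ : Chain J} (h : σ.points = τ.points) : σ = τ := by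
  cases σ; cases τ; simp_all

@[simp] theorem mem_ofTuple {n : ℕ} {v : Fin n → ℝ × J} {p : ℝ × J} :
    p ∈ (ofTuple v).points ↔ ∃ i, v i = p := by
  simp [ofTuple]

theorem sum_ofTuple {n : ℕ} {v : Fin n → ℝ × J} (hv : Function.Injective v) {M : Type*}
    [AddCommMonoid M] (q : ℝ × J → Prop) (F : ℝ × J → M) :
    ∑ p ∈ (ofTuple v).points with q p, F p = ∑ i with q (v i), F (v i) := by
  have : (ofTuple v).points.filter q = (Finset.univ.filter fun i => q (v i)).image v := by
    ext p
    simp only [Finset.mem_filter, mem_ofTuple, Finset.mem_image, Finset.mem_univ, true_and]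
    constructor
    · rintro ⟨⟨i, rfl⟩, h⟩
      exact ⟨i, h, rfl⟩
    · rintro ⟨i, h, rfl⟩
      exact ⟨⟨i, rfl⟩, h⟩
  rw [this, Finset.sum_image fun _ _ _ _ h => hv h]

theorem card_ofTuple {n : ℕ} {v : Fin n → ℝ × J} (hv : Function.Injective v) :
    (ofTuple v).card = n := by
  simp [card, ofTuple, Finset.card_image_of_injective _ hv]

theorem insert_ofTuple {n : ℕ} (v : Fin n → ℝ × J) (p : ℝ × J) :
    (ofTuple v).insert p = ofTuple (Fin.cons p v) := by
  apply ext_points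
  ext q
  simp [insert, ofTuple, Fin.exists_fin_succ, eq_comm]

theorem erase_ofTuple {n : ℕ} {v : Fin (n + 1) → ℝ × J} (hv : Function.Injective v)
    (i : Fin (n + 1)) : (ofTuple v).erase (v i) = ofTuple fun k => v (i.succAbove k) := by
  apply ext_points
  ext q
  simp only [erase, Finset.mem_erase, mem_ofTuple]
  constructor
  · rintro ⟨h, k, rfl⟩
    obtain ⟨k, rfl⟩ := Fin.exists_succAbove_eq (x := k) (y := i) (fun h' => h (h' ▸ rfl))
    exact ⟨k, rfl⟩
  · rintro ⟨k, rfl⟩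
    exact ⟨fun h => Fin.succAbove_ne i k (hv h), _, rfl⟩

theorem union_ofTuple {m n : ℕ} (v : Fin m → ℝ × J) (w : Fin n → ℝ × J) :
    (ofTuple v).union (ofTuple w) = ofTuple (Fin.append v w) := by
  apply ext_points
  ext q
  simp only [union, Finset.mem_union, mem_ofTuple]
  constructor
  · rintro (⟨i, rfl⟩ | ⟨i, rfl⟩)
    · exact ⟨Fin.castAdd n i, by simp⟩
    · exact ⟨Fin.natAdd m i, by simp⟩
  · rintro ⟨i, rfl⟩
    refine Fin.addCases (fun i => ?_) (fun i => ?_) i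
    · exact Or.inl ⟨i, by simp⟩
    · exact Or.inr ⟨i, by simp⟩

theorem insert_erase {τ : Chain J} {p : ℝ × J} (h : p ∈ τ.points) :
    (τ.erase p).insert p = τ := by
  apply ext_points
  ext q
  by_cases hq : q = p <;> simp_all [insert, erase]

theorem union_insert (σ ρ : Chain J) (p : ℝ × J) :
    σ.union (ρ.insert p) = (σ.union ρ).insert p := by
  apply ext_points
  ext q
  simp [union, insert]

theorem insert_union (σ ρ : Chain J) (p : ℝ × J) :
    (σ.insert p).union ρ = (σ.union ρ).insert p := by
  apply ext_points
  ext q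
  simp [union, insert]

/-- A strictly increasing enumeration of a finite set is unique. The sigma type carries its length,
so that no transport along an equality of cardinalities is needed later. -/
theorem sigma_orderEmbOfFin {α : Type*} [LinearOrder α] (s : Finset α) {m : ℕ} (w : Fin m → α)
    (hw : StrictMono w) (hs : Finset.univ.image w = s) :
    (⟨s.card, s.orderEmbOfFin rfl⟩ : Σ n, Fin n → α) = ⟨m, w⟩ := by
  have h : s.card = m := by
    rw [← hs, Finset.card_image_of_injective _ hw.injective, Finset.card_fin]
  subst h
  congr
  refine (Finset.orderEmbOfFin_unique rfl (fun x => ?_) hw).symm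
  rw [← hs]
  exact Finset.mem_image_of_mem _ (Finset.mem_univ _)

variable [MeasurableSpace J]

theorem measurable_ofTuple (n : ℕ) :
    Measurable fun v : Fin n → ℝ × J => (ofTuple v : Chain J) :=
  fun _ hA => MeasurableSpace.measurableSet_iInf.1 hA n

theorem measurableSet_iff {A : Set (Chain J)} : MeasurableSet A ↔
    ∀ n : ℕ, MeasurableSet ((fun v : Fin n → ℝ × J => (ofTuple v : Chain J)) ⁻¹' A) :=
  MeasurableSpace.measurableSet_iInf

variable [Countable J] [MeasurableSingletonClass J]

/-- A measurable enumeration of the points of a chain. -/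
theorem exists_section : ∃ S : Chain J → Σ n : ℕ, Fin n → ℝ × J, Measurable S ∧
    ∀ τ, ofTuple (S τ).2 = τ ∧ Function.Injective (S τ).2 := by
  obtain ⟨e, he⟩ := exists_injective_nat J
  -- Points are ordered by their instants and, at equal instants, by a numbering of the marks; a
  -- chain is then enumerated in increasing order.
  let key : ℝ × J → ℝ ×ₗ ℕ := fun p => toLex (p.1, e p.2)
  have hkey : Function.Injective key := by
    rintro ⟨s, j⟩ ⟨s', j'⟩ h
    have := toLex.injective h
    simp only [Prod.mk.injEq] at this
    rw [this.1, he this.2]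
  let : LinearOrder (ℝ × J) := LinearOrder.lift' key hkey
  have hlt : MeasurableSet {x : (ℝ × J) × (ℝ × J) | x.1 < x.2} := by
    have : {x : (ℝ × J) × (ℝ × J) | x.1 < x.2} =
        {x | x.1.1 < x.2.1} ∪ ({x | x.1.1 = x.2.1} ∩ {x | e x.1.2 < e x.2.2}) := by
      ext x
      exact Prod.Lex.toLex_lt_toLex
    rw [this]
    have he' : Measurable e := measurable_of_countable e
    exact (measurableSet_lt (by fun_prop) (by fun_prop)).union
      ((measurableSet_eq_fun (by fun_prop) (by fun_prop)).inter
        (measurableSet_lt (by fun_prop) (by fun_prop)))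
  let S : Chain J → Σ n : ℕ, Fin n → ℝ × J := fun τ =>
    ⟨τ.points.card, τ.points.orderEmbOfFin rfl⟩
  have hS : ∀ {m : ℕ} (w : Fin m → ℝ × J) (τ : Chain J), StrictMono w → ofTuple w = τ →
      S τ = ⟨m, w⟩ := fun w τ hw h =>
    sigma_orderEmbOfFin _ w hw (by rw [← h]; ext p; simp)
  have hS' : ∀ τ, ofTuple (S τ).2 = τ := by
    intro τ
    apply ext_points
    have := Finset.range_orderEmbOfFin τ.points rfl
    ext p
    rw [mem_ofTuple, ← Finset.mem_coe, ← this]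
    rfl
  refine ⟨S, fun A hA => ?_, fun τ => ⟨hS' τ, (τ.points.orderEmbOfFin rfl).injective⟩⟩
  rw [measurableSet_iff]
  intro n
  -- The sorted list of the values of `v` is `v ∘ f` for some selection `f` of indices. There are
  -- countably many `(m, f)`, and for each the conditions that `v ∘ f` increase and exhaust the
  -- values are measurable.
  have key : (fun v : Fin n → ℝ × J => (ofTuple v : Chain J)) ⁻¹' (S ⁻¹' A) =
      ⋃ m : ℕ, ⋃ f : Fin m → Fin n, ({v | ∀ i j, i < j → v (f i) < v (f j)} ∩
        {v | ∀ k, ∃ i, v k = v (f i)} ∩ {v | (⟨m, v ∘ f⟩ : Σ n : ℕ, Fin n → ℝ × J) ∈ A}) := by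
    ext v
    simp only [mem_preimage, mem_iUnion]
    constructor
    · intro h
      have h1 : ∀ i, ∃ k, v k = (S (ofTuple v)).2 i := by
        intro i
        have : (S (ofTuple v)).2 i ∈ (ofTuple (S (ofTuple v)).2).points := mem_ofTuple.2 ⟨i, rfl⟩
        rw [hS'] at this
        exact mem_ofTuple.1 this
      choose f hf using h1
      refine ⟨_, f, ⟨fun i j hij => ?_, fun k => ?_⟩, ?_⟩
      · rw [hf, hf]
        exact ((ofTuple v).points.orderEmbOfFin rfl).strictMono hij
      · have : v k ∈ (ofTuple v).points := mem_ofTuple.2 ⟨k, rfl⟩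
        rw [← hS' (ofTuple v), mem_ofTuple] at this
        obtain ⟨i, hi⟩ := this
        exact ⟨i, by rw [hf, hi]⟩
      · have : v ∘ f = (S (ofTuple v)).2 := funext hf
        rw [Set.mem_ofPred, this]
        exact h
    · rintro ⟨m, f, ⟨h1, h2⟩, h3⟩
      rw [hS (v ∘ f) (ofTuple v) (fun i j h => h1 i j h)]
      · exact h3
      · apply ext_points
        ext p
        simp only [mem_ofTuple, Function.comp]
        constructor
        · rintro ⟨i, rfl⟩
          exact ⟨_, rfl⟩
        · rintro ⟨k, rfl⟩
          obtain ⟨i, hi⟩ := h2 k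
          exact ⟨i, hi.symm⟩
  rw [key]
  refine MeasurableSet.iUnion fun m => MeasurableSet.iUnion fun f => (MeasurableSet.inter ?_ ?_).inter ?_
  · simp only [Set.ofPred_forall]
    refine MeasurableSet.iInter fun i => MeasurableSet.iInter fun j => MeasurableSet.iInter fun _ => ?_
    exact (show Measurable fun v : Fin n → ℝ × J => (v (f i), v (f j)) by fun_prop) hlt
  · simp only [Set.ofPred_forall, Set.ofPred_exists]
    refine MeasurableSet.iInter fun i => MeasurableSet.iUnion fun j => ?_
    have h' : ∀ x : Fin n → ℝ × J, x i = x (f j) ↔ (x i).1 = (x (f j)).1 ∧ (x i).2 = (x (f j)).2 :=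
      fun x => Prod.ext_iff
    simp only [h']
    refine MeasurableSet.inter (s₁ := {x : Fin n → ℝ × J | (x i).1 = (x (f j)).1})
      (s₂ := {x : Fin n → ℝ × J | (x i).2 = (x (f j)).2})
      (measurableSet_eq_fun (by fun_prop) (by fun_prop)) ?_
    exact (show Measurable fun x : Fin n → ℝ × J => ((x i).2, (x (f j)).2) by fun_prop)
      (Set.to_countable (diagonal J)).measurableSet
  · have h1 : Measurable (Sigma.mk (β := fun n : ℕ => Fin n → ℝ × J) m) :=
      fun B hB => MeasurableSpace.measurableSet_iInf.1 hB m
    have h2 : Measurable fun v : Fin n → ℝ × J => v ∘ f := by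
      simp only [Function.comp_def]; fun_prop
    exact (h1.comp h2) hA

theorem measurableEmbedding_sigmaMk {β : ℕ → Type*} [∀ n, MeasurableSpace (β n)] (n : ℕ) :
    MeasurableEmbedding (Sigma.mk n : β n → Σ n, β n) where
  injective := sigma_mk_injective
  measurable := fun B hB => MeasurableSpace.measurableSet_iInf.1 hB n
  measurableSet_image' := by
    intro A hA
    refine MeasurableSpace.measurableSet_iInf.2 fun m => ?_
    change MeasurableSet (Sigma.mk m ⁻¹' (Sigma.mk n '' A))
    by_cases h : n = m
    · subst h
      rwa [preimage_image_eq _ sigma_mk_injective]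
    · convert MeasurableSet.empty
      ext x
      simp only [mem_preimage, mem_image, Sigma.mk.injEq, mem_empty_iff_false, iff_false]
      rintro ⟨y, _, h', _⟩
      exact h h'

/-- A function of a parameter and of a chain is measurable if it is measurable in terms of
injective tuples. -/
theorem measurable_uncurry {Y Z : Type*} [MeasurableSpace Y] [MeasurableSpace Z]
    {H : Y → Chain J → Z} (Hn : ∀ n : ℕ, Y → (Fin n → ℝ × J) → Z)
    (hn : ∀ n, Measurable (Function.uncurry (Hn n)))
    (h : ∀ n y (v : Fin n → ℝ × J), Function.Injective v → H y (ofTuple v) = Hn n y v) :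
    Measurable (Function.uncurry H) := by
  obtain ⟨S, hS, hS'⟩ := exists_section (J := J)
  -- Through the measurable enumeration, `H` becomes a function on a disjoint union of tuple spaces,
  -- where measurability is checked on each summand.
  have h1 : Function.uncurry H = (fun x : Y × (Σ n : ℕ, Fin n → ℝ × J) => Hn x.2.1 x.1 x.2.2) ∘
      (Prod.map id S) := by
    ext ⟨y, τ⟩
    simp only [Function.uncurry, Function.comp, Prod.map, id]
    rw [← h _ _ _ (hS' τ).2, (hS' τ).1]
  rw [h1]
  refine Measurable.comp ?_ (measurable_id.prodMap hS)
  intro A hA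
  have h2 : (fun x : Y × (Σ n : ℕ, Fin n → ℝ × J) => Hn x.2.1 x.1 x.2.2) ⁻¹' A =
      ⋃ n, Prod.map id (Sigma.mk n) '' (Function.uncurry (Hn n) ⁻¹' A) := by
    ext ⟨y, n, v⟩
    simp only [mem_preimage, mem_iUnion, mem_image, Prod.exists, Prod.map, id, Prod.mk.injEq,
      Function.uncurry]
    constructor
    · intro h
      exact ⟨n, y, v, h, rfl, rfl⟩
    · rintro ⟨n, y, v, h, rfl, h'⟩
      cases h'
      exact h
  rw [h2]
  exact MeasurableSet.iUnion fun n =>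
    (MeasurableEmbedding.id.prodMap (measurableEmbedding_sigmaMk n)).measurableSet_image.2
      (hn n hA)

theorem measurable_of_tuple {Z : Type*} [MeasurableSpace Z]
    {H : Chain J → Z} (Hn : ∀ n : ℕ, (Fin n → ℝ × J) → Z) (hn : ∀ n, Measurable (Hn n))
    (h : ∀ n (v : Fin n → ℝ × J), Function.Injective v → H (ofTuple v) = Hn n v) :
    Measurable H :=
  (measurable_uncurry (Y := Unit) (H := fun _ => H) (fun n _ => Hn n)
    (fun n => (hn n).comp measurable_snd) fun n _ v => h n v).comp
      (measurable_const (a := ()).prodMk measurable_id)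

/-- Used for the separability of the `L²` spaces over the chains, on which the construction of
jointly measurable versions depends. -/
instance : MeasurableSpace.CountablyGenerated (Chain J) := by
  obtain ⟨S, hS, hS'⟩ := exists_section (J := J)
  -- `univ` is added to the generators of each tuple space because complements are taken inside the
  -- layer of `n`-point chains, which must itself be generated.
  let gen : Set (Set (Chain J)) := ⋃ n : ℕ, (fun b => S ⁻¹' (Sigma.mk n '' b)) ''
    (Insert.insert univ (MeasurableSpace.countableGeneratingSet (Fin n → ℝ × J)))
  refine ⟨gen, countable_iUnion fun n =>
    ((MeasurableSpace.countable_countableGeneratingSet).insert _).image _, le_antisymm ?_ ?_⟩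
  · intro A hA
    have h1 : ∀ n (B : Set (Fin n → ℝ × J)), MeasurableSet B →
        MeasurableSet[MeasurableSpace.generateFrom gen] (S ⁻¹' (Sigma.mk n '' B)) := by
      intro n B hB
      have huniv : MeasurableSet[MeasurableSpace.generateFrom gen] (S ⁻¹' (Sigma.mk n '' univ)) :=
        MeasurableSpace.measurableSet_generateFrom
          (mem_iUnion.2 ⟨n, mem_image_of_mem _ (mem_insert _ _)⟩)
      rw [← MeasurableSpace.generateFrom_countableGeneratingSet (α := Fin n → ℝ × J)] at hB
      induction B, hB using MeasurableSpace.generateFrom_induction with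
      | hC b hb _ =>
        exact MeasurableSpace.measurableSet_generateFrom
          (mem_iUnion.2 ⟨n, mem_image_of_mem _ (mem_insert_of_mem _ hb)⟩)
      | empty => simp
      | compl b _ hb =>
        rw [compl_eq_univ_sdiff, image_sdiff sigma_mk_injective, preimage_sdiff]
        exact huniv.diff hb
      | iUnion b _ hb =>
        rw [image_iUnion, preimage_iUnion]
        exact MeasurableSet.iUnion hb
    have h2 : A = ⋃ n, S ⁻¹' (Sigma.mk n '' {v | ofTuple v ∈ A}) := by
      ext τ
      simp only [mem_iUnion, mem_preimage, mem_image]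
      constructor
      · intro h
        refine ⟨(S τ).1, (S τ).2, ?_, rfl⟩
        rwa [Set.mem_ofPred, (hS' τ).1]
      · rintro ⟨n, v, hv, h⟩
        have := (hS' τ).1
        rw [← h] at this
        rw [← this]
        exact hv
    rw [h2]
    exact MeasurableSet.iUnion fun n => h1 n _ (measurable_ofTuple n hA)
  · refine MeasurableSpace.generateFrom_le ?_
    intro A hA
    obtain ⟨n, b, hb, rfl⟩ := mem_iUnion.1 hA
    refine hS ((measurableEmbedding_sigmaMk n).measurableSet_image.2 ?_)
    rcases hb with rfl | hb
    · exact MeasurableSet.univ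
    · exact MeasurableSpace.measurableSet_countableGeneratingSet hb

theorem measurable_card : Measurable (card : Chain J → ℕ) :=
  measurable_of_tuple (fun n _ => n) (fun _ => measurable_const) fun _ _ hv => card_ofTuple hv

theorem measurable_insert : Measurable fun x : Chain J × (ℝ × J) => x.1.insert x.2 := by
  have : Measurable (Function.uncurry fun (p : ℝ × J) (τ : Chain J) => τ.insert p) := by
    refine measurable_uncurry (fun n p v => ofTuple (Fin.cons p v)) (fun n => ?_)
      fun n p v _ => insert_ofTuple v p
    refine (measurable_ofTuple (n + 1)).comp (measurable_pi_iff.2 fun i => ?_)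
    refine Fin.cases ?_ (fun i => ?_) i
    · simpa using measurable_fst
    · simp only [Fin.cons_succ]; fun_prop
  exact this.comp measurable_swap

theorem measurable_union : Measurable fun x : Chain J × Chain J => x.1.union x.2 := by
  refine measurable_uncurry (H := fun (σ ρ : Chain J) => σ.union ρ)
    (fun n σ v => σ.union (ofTuple v)) (fun n => ?_) fun n p v _ => rfl
  have : Measurable (Function.uncurry fun (v : Fin n → ℝ × J) (σ : Chain J) => σ.union (ofTuple v)) := by
    refine measurable_uncurry (fun m v w => ofTuple (Fin.append w v)) (fun m => ?_)
      fun m v w _ => union_ofTuple w v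
    refine (measurable_ofTuple (m + n)).comp (measurable_pi_iff.2 fun i => ?_)
    refine Fin.addCases (fun i => ?_) (fun i => ?_) i
    · simp only [Fin.append_left]; fun_prop
    · simp only [Fin.append_right]; fun_prop
  exact this.comp measurable_swap

/-- Sums over the points of a chain are measurable. -/
theorem measurable_sum_points {Y M : Type*} [MeasurableSpace Y] [AddCommMonoid M]
    [MeasurableSpace M] [MeasurableAdd₂ M] {q : ℝ × J → Prop} (hq : MeasurableSet {p | q p})
    {F : Y → ℝ × J → Chain J → M}
    (hF : Measurable fun x : Y × (ℝ × J) × Chain J => F x.1 x.2.1 x.2.2) :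
    Measurable (Function.uncurry fun (y : Y) (τ : Chain J) =>
      ∑ p ∈ τ.points with q p, F y p (τ.erase p)) := by
  refine measurable_uncurry (fun n y v => ∑ i : Fin n, if q (v i) then
      F y (v i) (match n, v, i with | _ + 1, v, i => ofTuple fun k => v (i.succAbove k)) else 0)
    (fun n => ?_) ?_
  · refine Finset.measurable_sum _ fun i _ => ?_
    cases n with
    | zero => exact i.elim0
    | succ n =>
      refine Measurable.ite ?_ ?_ measurable_const
      · exact (show Measurable fun x : Y × (Fin (n + 1) → ℝ × J) => x.2 i by fun_prop) hq
      · refine hF.comp (measurable_fst.prodMk (Measurable.prodMk (by fun_prop) ?_))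
        exact (measurable_ofTuple n).comp (by fun_prop)
  · intro n y v hv
    rw [sum_ofTuple hv, Finset.sum_filter]
    refine Finset.sum_congr rfl fun i _ => ?_
    cases n with
    | zero => exact i.elim0
    | succ n => simp only [erase_ofTuple hv]

end Chain

/-! ### The measure on the space of chains -/

section ChainMeasure

variable {J : Type*} [MeasurableSpace J]

/-- `ds` on `B` times the counting measure on the marks. -/
def pointMeasure (J : Type*) [MeasurableSpace J] (B : Set ℝ) : Measure (ℝ × J) :=
  (volume.restrict B).prod Measure.count

theorem lintegral_chainMeasure (B : Set ℝ) {F : Chain J → ℝ≥0∞} (hF : Measurable F) :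
    ∫⁻ τ, F τ ∂chainMeasure J B = ∑' n : ℕ, ((n.factorial : ℝ≥0∞)⁻¹) *
      ∫⁻ v, F (Chain.ofTuple v) ∂(Measure.pi fun _ : Fin n => pointMeasure J B) := by
  rw [chainMeasure, lintegral_sum_measure]
  congr with n
  rw [lintegral_smul_measure, lintegral_map hF (Chain.measurable_ofTuple n)]
  rfl

variable [Countable J] [MeasurableSingletonClass J]

instance (B : Set ℝ) : SigmaFinite (pointMeasure J B) := by
  unfold pointMeasure; infer_instance

instance (B : Set ℝ) : SFinite (chainMeasure J B) := by
  unfold chainMeasure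
  have : ∀ n : ℕ, SFinite (((n.factorial : ℝ≥0∞)⁻¹) •
    (Measure.pi fun _ : Fin n => (volume.restrict B).prod (Measure.count : Measure J)).map
      (fun v => Chain.ofTuple v)) := fun n => inferInstance
  infer_instance

instance (B : Set ℝ) (I : Type*) [MeasurableSpace I] [Countable I] [MeasurableSingletonClass I] :
    SFinite (fockMeasure J B I) := by
  unfold fockMeasure; infer_instance

theorem pointMeasure_singleton (B : Set ℝ) (p : ℝ × J) : pointMeasure J B {p} = 0 := by
  rw [pointMeasure, ← singleton_prod_singleton, Measure.prod_prod]
  simp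

theorem lintegral_pi_succAbove {n : ℕ} {α : Type*} [MeasurableSpace α] (μ : Measure α)
    [SigmaFinite μ] (i : Fin (n + 1)) {F : α → (Fin n → α) → ℝ≥0∞}
    (hF : Measurable (Function.uncurry F)) :
    ∫⁻ v, F (v i) (fun k => v (i.succAbove k)) ∂(Measure.pi fun _ : Fin (n + 1) => μ) =
      ∫⁻ p, ∫⁻ w, F p w ∂(Measure.pi fun _ : Fin n => μ) ∂μ := by
  refine Eq.trans ?_ (lintegral_prod (Function.uncurry F) hF.aemeasurable)
  rw [← (measurePreserving_piFinSuccAbove (fun _ : Fin (n + 1) => μ) i).lintegral_comp hF]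
  rfl

/-- Lebesgue measure has no atoms, so two entries of a tuple coincide only on a null set. Tuples
with repetitions, whose chain has too few points, may therefore be ignored. -/
theorem ae_injective_tuple (B : Set ℝ) (n : ℕ) :
    ∀ᵐ v ∂(Measure.pi fun _ : Fin n => pointMeasure J B), Function.Injective v := by
  have : ∀ i j : Fin n, i ≠ j →
      ∀ᵐ v ∂(Measure.pi fun _ : Fin n => pointMeasure J B), v i ≠ v j := by
    intro i j hij
    cases n with
    | zero => exact i.elim0
    | succ n =>
      obtain ⟨k, rfl⟩ := Fin.exists_succAbove_eq hij.symm
      have hm : MeasurableSet {x : (ℝ × J) × (Fin n → ℝ × J) | x.1 = x.2 k} := by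
        have : {x : (ℝ × J) × (Fin n → ℝ × J) | x.1 = x.2 k} =
          {x | x.1.1 = (x.2 k).1} ∩ (fun x => (x.1.2, (x.2 k).2)) ⁻¹' (diagonal J) := by
            ext x; exact Prod.ext_iff
        rw [this]
        exact (measurableSet_eq_fun (by fun_prop) (by fun_prop)).inter
          ((show Measurable fun x : (ℝ × J) × (Fin n → ℝ × J) => (x.1.2, (x.2 k).2) by fun_prop)
            (Set.to_countable _).measurableSet)
      have h0 : ∀ᵐ x ∂((pointMeasure J B).prod (Measure.pi fun _ : Fin n => pointMeasure J B)),
          x.1 ≠ x.2 k := by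
        rw [ae_iff]
        simp only [not_not]
        rw [Measure.prod_apply_symm hm, lintegral_eq_zero_iff' (by
          exact (measurable_measure_prodMk_right hm).aemeasurable)]
        refine Eventually.of_forall fun w => ?_
        exact pointMeasure_singleton B (w k)
      exact (measurePreserving_piFinSuccAbove (fun _ : Fin (n + 1) => pointMeasure J B)
        i).quasiMeasurePreserving.ae h0
  filter_upwards [ae_all_iff.2 fun i => ae_all_iff.2 fun j => ae_all_iff.2 (this i j)] with v h
  exact fun i j hij => by_contra fun hne => h i j hne hij

/-- Integration of a sum over the points of a chain. -/
theorem lintegral_sum_erase (B : Set ℝ) {G : ℝ × J → Chain J → ℝ≥0∞}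
    (hG : Measurable (Function.uncurry G)) :
    ∫⁻ τ, ∑ p ∈ τ.points, G p (τ.erase p) ∂chainMeasure J B =
      ∫⁻ p, ∫⁻ τ, G p τ ∂chainMeasure J B ∂pointMeasure J B := by
  have hm : Measurable fun τ : Chain J => ∑ p ∈ τ.points, G p (τ.erase p) := by
    have := (Chain.measurable_sum_points (Y := Unit) (q := fun _ : ℝ × J => True)
      (F := fun _ p τ => G p τ) (by simp) (hG.comp measurable_snd)).comp
      (measurable_const (a := ()).prodMk measurable_id)
    simpa [Function.comp_def, Function.uncurry] using this
  have hG' : ∀ p, Measurable (G p) := fun p => hG.comp (measurable_const.prodMk measurable_id)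
  have hGn : ∀ n : ℕ, Measurable (Function.uncurry fun (p : ℝ × J) (w : Fin n → ℝ × J) =>
      G p (Chain.ofTuple w)) := fun n =>
    hG.comp (measurable_fst.prodMk ((Chain.measurable_ofTuple n).comp measurable_snd))
  rw [lintegral_chainMeasure B hm]
  simp_rw [lintegral_chainMeasure B (hG' _)]
  rw [lintegral_tsum fun n => ((hGn n).lintegral_prod_right).aemeasurable.const_mul _]
  -- The empty chain has no point to remove. On `(n+1)`-point chains the `n + 1` choices of the
  -- removed point contribute equally, and `(n + 1)/(n + 1)! = 1/n!` gives the `n`-point term on the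
  -- right.
  rw [tsum_eq_zero_add' ENNReal.summable]
  have h0 : ∫⁻ v, ∑ p ∈ (Chain.ofTuple v).points, G p ((Chain.ofTuple v).erase p)
      ∂(Measure.pi fun _ : Fin 0 => pointMeasure J B) = 0 := by
    simp [Chain.ofTuple]
  rw [h0, mul_zero, zero_add]
  congr with n
  have h1 : ∫⁻ v, ∑ p ∈ (Chain.ofTuple v).points, G p ((Chain.ofTuple v).erase p)
      ∂(Measure.pi fun _ : Fin (n + 1) => pointMeasure J B) =
      ∫⁻ v, ∑ i, G (v i) (Chain.ofTuple fun k => v (i.succAbove k))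
        ∂(Measure.pi fun _ : Fin (n + 1) => pointMeasure J B) := by
    refine lintegral_congr_ae ?_
    filter_upwards [ae_injective_tuple B (n + 1)] with v hv
    have := Chain.sum_ofTuple hv (fun _ => True) fun p => G p ((Chain.ofTuple v).erase p)
    simp only [Finset.filter_true] at this
    rw [this]
    simp only [Chain.erase_ofTuple hv]
  rw [h1, lintegral_finsetSum _ fun i _ => ?_]
  · have h2 : ∀ i : Fin (n + 1), ∫⁻ v, G (v i) (Chain.ofTuple fun k => v (i.succAbove k))
        ∂(Measure.pi fun _ : Fin (n + 1) => pointMeasure J B) =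
        ∫⁻ p, ∫⁻ w, G p (Chain.ofTuple w) ∂(Measure.pi fun _ : Fin n => pointMeasure J B)
          ∂pointMeasure J B := fun i =>
      lintegral_pi_succAbove (pointMeasure J B) i (hGn n)
    rw [lintegral_const_mul _ (hGn n).lintegral_prod_right]
    simp only [h2, Finset.sum_const, Finset.card_univ, Fintype.card_fin, nsmul_eq_mul]
    rw [← mul_assoc, Nat.factorial_succ]
    congr 1
    push_cast
    rw [ENNReal.mul_inv (by simp) (by simp), mul_right_comm, ENNReal.inv_mul_cancel (by simp)
      (by simp), one_mul]
  · exact (hGn n).comp (Measurable.prodMk (measurable_pi_apply i) (by fun_prop))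

theorem lintegral_pointMeasure (B : Set ℝ) {H : ℝ × J → Chain J → ℝ≥0∞}
    (hH : Measurable (Function.uncurry H)) :
    ∫⁻ p, ∫⁻ τ, H p τ ∂chainMeasure J B ∂pointMeasure J B =
      ∫⁻ s in B, ∫⁻ x, H (s, x.2) x.1 ∂fockMeasure J B J := by
  have h1 : Measurable fun p => ∫⁻ τ, H p τ ∂chainMeasure J B := hH.lintegral_prod_right
  rw [pointMeasure, lintegral_prod _ h1.aemeasurable]
  refine lintegral_congr fun s => ?_
  have h2 : Measurable fun x : Chain J × J => H (s, x.2) x.1 :=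
    hH.comp ((measurable_const.prodMk measurable_snd).prodMk measurable_fst)
  rw [fockMeasure, lintegral_prod_symm _ h2.aemeasurable]

/-- Almost every chain has a property of its points `p` and of the rest of it that almost every
point and almost every chain have. -/
theorem ae_forall_erase {B : Set ℝ} {P : ℝ × J → Chain J → Prop}
    (h : ∀ᵐ x ∂((volume.restrict B).prod (fockMeasure J B J)), P (x.1, x.2.2) x.2.1) :
    ∀ᵐ τ ∂chainMeasure J B, ∀ p ∈ τ.points, P p (τ.erase p) := by
  obtain ⟨N, hN, hNm, hN0⟩ := exists_measurable_superset_of_null h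
  let N' : Set ((ℝ × J) × Chain J) := (fun y => (y.1.1, (y.2, y.1.2))) ⁻¹' N
  have hN'm : MeasurableSet N' :=
    (show Measurable fun y : (ℝ × J) × Chain J => (y.1.1, (y.2, y.1.2)) by fun_prop) hNm
  -- The indicator of the exceptional null set has double integral zero. By `lintegral_sum_erase`
  -- the integral of its sum over the points of `τ` is zero too, so for almost every `τ` no point
  -- meets the exceptional set.
  have hG : Measurable (Function.uncurry fun (p : ℝ × J) (τ : Chain J) =>
      N'.indicator (1 : (ℝ × J) × Chain J → ℝ≥0∞) (p, τ)) := measurable_one.indicator hN'm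
  have h1 := lintegral_sum_erase B hG
  rw [lintegral_pointMeasure B hG] at h1
  have h2 : ∫⁻ s in B, ∫⁻ x, N'.indicator (1 : (ℝ × J) × Chain J → ℝ≥0∞) ((s, x.2), x.1)
      ∂fockMeasure J B J = 0 := by
    have h3 : Measurable fun y : ℝ × Chain J × J =>
        N'.indicator (1 : (ℝ × J) × Chain J → ℝ≥0∞) ((y.1, y.2.2), y.2.1) :=
      (measurable_one.indicator hN'm).comp
        (show Measurable fun y : ℝ × Chain J × J => ((y.1, y.2.2), y.2.1) by fun_prop)
    rw [← lintegral_prod (fun y : ℝ × Chain J × J =>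
      N'.indicator (1 : (ℝ × J) × Chain J → ℝ≥0∞) ((y.1, y.2.2), y.2.1)) h3.aemeasurable]
    have h4 : (fun y : ℝ × Chain J × J =>
      N'.indicator (1 : (ℝ × J) × Chain J → ℝ≥0∞) ((y.1, y.2.2), y.2.1)) = N.indicator 1 := rfl
    rw [h4, lintegral_indicator_one hNm, hN0]
  rw [h2, lintegral_eq_zero_iff'] at h1
  · filter_upwards [h1] with τ hτ p hp
    simp only [Pi.zero_apply, Finset.sum_eq_zero_iff] at hτ
    by_contra hP
    have := hτ p hp
    rw [indicator_of_mem] at this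
    · simp at this
    · exact hN hP
  · have := (Chain.measurable_sum_points (Y := Unit) (q := fun _ : ℝ × J => True)
      (F := fun _ p τ => N'.indicator (1 : (ℝ × J) × Chain J → ℝ≥0∞) (p, τ)) (by simp)
      (hG.comp measurable_snd)).comp (measurable_const (a := ()).prodMk measurable_id)
    simpa [Function.comp_def, Function.uncurry] using this.aemeasurable

theorem measurable_insert_time : Measurable fun y : ℝ × Chain J × J => y.2.1.insert (y.1, y.2.2) :=
  Chain.measurable_insert.comp
    (show Measurable fun y : ℝ × Chain J × J => (y.2.1, (y.1, y.2.2)) by fun_prop)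

/-- A chain `τ` arises as `σ ⊔ p` in `|τ|` ways, one for each of its points. -/
theorem lintegral_insert (B : Set ℝ) {F : Chain J → ℝ≥0∞} (hF : Measurable F) :
    ∫⁻ s in B, ∫⁻ x, F (x.1.insert (s, x.2)) ∂fockMeasure J B J =
      ∫⁻ τ, τ.card * F τ ∂chainMeasure J B := by
  have hG : Measurable (Function.uncurry fun (p : ℝ × J) (τ : Chain J) => F (τ.insert p)) :=
    hF.comp (Chain.measurable_insert.comp measurable_swap)
  rw [← lintegral_pointMeasure B hG, ← lintegral_sum_erase B hG]
  refine lintegral_congr fun τ => ?_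
  rw [Finset.sum_congr rfl fun p hp => by rw [Chain.insert_erase hp]]
  simp [Chain.card]

/-- This makes `φ(τ ⊔ (s, j))` meaningful for a class `φ`: by `lintegral_insert`, changing `φ` on a
null set of chains changes it only on a null set of triples `(s, τ, j)`. -/
theorem quasiMeasurePreserving_insert (B : Set ℝ) :
    Measure.QuasiMeasurePreserving (fun y : ℝ × Chain J × J => y.2.1.insert (y.1, y.2.2))
      ((volume.restrict B).prod (fockMeasure J B J)) (chainMeasure J B) := by
  refine ⟨measurable_insert_time, Measure.AbsolutelyContinuous.mk fun N hN h0 => ?_⟩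
  rw [Measure.map_apply measurable_insert_time hN, ← lintegral_indicator_one
    (measurable_insert_time hN), lintegral_prod _ (measurable_one.indicator
    (measurable_insert_time hN)).aemeasurable]
  have := lintegral_insert B (F := N.indicator 1) (measurable_one.indicator hN)
  refine Eq.trans this ?_
  rw [lintegral_eq_zero_iff' (by
    exact ((measurable_from_nat (f := fun n => (n : ℝ≥0∞))).comp Chain.measurable_card).aemeasurable.mul
      (measurable_one.indicator hN).aemeasurable)]
  filter_upwards [compl_mem_ae_iff.2 h0] with τ hτ
  simp [indicator_of_notMem hτ]

theorem ae_points_mem {B : Set ℝ} (hB : MeasurableSet B) :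
    ∀ᵐ τ ∂chainMeasure J B, ∀ p ∈ τ.points, p.1 ∈ B := by
  refine ae_forall_erase (P := fun p _ => p.1 ∈ B) ?_
  exact Measure.quasiMeasurePreserving_fst.ae (ae_restrict_mem hB)

end ChainMeasure

/-! ### Factorization of the measure on the space of chains -/

section Factorization

variable {J : Type*} [MeasurableSpace J] [Countable J] [MeasurableSingletonClass J]

theorem measurable_union_right (σ : Chain J) : Measurable fun ρ : Chain J => σ.union ρ :=
  Chain.measurable_union.comp (measurable_const.prodMk measurable_id)

theorem measurable_insert_left (p : ℝ × J) : Measurable fun σ : Chain J => σ.insert p :=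
  Chain.measurable_insert.comp (measurable_id.prodMk measurable_const)

/-- The integral over the chains of values of `n`-tuples. -/
def tupleIntegral (n : ℕ) (μ : Measure (ℝ × J)) (F : Chain J → ℝ≥0∞) : ℝ≥0∞ :=
  ∫⁻ v, F (Chain.ofTuple v) ∂(Measure.pi fun _ : Fin n => μ)

theorem tupleIntegral_zero (μ : Measure (ℝ × J)) [SigmaFinite μ] (F : Chain J → ℝ≥0∞) :
    tupleIntegral 0 μ F = F ⟨∅⟩ := by
  have : ∀ v : Fin 0 → ℝ × J, Chain.ofTuple v = ⟨∅⟩ := fun v => by simp [Chain.ofTuple]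
  simp [tupleIntegral, this]

theorem tupleIntegral_succ (n : ℕ) (μ : Measure (ℝ × J)) [SigmaFinite μ] {F : Chain J → ℝ≥0∞}
    (hF : Measurable F) :
    tupleIntegral (n + 1) μ F = ∫⁻ p, tupleIntegral n μ (fun τ => F (τ.insert p)) ∂μ := by
  have h : Measurable (Function.uncurry fun (p : ℝ × J) (w : Fin n → ℝ × J) =>
      F ((Chain.ofTuple w).insert p)) :=
    hF.comp (Chain.measurable_insert.comp
      (((Chain.measurable_ofTuple n).comp measurable_snd).prodMk measurable_fst))
  unfold tupleIntegral
  rw [← lintegral_pi_succAbove μ 0 h]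
  refine lintegral_congr fun v => ?_
  rw [Chain.insert_ofTuple]
  congr 2
  ext i : 1
  refine Fin.cases ?_ (fun i => ?_) i <;> simp

theorem measurable_tupleIntegral {Y : Type*} [MeasurableSpace Y] (n : ℕ) (μ : Measure (ℝ × J))
    [SigmaFinite μ] {F : Y → Chain J → ℝ≥0∞} (hF : Measurable (Function.uncurry F)) :
    Measurable fun y => tupleIntegral n μ (F y) := by
  have : Measurable fun x : Y × (Fin n → ℝ × J) => F x.1 (Chain.ofTuple x.2) :=
    hF.comp (measurable_fst.prodMk ((Chain.measurable_ofTuple n).comp measurable_snd))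
  exact this.lintegral_prod_right'

theorem tupleIntegral_lintegral {Y : Type*} [MeasurableSpace Y] (n : ℕ) (μ : Measure (ℝ × J))
    [SigmaFinite μ] (ν : Measure Y) [SFinite ν] {F : Y → Chain J → ℝ≥0∞}
    (hF : Measurable (Function.uncurry F)) :
    tupleIntegral n μ (fun τ => ∫⁻ y, F y τ ∂ν) = ∫⁻ y, tupleIntegral n μ (F y) ∂ν := by
  have : Measurable fun x : (Fin n → ℝ × J) × Y => F x.2 (Chain.ofTuple x.1) :=
    hF.comp (measurable_snd.prodMk ((Chain.measurable_ofTuple n).comp measurable_fst))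
  exact lintegral_lintegral_swap this.aemeasurable

/-- The binomial theorem for integrals of symmetric functions. In the induction one point is split
off; it falls under `μ` or under `ν`, and Pascal's rule collects the two contributions. -/
theorem tupleIntegral_add (n : ℕ) (μ ν : Measure (ℝ × J)) [SigmaFinite μ] [SigmaFinite ν] :
    ∀ {F : Chain J → ℝ≥0∞}, Measurable F → tupleIntegral n (μ + ν) F =
      ∑ ij ∈ Finset.HasAntidiagonal.antidiagonal n, (n.choose ij.1 : ℝ≥0∞) *
        tupleIntegral ij.1 μ fun σ => tupleIntegral ij.2 ν fun ρ => F (σ.union ρ) := by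
  induction n with
  | zero =>
    intro F _
    simp [tupleIntegral_zero, Chain.union]
  | succ n ih =>
    intro F hF
    have hFp : ∀ p, Measurable fun τ : Chain J => F (τ.insert p) := fun p =>
      hF.comp (measurable_insert_left p)
    have hF3 : Measurable fun x : ((ℝ × J) × Chain J) × Chain J =>
        F ((x.1.2.union x.2).insert x.1.1) :=
      hF.comp (Chain.measurable_insert.comp ((Chain.measurable_union.comp
        (show Measurable fun x : ((ℝ × J) × Chain J) × Chain J => (x.1.2, x.2) by fun_prop)).prodMk
        (by fun_prop)))
    have hm2 : ∀ j, Measurable (Function.uncurry fun (p : ℝ × J) (σ : Chain J) =>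
        tupleIntegral j ν fun ρ => F ((σ.union ρ).insert p)) := fun j =>
      measurable_tupleIntegral (Y := (ℝ × J) × Chain J) j ν
        (F := fun y ρ => F ((y.2.union ρ).insert y.1)) hF3
    have hm1 : ∀ i j, Measurable fun p : ℝ × J => tupleIntegral i μ fun σ =>
        tupleIntegral j ν fun ρ => F ((σ.union ρ).insert p) := fun i j =>
      measurable_tupleIntegral i μ (hm2 j)
    rw [tupleIntegral_succ n _ hF, lintegral_add_measure]
    simp_rw [ih (hFp _)]
    rw [lintegral_finsetSum _ fun ij _ => (hm1 _ _).const_mul _,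
      lintegral_finsetSum _ fun ij _ => (hm1 _ _).const_mul _]
    simp_rw [lintegral_const_mul _ (hm1 _ _)]
    have hl : ∀ i j, ∫⁻ p, tupleIntegral i μ (fun σ =>
        tupleIntegral j ν fun ρ => F ((σ.union ρ).insert p)) ∂μ =
        tupleIntegral (i + 1) μ fun σ => tupleIntegral j ν fun ρ => F (σ.union ρ) := by
      intro i j
      rw [tupleIntegral_succ i μ (F := fun σ => tupleIntegral j ν fun ρ => F (σ.union ρ))
        (measurable_tupleIntegral (Y := Chain J) j ν (F := fun σ ρ => F (σ.union ρ))
          (hF.comp Chain.measurable_union))]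
      simp_rw [Chain.insert_union]
    have hr : ∀ i j, ∫⁻ p, tupleIntegral i μ (fun σ =>
        tupleIntegral j ν fun ρ => F ((σ.union ρ).insert p)) ∂ν =
        tupleIntegral i μ fun σ => tupleIntegral (j + 1) ν fun ρ => F (σ.union ρ) := by
      intro i j
      rw [← tupleIntegral_lintegral i μ ν (hm2 j)]
      congr with σ
      rw [tupleIntegral_succ j ν (F := fun ρ => F (σ.union ρ))
        (hF.comp (measurable_union_right σ))]
      simp_rw [Chain.union_insert]
    simp_rw [hl, hr]
    rw [Finset.sum_antidiagonal_choose_succ_mul (fun i j => tupleIntegral i μ fun σ =>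
      tupleIntegral j ν fun ρ => F (σ.union ρ)), add_comm]
    congr 1
    refine Finset.sum_congr rfl fun ij hij => ?_
    rw [← Finset.HasAntidiagonal.mem_antidiagonal.1 hij, Nat.choose_symm_add]

/-- The exponential law `exp(μ + ν) = exp μ · exp ν`: by `tupleIntegral_add` the weight of `i`
points in `B₁` and `j` points in `B₂` is `C(i+j, i)/(i+j)! = 1/(i! j!)`. -/
theorem lintegral_chainMeasure_union {B₁ B₂ : Set ℝ} (h₂ : MeasurableSet B₂)
    (hd : Disjoint B₁ B₂) {F : Chain J → ℝ≥0∞} (hF : Measurable F) :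
    ∫⁻ τ, F τ ∂chainMeasure J (B₁ ∪ B₂) =
      ∫⁻ ρ, ∫⁻ σ, F (σ.union ρ) ∂chainMeasure J B₁ ∂chainMeasure J B₂ := by
  have hm : Measurable fun x : Chain J × Chain J => F (x.1.union x.2) :=
    hF.comp Chain.measurable_union
  have hν : pointMeasure J (B₁ ∪ B₂) = pointMeasure J B₁ + pointMeasure J B₂ := by
    unfold pointMeasure
    rw [Measure.restrict_union hd h₂, Measure.add_prod]
  have hm2 : ∀ j, Measurable fun σ : Chain J =>
      tupleIntegral j (pointMeasure J B₂) fun ρ => F (σ.union ρ) := fun j =>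
    measurable_tupleIntegral (Y := Chain J) j _ (F := fun σ ρ => F (σ.union ρ)) hm
  have hc : ∀ (B : Set ℝ) {H : Chain J → ℝ≥0∞}, Measurable H → ∫⁻ τ, H τ ∂chainMeasure J B =
      ∑' n : ℕ, ((n.factorial : ℝ≥0∞)⁻¹) * tupleIntegral n (pointMeasure J B) H :=
    fun B _ hH => lintegral_chainMeasure B hH
  rw [lintegral_lintegral_swap (f := fun ρ σ => F (Chain.union σ ρ))
    (hm.comp measurable_swap).aemeasurable, hc _ hF, hν,
    hc B₁ (by exact hm.lintegral_prod_right')]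
  simp_rw [tupleIntegral_add _ _ _ hF]
  have h1 : ∀ σ : Chain J, ∫⁻ ρ, F (σ.union ρ) ∂chainMeasure J B₂ =
      ∑' n : ℕ, ((n.factorial : ℝ≥0∞)⁻¹) *
        tupleIntegral n (pointMeasure J B₂) fun ρ => F (σ.union ρ) :=
    fun σ => hc _ (hF.comp (measurable_union_right σ))
  simp_rw [h1]
  have h2 : ∀ i, tupleIntegral i (pointMeasure J B₁) (fun σ => ∑' n : ℕ, ((n.factorial : ℝ≥0∞)⁻¹) *
        tupleIntegral n (pointMeasure J B₂) fun ρ => F (σ.union ρ)) =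
      ∑' n : ℕ, ((n.factorial : ℝ≥0∞)⁻¹) * tupleIntegral i (pointMeasure J B₁) (fun σ =>
        tupleIntegral n (pointMeasure J B₂) fun ρ => F (σ.union ρ)) := by
    intro i
    exact (lintegral_tsum fun n => (((hm2 n).comp (Chain.measurable_ofTuple i)).const_mul
      _).aemeasurable).trans (tsum_congr fun n => lintegral_const_mul _
        ((hm2 n).comp (Chain.measurable_ofTuple i)))
  simp_rw [h2, ← ENNReal.tsum_mul_left]
  rw [← ENNReal.tsum_prod (f := fun i j => ((i.factorial : ℝ≥0∞)⁻¹) * (((j.factorial : ℝ≥0∞)⁻¹) *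
    tupleIntegral i (pointMeasure J B₁) (fun σ =>
        tupleIntegral j (pointMeasure J B₂) fun ρ => F (σ.union ρ)))),
    -- The double series over `(i, j)` is summed along the antidiagonals `i + j = n`.
    ← Finset.HasAntidiagonal.sigmaAntidiagonalEquivProd.tsum_eq, ENNReal.tsum_sigma']
  congr with n
  rw [tsum_fintype, Finset.mul_sum, ← Finset.sum_coe_sort (Finset.HasAntidiagonal.antidiagonal n)]
  refine Finset.sum_congr rfl fun ij _ => ?_
  obtain ⟨⟨i, j⟩, hij⟩ := ij
  have hij' := Finset.HasAntidiagonal.mem_antidiagonal.1 hij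
  simp only [Finset.HasAntidiagonal.sigmaAntidiagonalEquivProd_apply]
  rw [← mul_assoc, ← mul_assoc]
  congr 1
  have := Nat.choose_mul_factorial_mul_factorial (n := n) (k := i) (by simp at hij'; omega)
  have hj : n - i = j := by simp at hij'; omega
  rw [hj] at this
  rw [← this]
  push_cast
  have h3 : (i.factorial : ℝ≥0∞) ≠ 0 := by exact_mod_cast i.factorial_ne_zero
  have h4 : (j.factorial : ℝ≥0∞) ≠ 0 := by exact_mod_cast j.factorial_ne_zero
  have h5 : (n.choose i : ℝ≥0∞) ≠ 0 := by
    exact_mod_cast (Nat.choose_pos (by simp at hij'; omega)).ne'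
  rw [ENNReal.mul_inv (Or.inr (by simp)) (Or.inr h4), ENNReal.mul_inv (by simp) (by simp),
    mul_right_comm, mul_right_comm (_⁻¹), ENNReal.inv_mul_cancel h5 (by simp), one_mul]

/-- `(ρ, (σ, i)) ↦ (σ ⊔ ρ, i)`. -/
def joinChain {I : Type*} (y : Chain J × Chain J × I) : Chain J × I := (y.2.1.union y.1, y.2.2)

theorem measurable_joinChain {I : Type*} [MeasurableSpace I] :
    Measurable (joinChain : Chain J × Chain J × I → Chain J × I) :=
  (Chain.measurable_union.comp
    (show Measurable fun y : Chain J × Chain J × I => (y.2.1, y.1) by fun_prop)).prodMk (by fun_prop)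

/-- The factorization into past and future at time `r`, the additional index remaining with the
past. It translates statements about chains in `]0, ∞[` into statements about the fibres over the
future chains `ρ`. -/
theorem measurePreserving_joinChain {r : ℝ} (hr : 0 ≤ r) {I : Type*} [MeasurableSpace I]
    [Countable I] [MeasurableSingletonClass I] :
    MeasurePreserving joinChain ((chainMeasure J (Ioi r)).prod (fockMeasure J (Ioc 0 r) I))
      (fockMeasure J (Ioi 0) I) := by
  refine ⟨measurable_joinChain, Measure.ext_of_lintegral _ fun F hF => ?_⟩
  rw [lintegral_map hF measurable_joinChain, lintegral_prod (fun a => F (joinChain a))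
    (hF.comp measurable_joinChain).aemeasurable, fockMeasure, fockMeasure,
    lintegral_prod_symm _ hF.aemeasurable]
  have hFi : ∀ i, Measurable fun τ => F (τ, i) := fun i => hF.comp (by fun_prop)
  have hB : Ioi (0 : ℝ) = Ioc 0 r ∪ Ioi r := (Ioc_union_Ioi_eq_Ioi hr).symm
  have h1 : ∀ i, ∫⁻ τ, F (τ, i) ∂chainMeasure J (Ioi 0) =
      ∫⁻ ρ, ∫⁻ σ, F (σ.union ρ, i) ∂chainMeasure J (Ioc 0 r) ∂chainMeasure J (Ioi r) := by
    intro i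
    rw [hB, lintegral_chainMeasure_union measurableSet_Ioi
      (Set.disjoint_left.2 fun x hx hx' => not_lt.2 hx.2 hx') (hFi i)]
  simp_rw [h1]
  have h3 : Measurable fun x : (Chain J × I) × Chain J => F (x.1.1.union x.2, x.1.2) :=
    hF.comp ((Chain.measurable_union.comp
      (show Measurable fun x : (Chain J × I) × Chain J => (x.1.1, x.2) by fun_prop)).prodMk
        (by fun_prop))
  have h2 : ∀ ρ : Chain J, ∫⁻ x, F (joinChain (ρ, x))
      ∂(chainMeasure J (Ioc 0 r)).prod Measure.count =
      ∫⁻ i, ∫⁻ σ, F (σ.union ρ, i) ∂chainMeasure J (Ioc 0 r) ∂(Measure.count : Measure I) := by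
    intro ρ
    exact lintegral_prod_symm _
      (hF.comp (measurable_joinChain.comp (measurable_const.prodMk measurable_id))).aemeasurable
  simp_rw [h2]
  rw [lintegral_lintegral_swap]
  refine Measurable.aemeasurable ?_
  have h4 : Measurable fun y : (Chain J × I) × Chain J => F (y.2.union y.1.1, y.1.2) :=
    hF.comp ((Chain.measurable_union.comp
      (show Measurable fun x : (Chain J × I) × Chain J => (x.2, x.1.1) by fun_prop)).prodMk
        (by fun_prop))
  exact h4.lintegral_prod_right'

theorem ae_join {r : ℝ} (hr : 0 ≤ r) {I : Type*} [MeasurableSpace I]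
    [Countable I] [MeasurableSingletonClass I] {P : Chain J × I → Prop}
    (h : ∀ᵐ x ∂fockMeasure J (Ioi 0) I, P x) :
    ∀ᵐ ρ ∂chainMeasure J (Ioi r), ∀ᵐ x ∂fockMeasure J (Ioc 0 r) I, P (x.1.union ρ, x.2) :=
  Measure.ae_ae_of_ae_prod ((measurePreserving_joinChain hr).quasiMeasurePreserving.ae h)

theorem ae_of_ae_join {r : ℝ} (hr : 0 ≤ r) {I : Type*} [MeasurableSpace I]
    [Countable I] [MeasurableSingletonClass I] {P : Chain J × I → Prop}
    (hP : MeasurableSet {x | P x})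
    (h : ∀ᵐ ρ ∂chainMeasure J (Ioi r), ∀ᵐ x ∂fockMeasure J (Ioc 0 r) I, P (x.1.union ρ, x.2)) :
    ∀ᵐ x ∂fockMeasure J (Ioi 0) I, P x := by
  rw [← (measurePreserving_joinChain hr).map_eq, ae_map_iff measurable_joinChain.aemeasurable hP]
  exact (Measure.ae_prod_iff_ae_ae (measurable_joinChain hP)).2 h

theorem measurableSet_singleton_empty : MeasurableSet ({⟨∅⟩} : Set (Chain J)) := by
  have hS : ({⟨∅⟩} : Set (Chain J)) = Chain.card ⁻¹' {0} := by
    ext τ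
    simp only [mem_singleton_iff, mem_preimage, Chain.card, Finset.card_eq_zero]
    exact ⟨fun h => by rw [h], fun h => Chain.ext_points h⟩
  exact hS ▸ Chain.measurable_card (measurableSet_singleton 0)

theorem chainMeasure_singleton_empty (B : Set ℝ) : chainMeasure J B {⟨∅⟩} = 1 := by
  have hm := measurableSet_singleton_empty (J := J)
  rw [← lintegral_indicator_one hm, lintegral_chainMeasure B (measurable_one.indicator hm),
    tsum_eq_single 0]
  · simp [Chain.ofTuple]
  · intro n hn
    have : ∀ v : Fin n → ℝ × J, Chain.ofTuple v ∉ ({⟨∅⟩} : Set (Chain J)) := by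
      intro v hv
      have : v ⟨0, Nat.pos_of_ne_zero hn⟩ ∈ (Chain.ofTuple v).points := Chain.mem_ofTuple.2 ⟨_, rfl⟩
      rw [mem_singleton_iff.1 hv] at this
      simp at this
    simp [this]

theorem ae_fockMeasure_unit {B : Set ℝ} {P : Chain J × Unit → Prop} :
    (∀ᵐ x ∂fockMeasure J B Unit, P x) ↔ ∀ᵐ τ ∂chainMeasure J B, P (τ, ()) := by
  have h1 : (Measure.count : Measure Unit) = Measure.dirac () := by
    ext s hs
    rcases Set.eq_empty_or_nonempty s with rfl | ⟨x, hx⟩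
    · simp
    · have : s = univ := eq_univ_of_forall fun y => hx
      simp [this]
  rw [fockMeasure, h1, Measure.prod_dirac]
  exact MeasurableEquiv.prodPUnit.symm.measurableEmbedding.ae_map_iff

theorem ae_fockMeasure_iff {B : Set ℝ} {I : Type*} [MeasurableSpace I]
    [Countable I] [MeasurableSingletonClass I] {P : Chain J × I → Prop} :
    (∀ᵐ x ∂fockMeasure J B I, P x) ↔ ∀ i, ∀ᵐ τ ∂chainMeasure J B, P (τ, i) := by
  constructor
  · intro h i
    have h1 : ∀ᵐ y ∂((Measure.count : Measure I).prod (chainMeasure J B)), P (y.2, y.1) :=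
      (Measure.measurePreserving_swap (μ := (Measure.count : Measure I))
        (ν := chainMeasure J B)).quasiMeasurePreserving.ae h
    have h2 := ae_iff.1 (Measure.ae_ae_of_ae_prod h1)
    rw [Measure.count_eq_zero_iff] at h2
    by_contra hi
    exact notMem_empty i (h2 ▸ hi)
  · intro h
    have h1 : {x : Chain J × I | ¬ P x} ⊆ ⋃ i, {τ | ¬ P (τ, i)} ×ˢ {i} := by
      rintro ⟨τ, i⟩ hx
      exact mem_iUnion.2 ⟨i, hx, rfl⟩
    refine measure_mono_null h1 (measure_iUnion_null fun i => ?_)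
    rw [fockMeasure, Measure.prod_prod, ae_iff.1 (h i), zero_mul]

end Factorization

/-! ### The norms of the Fock scale -/

section ScaleNorm

variable {J : Type*} [MeasurableSpace J] {B : Set ℝ} {I : Type*} [MeasurableSpace I]

namespace FockFun

/-- The class of a measurable function. -/
def mk (f : Chain J × I → ℂ) (hf : Measurable f) : FockFun J B I :=
  AEEqFun.mk f hf.aestronglyMeasurable

theorem coe_mk (f : Chain J × I → ℂ) (hf : Measurable f) :
    (mk f hf : FockFun J B I) =ᵐ[fockMeasure J B I] f :=
  AEEqFun.coeFn_mk _ _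

theorem measurable (f : FockFun J B I) : Measurable (f : Chain J × I → ℂ) :=
  (AEEqFun.stronglyMeasurable _).measurable

theorem ext_ae {f g : FockFun J B I} (h : (f : Chain J × I → ℂ) =ᵐ[fockMeasure J B I] g) : f = g :=
  AEEqFun.ext h

theorem coe_add (f g : FockFun J B I) :
    ((f + g : FockFun J B I) : Chain J × I → ℂ) =ᵐ[fockMeasure J B I] fun x => f x + g x :=
  AEEqFun.coeFn_add f g

theorem coe_sub (f g : FockFun J B I) :
    ((f - g : FockFun J B I) : Chain J × I → ℂ) =ᵐ[fockMeasure J B I] fun x => f x - g x :=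
  AEEqFun.coeFn_sub f g

theorem coe_smul (c : ℂ) (f : FockFun J B I) :
    ((c • f : FockFun J B I) : Chain J × I → ℂ) =ᵐ[fockMeasure J B I] fun x => c * f x :=
  AEEqFun.coeFn_smul c f

theorem coe_zero :
    ((0 : FockFun J B I) : Chain J × I → ℂ) =ᵐ[fockMeasure J B I] fun _ => 0 :=
  AEEqFun.coeFn_zero

theorem coe_sum {α : Type*} (s : Finset α) (f : α → FockFun J B I) :
    ((∑ a ∈ s, f a : FockFun J B I) : Chain J × I → ℂ) =ᵐ[fockMeasure J B I]
      fun x => ∑ a ∈ s, f a x := by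
  induction s using Finset.induction_on with
  | empty => simpa using coe_zero
  | insert a s ha ih =>
    rw [Finset.sum_insert ha]
    filter_upwards [coe_add (f a) (∑ a ∈ s, f a), ih] with x h1 h2
    rw [h1, h2, Finset.sum_insert ha]

end FockFun

variable (J B I) in
/-- The measure `η ^ |τ| dτ`. -/
def scaleMeasure (η : ℝ) : Measure (Chain J × I) :=
  (fockMeasure J B I).withDensity fun x => ENNReal.ofReal (η ^ x.1.card)

theorem eLpNorm_two_sq {X : Type*} [MeasurableSpace X] (μ : Measure X) (f : X → ℂ) :
    eLpNorm f 2 μ ^ 2 = ∫⁻ x, ‖f x‖ₑ ^ 2 ∂μ := by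
  have := eLpNorm_nnreal_pow_eq_lintegral (f := f) (μ := μ) (p := 2) (by norm_num)
  simpa using this

variable [Countable J] [MeasurableSingletonClass J]

theorem measurable_weight (η : ℝ) :
    Measurable fun x : Chain J × I => ENNReal.ofReal (η ^ x.1.card) :=
  (measurable_from_nat (f := fun n => ENNReal.ofReal (η ^ n))).comp
    (Chain.measurable_card.comp measurable_fst)

theorem scaleNorm_sq (η : ℝ) (f : Chain J × I → ℂ) :
    scaleNorm J B I η f ^ 2 =
      ∫⁻ x, ENNReal.ofReal (η ^ x.1.card) * ‖f x‖ₑ ^ 2 ∂fockMeasure J B I := by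
  rw [scaleNorm, eLpNorm_two_sq, lintegral_withDensity_eq_lintegral_mul_non_measurable _
    (measurable_weight η) (by simp)]
  rfl

theorem scaleMeasure_ac (η : ℝ) : scaleMeasure J B I η ≪ fockMeasure J B I :=
  withDensity_absolutelyContinuous _ _

theorem ac_scaleMeasure {η : ℝ} (hη : 0 < η) : fockMeasure J B I ≪ scaleMeasure J B I η :=
  withDensity_absolutelyContinuous' (measurable_weight η).aemeasurable
    (Eventually.of_forall fun x => by simp [pow_pos hη])

theorem scaleNorm_congr (η : ℝ) {f g : Chain J × I → ℂ} (h : f =ᵐ[fockMeasure J B I] g) :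
    scaleNorm J B I η f = scaleNorm J B I η g :=
  eLpNorm_congr_ae ((scaleMeasure_ac η).ae_eq h)

theorem scaleNorm_zero (η : ℝ) : scaleNorm J B I η (0 : FockFun J B I) = 0 := by
  rw [scaleNorm_congr η FockFun.coe_zero]
  exact eLpNorm_zero

theorem scaleNorm_mono_weight {η η' : ℝ} (h0 : 0 ≤ η) (h : η ≤ η') (f : Chain J × I → ℂ) :
    scaleNorm J B I η f ≤ scaleNorm J B I η' f := by
  refine eLpNorm_mono_measure _ (withDensity_mono (Eventually.of_forall fun x => ?_))
  exact ENNReal.ofReal_le_ofReal (pow_le_pow_left₀ h0 h _)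

theorem ae_eq_zero_of_scaleNorm {η : ℝ} (hη : 0 < η) {f : Chain J × I → ℂ}
    (hf : Measurable f) (h : scaleNorm J B I η f = 0) : f =ᵐ[fockMeasure J B I] 0 := by
  refine (ac_scaleMeasure hη).ae_eq ?_
  exact (eLpNorm_eq_zero_iff hf.aestronglyMeasurable (by norm_num)).1 h

theorem scaleNorm_add_le (η : ℝ) {f g : Chain J × I → ℂ}
    (hf : Measurable f) (hg : Measurable g) :
    scaleNorm J B I η (fun x => f x + g x) ≤ scaleNorm J B I η f + scaleNorm J B I η g :=
  eLpNorm_add_le hf.aestronglyMeasurable hg.aestronglyMeasurable (by norm_num)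

theorem memLp_of_scaleNorm {η : ℝ} {f : Chain J × I → ℂ} (hf : Measurable f)
    (h : scaleNorm J B I η f < ⊤) : MemLp f 2 (scaleMeasure J B I η) :=
  ⟨hf.aestronglyMeasurable, h⟩

theorem memLp_scale {S : Set ℝ} {η : ℝ} (hη : η ∈ S) (f : scaleSpace J B I S) :
    MemLp (f.1 : Chain J × I → ℂ) 2 (scaleMeasure J B I η) :=
  memLp_of_scaleNorm f.1.measurable (f.2 η hη)

/-- The inclusion of the scale into the Hilbert space `𝒢(η)`. -/
def toHilbert {S : Set ℝ} {η : ℝ} (hη : η ∈ S) :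
    scaleSpace J B I S →ₗ[ℂ] Lp ℂ 2 (scaleMeasure J B I η) where
  toFun f := (memLp_scale hη f).toLp _
  map_add' f g := by
    rw [← MemLp.toLp_add]
    exact MemLp.toLp_congr _ _ ((scaleMeasure_ac η).ae_eq (FockFun.coe_add f.1 g.1))
  map_smul' c f := by
    rw [RingHom.id_apply, ← MemLp.toLp_const_smul]
    exact MemLp.toLp_congr _ _ ((scaleMeasure_ac η).ae_eq (FockFun.coe_smul c f.1))

theorem coe_toHilbert {S : Set ℝ} {η : ℝ} (hη : η ∈ S) (h0 : 0 < η) (f : scaleSpace J B I S) :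
    (toHilbert hη f : Chain J × I → ℂ) =ᵐ[fockMeasure J B I] f.1 :=
  (ac_scaleMeasure h0).ae_eq (MemLp.coeFn_toLp (memLp_scale hη f))

theorem enorm_toHilbert {S : Set ℝ} {η : ℝ} (hη : η ∈ S) (f : scaleSpace J B I S) :
    ‖toHilbert hη f‖ₑ = scaleNorm J B I η f.1 :=
  Lp.enorm_toLp (memLp_scale hη f)

theorem norm_toHilbert {S : Set ℝ} {η : ℝ} (hη : η ∈ S) (f : scaleSpace J B I S) :
    ‖toHilbert hη f‖ = (scaleNorm J B I η f.1).toReal :=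
  Lp.norm_toLp _ (memLp_scale hη f)

theorem toHilbert_injective {S : Set ℝ} {η : ℝ} (hη : η ∈ S) (h0 : 0 < η) :
    Function.Injective (toHilbert (J := J) (B := B) (I := I) hη) := by
  intro f g h
  refine Subtype.ext (FockFun.ext_ae ?_)
  have h1 := coe_toHilbert hη h0 f
  rw [h] at h1
  exact h1.symm.trans (coe_toHilbert hη h0 g)

theorem integral_scaleMeasure {η : ℝ} (h0 : 0 < η) (F : Chain J × I → ℂ) :
    ∫ x, F x ∂scaleMeasure J B I η =
      ∫ x, ((η ^ x.1.card : ℝ) : ℂ) * F x ∂fockMeasure J B I := by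
  rw [scaleMeasure, integral_withDensity_eq_integral_toReal_smul (measurable_weight η) (by simp)]
  refine integral_congr_ae (Eventually.of_forall fun x => ?_)
  simp only
  rw [ENNReal.toReal_ofReal (pow_pos h0 _).le, Complex.real_smul]

theorem measurable_pow_card (η : ℝ) :
    Measurable fun x : Chain J × I => ((η ^ x.1.card : ℝ) : ℂ) :=
  (measurable_from_nat (f := fun n => ((η ^ n : ℝ) : ℂ))).comp
    (Chain.measurable_card.comp measurable_fst)

/-- The Cauchy–Schwarz inequality for the duality between `𝒢(1/η)` and `𝒢(η)`. -/
theorem lintegral_mul_le_scaleNorm {η : ℝ} (h0 : 0 < η) {f g : Chain J × I → ℂ}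
    (hf : Measurable f) (hg : Measurable g) :
    ∫⁻ x, ‖f x‖ₑ * ‖g x‖ₑ ∂fockMeasure J B I ≤
      scaleNorm J B I η⁻¹ f * scaleNorm J B I η g := by
  -- The weights are moved into the functions as `√η ^ |τ|`, so that those of the two factors cancel
  -- in the product in Hölder's inequality.
  have h1 : ∀ (η : ℝ) (f : Chain J × I → ℂ), 0 < η → scaleNorm J B I η f =
      (∫⁻ x, (ENNReal.ofReal (√η ^ x.1.card) * ‖f x‖ₑ) ^ (2 : ℝ) ∂fockMeasure J B I)
        ^ (1 / 2 : ℝ) := by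
    intro η f hη
    have : ∀ x : Chain J × I, (ENNReal.ofReal (√η ^ x.1.card) * ‖f x‖ₑ) ^ (2 : ℝ) =
        ENNReal.ofReal (η ^ x.1.card) * ‖f x‖ₑ ^ 2 := by
      intro x
      rw [ENNReal.rpow_two, mul_pow, ← ENNReal.ofReal_pow (by positivity), ← pow_mul, mul_comm _ 2,
        pow_mul, Real.sq_sqrt hη.le]
    simp_rw [this]
    rw [← scaleNorm_sq, ← ENNReal.rpow_two, ← ENNReal.rpow_mul]
    norm_num
  rw [h1 _ _ h0, h1 _ _ (inv_pos.2 h0)]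
  have h2 := ENNReal.lintegral_mul_le_Lp_mul_Lq (fockMeasure J B I)
    (Real.HolderConjugate.two_two)
    (f := fun x => ENNReal.ofReal (√η⁻¹ ^ x.1.card) * ‖f x‖ₑ)
    (g := fun x => ENNReal.ofReal (√η ^ x.1.card) * ‖g x‖ₑ)
    ((measurable_weight _).mul hf.enorm).aemeasurable
    ((measurable_weight _).mul hg.enorm).aemeasurable
  refine le_trans (le_of_eq (lintegral_congr fun x => ?_)) h2
  simp only [Pi.mul_apply]
  rw [mul_mul_mul_comm, ← ENNReal.ofReal_mul (by positivity), ← mul_pow, ← Real.sqrt_mul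
    (inv_pos.2 h0).le, inv_mul_cancel₀ h0.ne']
  simp

theorem integrable_mul_of_scaleNorm {η : ℝ} (h0 : 0 < η) {f g : Chain J × I → ℂ}
    (hf : Measurable f) (hg : Measurable g) (hf' : scaleNorm J B I η⁻¹ f < ⊤)
    (hg' : scaleNorm J B I η g < ⊤) :
    Integrable (fun x => f x * g x) (fockMeasure J B I) := by
  refine ⟨(hf.mul hg).aestronglyMeasurable, ?_⟩
  refine lt_of_le_of_lt ?_ (lt_of_le_of_lt (lintegral_mul_le_scaleNorm (B := B) h0 hf hg)
    (ENNReal.mul_lt_top hf' hg'))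
  exact le_of_eq (lintegral_congr fun x => enorm_mul _ _)

theorem scaleNorm_conj (η : ℝ) (f : Chain J × I → ℂ) :
    scaleNorm J B I η (fun x => starRingEnd ℂ (f x)) = scaleNorm J B I η f :=
  eLpNorm_congr_norm_ae (Eventually.of_forall fun x => by simp)

theorem integrable_pairing (χ : FockPlus J B I) (ψ : FockMinus J B I) :
    Integrable (fun x => starRingEnd ℂ (χ.1 x) * ψ.1 x) (fockMeasure J B I) := by
  refine integrable_mul_of_scaleNorm (η := 1 / 2) (by norm_num)
    (Complex.continuous_conj.measurable.comp χ.1.measurable) ψ.1.measurable ?_ ?_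
  · exact (scaleNorm_conj _ _).trans_lt (χ.2 _ (by norm_num [Set.mem_Ioi]))
  · exact ψ.2 _ (by norm_num [Set.mem_Ioo])

theorem enorm_pairing_le {η : ℝ} (h0 : 0 < η) (χ : FockPlus J B I) (ψ : FockMinus J B I) :
    ‖pairing χ ψ‖ₑ ≤ scaleNorm J B I η⁻¹ χ.1 * scaleNorm J B I η ψ.1 := by
  refine (enorm_integral_le_lintegral_enorm _).trans ?_
  rw [← scaleNorm_conj η⁻¹]
  refine le_trans (le_of_eq (lintegral_congr fun x => enorm_mul _ _))
    (lintegral_mul_le_scaleNorm h0 (Complex.continuous_conj.measurable.comp χ.1.measurable)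
      ψ.1.measurable)

theorem pairing_add (χ : FockPlus J B I) (ψ ψ' : FockMinus J B I) :
    pairing χ (ψ + ψ') = pairing χ ψ + pairing χ ψ' := by
  unfold pairing
  rw [← integral_add (integrable_pairing χ ψ) (integrable_pairing χ ψ')]
  refine integral_congr_ae ?_
  filter_upwards [FockFun.coe_add ψ.1 ψ'.1] with x hx
  rw [← mul_add, ← hx]; rfl

theorem pairing_smul (c : ℂ) (χ : FockPlus J B I) (ψ : FockMinus J B I) :
    pairing χ (c • ψ) = c * pairing χ ψ := by
  unfold pairing
  rw [← integral_const_mul]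
  refine integral_congr_ae ?_
  filter_upwards [FockFun.coe_smul c ψ.1] with x hx
  rw [mul_left_comm, ← hx]; rfl

/-- The pairing as a linear functional of the second argument. -/
def pairingHom (χ : FockPlus J B I) : FockMinus J B I →ₗ[ℂ] ℂ where
  toFun := pairing χ
  map_add' := pairing_add χ
  map_smul' c ψ := pairing_smul c χ ψ

/-- A bounded linear functional on the scale is represented by a function. -/
theorem exists_kernel {S : Set ℝ} {ζ : ℝ} (hζ : ζ ∈ S) (h0 : 0 < ζ)
    (ℓ : scaleSpace J B I S →ₗ[ℂ] ℂ) (c : ℝ)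
    (hc : ∀ u, ‖ℓ u‖ ≤ c * (scaleNorm J B I ζ u.1).toReal) :
    ∃ k : Chain J × I → ℂ, Measurable k ∧ scaleNorm J B I ζ⁻¹ k < ⊤ ∧
      ∀ u, ℓ u = ∫ x, k x * u.1 x ∂fockMeasure J B I := by
  let E := LinearEquiv.ofInjective _ (toHilbert_injective (J := J) (B := B) (I := I) hζ h0)
  -- The functional is defined only on the image of the scale in `𝒢(ζ)`. Hahn–Banach extends it to
  -- the whole Hilbert space and Riesz represents the extension by some `h`.
  let ℓ' : LinearMap.range (toHilbert (J := J) (B := B) (I := I) hζ) →L[ℂ] ℂ :=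
    (ℓ ∘ₗ E.symm.toLinearMap).mkContinuous c (by
      rintro ⟨_, u, rfl⟩
      have : E.symm ⟨toHilbert hζ u, u, rfl⟩ = u := E.symm_apply_apply u
      simp only [LinearMap.comp_apply, LinearEquiv.coe_coe, this]
      exact (hc u).trans (by rw [← norm_toHilbert hζ]; rfl))
  obtain ⟨g, hg, -⟩ := exists_extension_norm_eq _ ℓ'
  let h := (InnerProductSpace.toDual ℂ (Lp ℂ 2 (scaleMeasure J B I ζ))).symm g
  have hh : ∀ x, inner ℂ h x = g x := fun x => InnerProductSpace.toDual_symm_apply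
  have hm : Measurable (h : Chain J × I → ℂ) := (Lp.stronglyMeasurable h).measurable
  -- The weight of the inner product of `𝒢(ζ)` is absorbed into the kernel `ζ^|τ| h̄`, which then
  -- lies in `𝒢(1/ζ)` because `ζ⁻ⁿ |ζⁿ h|² = ζⁿ |h|²`.
  refine ⟨fun x => ((ζ ^ x.1.card : ℝ) : ℂ) * starRingEnd ℂ (h x), (measurable_pow_card ζ).mul
    (Complex.continuous_conj.measurable.comp hm), ?_, fun u => ?_⟩
  · have h1 : scaleNorm J B I ζ⁻¹ (fun x => ((ζ ^ x.1.card : ℝ) : ℂ) * starRingEnd ℂ (h x)) ^ 2 =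
        scaleNorm J B I ζ h ^ 2 := by
      rw [scaleNorm_sq, scaleNorm_sq]
      refine lintegral_congr fun x => ?_
      have hp := pow_pos h0 x.1.card
      rw [enorm_mul, mul_pow, ← mul_assoc]
      congr 1
      · have : ‖((ζ ^ x.1.card : ℝ) : ℂ)‖ₑ = ENNReal.ofReal (ζ ^ x.1.card) := by
          rw [← ofReal_norm, Complex.norm_real, Real.norm_of_nonneg hp.le]
        rw [this, ← ENNReal.ofReal_pow hp.le, ← ENNReal.ofReal_mul (by positivity)]
        congr 1
        rw [inv_pow]
        field_simp
      · congr 1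
        rw [← ofReal_norm, ← ofReal_norm]
        simp
    have h2 : scaleNorm J B I ζ h < ⊤ := (Lp.memLp h).2
    rw [lt_top_iff_ne_top]
    intro h3
    rw [h3] at h1
    simp only [ne_eq, OfNat.ofNat_ne_zero, not_false_eq_true, ENNReal.top_pow] at h1
    exact (ENNReal.pow_lt_top h2).ne h1.symm
  · have h1 : ℓ u = g (toHilbert hζ u) := by
      have h2 := hg ⟨toHilbert hζ u, u, rfl⟩
      have : E.symm ⟨toHilbert hζ u, u, rfl⟩ = u := E.symm_apply_apply u
      simp only [ℓ', LinearMap.mkContinuous_apply, LinearMap.comp_apply, LinearEquiv.coe_coe,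
        this] at h2
      exact h2.symm
    rw [h1, ← hh, L2.inner_def, integral_scaleMeasure h0]
    refine integral_congr_ae ?_
    filter_upwards [coe_toHilbert hζ h0 u] with x hx
    rw [hx, RCLike.inner_apply, mul_comm (u.1 x), mul_assoc]

end ScaleNorm

/-! ### Jointly measurable versions of weakly measurable functions -/

/-- With a dense sequence for `d`, a bound on a norm becomes countably many conditions on inner
products; for a weakly measurable function these are measurable conditions. The proof extends the
bound by density and takes `y = x`. -/
theorem norm_le_of_inner_le_dense {H : Type*} [NormedAddCommGroup H] [InnerProductSpace ℂ H]
    {ι : Type*} {d : ι → H} (hd : DenseRange d) {x : H} {c : ℝ} (hc : 0 ≤ c)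
    (h : ∀ j, ‖(inner ℂ (d j) x : ℂ)‖ ≤ c * ‖d j‖) : ‖x‖ ≤ c := by
  have h1 : ∀ y : H, ‖(inner ℂ y x : ℂ)‖ ≤ c * ‖y‖ := fun y =>
    hd.induction_on (p := fun y => ‖(inner ℂ y x : ℂ)‖ ≤ c * ‖y‖) y
      (isClosed_le (by fun_prop) (by fun_prop)) h
  have h2 := h1 x
  rw [inner_self_eq_norm_sq_to_K] at h2
  simp only [Complex.coe_algebraMap, norm_pow, Complex.norm_real, norm_norm] at h2
  rcases (norm_nonneg x).eq_or_lt with h0 | h0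
  · rwa [← h0]
  · nlinarith

/-- A sequence that converges fast in `L²` converges almost everywhere. -/
theorem ae_tendsto_of_norm_sub_le {X : Type*} [MeasurableSpace X] {μ : Measure X}
    {d : ℕ → Lp ℂ 2 μ} {u : Lp ℂ 2 μ} (h : ∀ n, ‖u - d n‖ ≤ (1 / 2 : ℝ) ^ n) :
    ∀ᵐ x ∂μ, Tendsto (fun n => d n x) atTop (𝓝 (u x)) := by
  have hmeas : ∀ n, Measurable fun x => ‖d n x - u x‖ₑ ^ 2 := fun n =>
    (((Lp.stronglyMeasurable _).measurable.sub (Lp.stronglyMeasurable _).measurable).enorm).pow_const 2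
  -- The squared distances are at most `4⁻ⁿ`, so the sum of the squared differences is integrable,
  -- hence finite almost everywhere, and its terms tend to zero.
  have h1 : ∫⁻ x, ∑' n, ‖d n x - u x‖ₑ ^ 2 ∂μ < ⊤ := by
    rw [lintegral_tsum fun n => (hmeas n).aemeasurable]
    have h2 : ∀ n, ∫⁻ x, ‖d n x - u x‖ₑ ^ 2 ∂μ ≤ ENNReal.ofReal ((1 / 4 : ℝ) ^ n) := by
      intro n
      have h3 : ∫⁻ x, ‖d n x - u x‖ₑ ^ 2 ∂μ = ‖d n - u‖ₑ ^ 2 := by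
        rw [Lp.enorm_def, eLpNorm_two_sq]
        refine lintegral_congr_ae ?_
        filter_upwards [Lp.coeFn_sub (d n) u] with x hx
        rw [hx]; rfl
      rw [h3, ← ofReal_norm, ← ENNReal.ofReal_pow (norm_nonneg _), norm_sub_rev]
      refine ENNReal.ofReal_le_ofReal ?_
      calc ‖u - d n‖ ^ 2 ≤ ((1 / 2 : ℝ) ^ n) ^ 2 := by gcongr; exact h n
        _ = (1 / 4 : ℝ) ^ n := by rw [← pow_mul, mul_comm, pow_mul]; norm_num
    refine (ENNReal.tsum_le_tsum h2).trans_lt ?_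
    rw [← ENNReal.ofReal_tsum_of_nonneg (fun n => by positivity)
      (summable_geometric_of_lt_one (by norm_num) (by norm_num))]
    exact ENNReal.ofReal_lt_top
  filter_upwards [ae_lt_top (Measurable.tsum hmeas) h1.ne] with x hx
  have h3 : Tendsto (fun n => ‖d n x - u x‖ₑ ^ 2) atTop (𝓝 0) :=
    ENNReal.tendsto_atTop_zero_of_tsum_ne_top hx.ne
  have h4 : Tendsto (fun n => ‖d n x - u x‖ₑ) atTop (𝓝 0) := by
    have h5 := h3.ennrpow_const (1 / 2)
    rw [ENNReal.zero_rpow_of_pos (by norm_num)] at h5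
    refine h5.congr fun n => ?_
    rw [← ENNReal.rpow_two, ← ENNReal.rpow_mul]
    norm_num
  rw [tendsto_iff_edist_tendsto_0]
  simpa [edist_eq_enorm_sub] using h4

/-- A weakly measurable function with values in a separable Hilbert space is approximated by
countably valued functions. -/
theorem exists_measurable_index {Ω H : Type*} [MeasurableSpace Ω] [NormedAddCommGroup H]
    [InnerProductSpace ℂ H] (ν : Measure Ω) {d : ℕ → H} (hd : DenseRange d) (U : Ω → H)
    (hU : ∀ h, AEMeasurable (fun s => (inner ℂ h (U s) : ℂ)) ν) {c : ℝ} (hc : 0 < c) :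
    ∃ K : Ω → ℕ, Measurable K ∧ ∀ᵐ s ∂ν, ‖U s - d (K s)‖ ≤ c := by
  let m : ℕ → Ω → ℂ := fun j => (hU (d j)).mk
  have hm : ∀ j, Measurable (m j) := fun j => (hU (d j)).measurable_mk
  have hmU : ∀ᵐ s ∂ν, ∀ j, inner ℂ (d j) (U s) = m j s := ae_all_iff.2 fun j => (hU (d j)).ae_eq_mk
  -- `P s k` expresses `‖U s - d k‖ ≤ c` through the measurable versions `m j` of the inner
  -- products.
  let P : Ω → ℕ → Prop := fun s k => ∀ j, ‖m j s - inner ℂ (d j) (d k)‖ ≤ c * ‖d j‖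
  have hPm : ∀ k, MeasurableSet {s | P s k} := by
    intro k
    simp only [P, Set.ofPred_forall]
    exact MeasurableSet.iInter fun j =>
      measurableSet_le ((hm j).sub_const _).norm measurable_const
  -- The second alternative makes the search for a least `k` succeed for every `s`. Where `m` agrees
  -- with the true inner products it cannot occur, by density of `d`.
  let Q : Ω → ℕ → Prop := fun s k => P s k ∨ ∀ k', ¬ P s k'
  have hQm : ∀ k, MeasurableSet {s | Q s k} := by
    intro k
    refine (hPm k).union (s₂ := {s | ∀ k', ¬ P s k'}) ?_
    rw [Set.ofPred_forall]
    exact MeasurableSet.iInter fun k' => (hPm k').compl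
  have hQ : ∀ s, ∃ k, Q s k := by
    intro s
    by_cases h : ∃ k, P s k
    · exact ⟨h.choose, Or.inl h.choose_spec⟩
    · exact ⟨0, Or.inr fun k hk => h ⟨k, hk⟩⟩
  refine ⟨fun s => Nat.find (hQ s), measurable_find hQ hQm, ?_⟩
  filter_upwards [hmU] with s hs
  have hPn : P s (Nat.find (hQ s)) := by
    rcases Nat.find_spec (hQ s) with h | h
    · exact h
    · exfalso
      obtain ⟨k, hk⟩ := Metric.denseRange_iff.1 hd (U s) c hc
      refine h k fun j => ?_
      rw [← hs j, ← inner_sub_right]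
      refine (norm_inner_le_norm _ _).trans ?_
      rw [mul_comm, ← dist_eq_norm]
      gcongr
  refine norm_le_of_inner_le_dense hd hc.le fun j => ?_
  rw [inner_sub_right, hs j]
  exact hPn j

/-- A weakly measurable family of elements of `L²` has a jointly measurable version. -/
theorem exists_jointly_measurable {Ω X : Type*} [MeasurableSpace Ω] [MeasurableSpace X]
    (ν : Measure Ω) (μ : Measure X) [SecondCountableTopology (Lp ℂ 2 μ)] (U : Ω → Lp ℂ 2 μ)
    (hU : ∀ h, AEMeasurable (fun s => (inner ℂ h (U s) : ℂ)) ν) :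
    ∃ f : Ω → X → ℂ, Measurable (Function.uncurry f) ∧ ∀ᵐ s ∂ν, f s =ᵐ[μ] U s := by
  have hd := TopologicalSpace.denseRange_denseSeq (Lp ℂ 2 μ)
  choose K hK hKU using fun n : ℕ => exists_measurable_index ν hd U hU
    (show (0 : ℝ) < (1 / 2) ^ n by positivity)
  let f : ℕ → Ω × X → ℂ := fun n y => TopologicalSpace.denseSeq (Lp ℂ 2 μ) (K n y.1) y.2
  have hf : ∀ n, Measurable (f n) := by
    intro n
    have h1 : Measurable fun y : ℕ × X => (TopologicalSpace.denseSeq (Lp ℂ 2 μ) y.1 : X → ℂ) y.2 :=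
      measurable_from_prod_countable_right fun k =>
        (Lp.stronglyMeasurable (TopologicalSpace.denseSeq (Lp ℂ 2 μ) k)).measurable
    exact h1.comp (((hK n).comp measurable_fst).prodMk measurable_snd)
  -- The pointwise limit is taken jointly in `(s, x)`; `limUnder` has some value also where there is
  -- no convergence, and is measurable everywhere.
  have hlim : Measurable fun y : Ω × X => limUnder atTop fun n => f n y :=
    (StronglyMeasurable.limUnder fun n => (hf n).stronglyMeasurable).measurable
  refine ⟨fun s x => limUnder atTop fun n => f n (s, x), hlim, ?_⟩
  filter_upwards [ae_all_iff.2 hKU] with s hs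
  filter_upwards [ae_tendsto_of_norm_sub_le hs] with x hx
  exact hx.limUnder_eq

theorem lt_top_of_sq_lt_top {a : ℝ≥0∞} (h : a ^ 2 < ⊤) : a < ⊤ := by
  simpa using h

section Versions

variable {J : Type*} [MeasurableSpace J] [Countable J] [MeasurableSingletonClass J] {B : Set ℝ}
  {I : Type*} [MeasurableSpace I] [Countable I] [MeasurableSingletonClass I]

instance (η : ℝ) : SFinite (scaleMeasure J B I η) := by
  unfold scaleMeasure; infer_instance

instance (η : ℝ) : SecondCountableTopology (Lp ℂ 2 (scaleMeasure J B I η)) := by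
  have : Fact ((2 : ℝ≥0∞) ≠ ⊤) := ⟨by simp⟩
  infer_instance

/-- Cutting off at `N` points puts `η^|τ| h` into every `𝒢(ζ)`, `ζ ≥ 1`, whenever `h ∈ 𝒢(η)`. This
supplies elements of `𝒢⁺` approximating a functional on `𝒢(η)`. -/
theorem scaleNorm_truncate {η ζ : ℝ} (h0 : 0 < η) (hζ : 1 ≤ ζ) (h1 : η ≤ 1) (N : ℕ)
    (h : Chain J × I → ℂ) :
    scaleNorm J B I ζ (fun x => if x.1.card ≤ N then ((η ^ x.1.card : ℝ) : ℂ) * h x else 0) ^ 2 ≤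
      ENNReal.ofReal (ζ ^ N) * scaleNorm J B I η h ^ 2 := by
  rw [scaleNorm_sq, scaleNorm_sq, ← lintegral_const_mul' _ _ (by simp)]
  refine lintegral_mono fun x => ?_
  split_ifs with hx
  · have hp := pow_pos h0 x.1.card
    have : ‖((η ^ x.1.card : ℝ) : ℂ)‖ₑ = ENNReal.ofReal (η ^ x.1.card) := by
      rw [← ofReal_norm, Complex.norm_real, Real.norm_of_nonneg hp.le]
    rw [enorm_mul, mul_pow, this, ← mul_assoc, ← mul_assoc, ← ENNReal.ofReal_pow hp.le,
      ← ENNReal.ofReal_mul (by positivity), ← ENNReal.ofReal_mul (by positivity)]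
    gcongr ENNReal.ofReal ?_ * _
    have h2 : η ^ x.1.card ≤ 1 := pow_le_one₀ h0.le h1
    have h3 : ζ ^ x.1.card ≤ ζ ^ N := pow_le_pow_right₀ hζ hx
    calc ζ ^ x.1.card * (η ^ x.1.card) ^ 2 = ζ ^ x.1.card * η ^ x.1.card * η ^ x.1.card := by ring
      _ ≤ ζ ^ N * η ^ x.1.card * 1 := by gcongr
      _ = _ := mul_one _
  · simp

theorem measurableSet_card_le (N : ℕ) : MeasurableSet {x : Chain J × I | x.1.card ≤ N} :=
  (Chain.measurable_card.comp measurable_fst) (measurableSet_Iic (a := N))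

/-- The functionals on `𝒢(η)`, `η < 1`, are limits of pairings with elements of `𝒢⁺`. -/
theorem exists_tendsto_pairing {η : ℝ} (hη : η ∈ Ioo (0 : ℝ) 1)
    (h : Lp ℂ 2 (scaleMeasure J B I η)) : ∃ χ : ℕ → FockPlus J B I, ∀ ψ : FockMinus J B I,
      Tendsto (fun N => pairing (χ N) ψ) atTop (𝓝 (inner ℂ h (toHilbert hη ψ))) := by
  have hhm : Measurable (h : Chain J × I → ℂ) := (Lp.stronglyMeasurable h).measurable
  have hm : ∀ N, Measurable fun x : Chain J × I =>
      if x.1.card ≤ N then ((η ^ x.1.card : ℝ) : ℂ) * h x else 0 := fun N =>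
    Measurable.ite (measurableSet_card_le N) ((measurable_pow_card η).mul hhm) measurable_const
  have hS : ∀ N, ∀ ζ ∈ Ioi (1 : ℝ), scaleNorm J B I ζ (FockFun.mk _ (hm N) : FockFun J B I) < ⊤ := by
    intro N ζ hζ
    rw [scaleNorm_congr ζ (FockFun.coe_mk _ (hm N))]
    refine lt_top_of_sq_lt_top ((scaleNorm_truncate hη.1 (le_of_lt hζ) hη.2.le N h).trans_lt ?_)
    exact ENNReal.mul_lt_top (by simp) (ENNReal.pow_lt_top (Lp.memLp h).2)
  refine ⟨fun N => ⟨FockFun.mk _ (hm N), hS N⟩, fun ψ => ?_⟩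
  -- The pairing has no weight; the factor `η^|τ|` built into the truncation restores the inner
  -- product of `𝒢(η)`, and dominated convergence removes the cut-off.
  have h1 : ∀ N, pairing (⟨FockFun.mk _ (hm N), hS N⟩ : FockPlus J B I) ψ =
      ∫ x, (if x.1.card ≤ N then starRingEnd ℂ (h x) * toHilbert hη ψ x else 0)
        ∂scaleMeasure J B I η := by
    intro N
    rw [integral_scaleMeasure hη.1, pairing]
    refine integral_congr_ae ?_
    filter_upwards [coe_toHilbert hη hη.1 ψ, FockFun.coe_mk _ (hm N)] with x hx hx'
    rw [hx']
    split_ifs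
    · rw [hx, map_mul, Complex.conj_ofReal, mul_assoc]
    · simp
  have h2 : Integrable (fun x => starRingEnd ℂ (h x) * toHilbert hη ψ x) (scaleMeasure J B I η) := by
    have := L2.integrable_inner (𝕜 := ℂ) h (toHilbert hη ψ)
    simpa only [RCLike.inner_apply, mul_comm] using this
  simp_rw [h1]
  rw [L2.inner_def]
  have h3 : ∀ x, inner ℂ (h x) (toHilbert hη ψ x) = starRingEnd ℂ (h x) * toHilbert hη ψ x := by
    intro x
    rw [RCLike.inner_apply, mul_comm]
  simp_rw [h3]
  refine tendsto_integral_of_dominated_convergence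
    (fun x => ‖starRingEnd ℂ (h x) * toHilbert hη ψ x‖) (fun N => ?_) h2.norm
    (fun N => Eventually.of_forall fun x => ?_) (Eventually.of_forall fun x => ?_)
  · refine (Measurable.ite (measurableSet_card_le N) ?_ measurable_const).aestronglyMeasurable
    exact (Complex.continuous_conj.measurable.comp hhm).mul
      (Lp.stronglyMeasurable (toHilbert hη ψ)).measurable
  · split_ifs
    · exact le_rfl
    · rw [norm_zero]; exact norm_nonneg _
  · refine tendsto_const_nhds.congr' ?_
    filter_upwards [eventually_ge_atTop x.1.card] with N hN
    rw [if_pos hN]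

theorem half_mem : (1 / 2 : ℝ) ∈ Ioo (0 : ℝ) 1 := by norm_num [Set.mem_Ioo]

variable (J B I) in
/-- Countably many elements of `𝒢⁺` separate the elements of `𝒢₋`. -/
theorem exists_separating : ∃ χ : ℕ × ℕ → FockPlus J B I, ∀ ψ ψ' : FockMinus J B I,
    (∀ n, pairing (χ n) ψ = pairing (χ n) ψ') → ψ = ψ' := by
  -- One norm of the scale suffices, since the inclusion of `𝒢₋` into a single `𝒢(η)` is injective;
  -- `1/2` stands for any fixed `η` in `]0, 1[`.
  let d := TopologicalSpace.denseSeq (Lp ℂ 2 (scaleMeasure J B I (1 / 2)))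
  have hd : DenseRange d := TopologicalSpace.denseRange_denseSeq _
  choose χ hχ using fun n => exists_tendsto_pairing half_mem (d n)
  refine ⟨fun n => χ n.1 n.2, fun ψ ψ' h => toHilbert_injective half_mem (by norm_num) ?_⟩
  have h1 : ∀ n, inner ℂ (d n) (toHilbert half_mem ψ) = inner ℂ (d n) (toHilbert half_mem ψ') := by
    intro n
    refine tendsto_nhds_unique (hχ n ψ) ?_
    simp_rw [fun N => h (n, N)]
    exact hχ n ψ'
  refine ext_inner_left ℂ fun v => ?_
  exact congrFun (hd.equalizer (g := fun v => inner ℂ v (toHilbert half_mem ψ))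
    (h := fun v => inner ℂ v (toHilbert half_mem ψ')) (by fun_prop) (by fun_prop)
    (funext h1)) v

/-- A weakly measurable family of elements of `𝒢₋` has a jointly measurable version. -/
theorem exists_version {Ω : Type*} [MeasurableSpace Ω] (ν : Measure Ω) (u : Ω → FockMinus J B I)
    (hu : ∀ χ, AEMeasurable (fun s => pairing χ (u s)) ν) :
    ∃ f : Ω → Chain J × I → ℂ, Measurable (Function.uncurry f) ∧
      ∀ᵐ s ∂ν, f s =ᵐ[fockMeasure J B I] (u s).1 := by
  obtain ⟨f, hf, hfU⟩ := exists_jointly_measurable ν (scaleMeasure J B I (1 / 2))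
    (fun s => toHilbert half_mem (u s)) fun h => by
      obtain ⟨χ, hχ⟩ := exists_tendsto_pairing half_mem h
      exact aemeasurable_of_tendsto_metrizable_ae atTop (fun N => hu (χ N))
        (Eventually.of_forall fun s => hχ (u s))
  refine ⟨f, hf, ?_⟩
  filter_upwards [hfU] with s hs
  exact ((ac_scaleMeasure (by norm_num)).ae_eq hs).trans (coe_toHilbert half_mem (by norm_num) _)

end Versions

/-! ### Integral inequalities -/

theorem lintegral_mul_le_sqrt {X : Type*} [MeasurableSpace X] (μ : Measure X) {f g : X → ℝ≥0∞}
    (hf : Measurable f) (hg : Measurable g) :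
    ∫⁻ x, f x * g x ∂μ ≤
      (∫⁻ x, f x ^ 2 ∂μ) ^ (1 / 2 : ℝ) * (∫⁻ x, g x ^ 2 ∂μ) ^ (1 / 2 : ℝ) := by
  have := ENNReal.lintegral_mul_le_Lp_mul_Lq μ Real.HolderConjugate.two_two hf.aemeasurable
    hg.aemeasurable
  simpa only [Pi.mul_apply, ENNReal.rpow_two] using this

/-- The Cauchy–Schwarz inequality with an upper bound that need not be measurable. -/
theorem lintegral_le_sqrt_of_le_mul {X : Type*} [MeasurableSpace X] (μ : Measure X)
    {F M b : X → ℝ≥0∞} (hF : Measurable F) (hb : Measurable b) (hb' : ∀ᵐ x ∂μ, b x < ⊤)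
    (h : ∀ᵐ x ∂μ, F x ≤ M x * b x) :
    ∫⁻ x, F x ∂μ ≤ (∫⁻ x, M x ^ 2 ∂μ) ^ (1 / 2 : ℝ) * (∫⁻ x, b x ^ 2 ∂μ) ^ (1 / 2 : ℝ) := by
  -- `M` is replaced by the measurable quotient `F / b ≤ M`; where `b` vanishes, so does `F`.
  have h1 : ∫⁻ x, F x ∂μ = ∫⁻ x, F x / b x * b x ∂μ := by
    refine lintegral_congr_ae ?_
    filter_upwards [h, hb'] with x hx hx'
    by_cases h0 : b x = 0
    · rw [h0, mul_zero] at hx ⊢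
      exact le_antisymm hx bot_le
    · rw [ENNReal.div_mul_cancel h0 hx'.ne]
  rw [h1]
  refine (lintegral_mul_le_sqrt μ (hF.div hb) hb).trans ?_
  gcongr ?_ ^ _ * _
  refine lintegral_mono_ae ?_
  filter_upwards [h] with x hx
  gcongr
  exact ENNReal.div_le_of_le_mul hx

/-- Minkowski's integral inequality in `L²`. -/
theorem lintegral_lintegral_sq_le {Ω X : Type*} [MeasurableSpace Ω] [MeasurableSpace X]
    (ν : Measure Ω) (μ : Measure X) [SFinite ν] [SFinite μ] {a : Ω → X → ℝ≥0∞}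
    (ha : Measurable (Function.uncurry a)) :
    ∫⁻ x, (∫⁻ s, a s x ∂ν) ^ 2 ∂μ ≤ (∫⁻ s, (∫⁻ x, a s x ^ 2 ∂μ) ^ (1 / 2 : ℝ) ∂ν) ^ 2 := by
  have ha1 : ∀ s, Measurable (a s) := fun s => ha.comp (measurable_const.prodMk measurable_id)
  have ha2 : ∀ x, Measurable fun s => a s x := fun x => ha.comp (measurable_id.prodMk measurable_const)
  have hA : Measurable fun x => ∫⁻ s, a s x ∂ν := ha.lintegral_prod_left'
  have hN : Measurable fun s => (∫⁻ x, a s x ^ 2 ∂μ) ^ (1 / 2 : ℝ) :=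
    Measurable.pow_const (Measurable.lintegral_prod_right' (ha.pow_const 2)) _
  -- The square is written as a double integral over `(s, s')`, and Cauchy–Schwarz is applied in `x`
  -- for each pair.
  have h1 : ∫⁻ x, (∫⁻ s, a s x ∂ν) ^ 2 ∂μ = ∫⁻ s, ∫⁻ x, a s x * ∫⁻ s', a s' x ∂ν ∂μ ∂ν := by
    rw [lintegral_lintegral_swap]
    · refine lintegral_congr fun x => ?_
      rw [sq, ← lintegral_mul_const _ (ha2 x)]
    · exact (ha.mul (hA.comp measurable_snd)).aemeasurable
  have h2 : ∀ s, ∫⁻ x, a s x * ∫⁻ s', a s' x ∂ν ∂μ = ∫⁻ s', ∫⁻ x, a s x * a s' x ∂μ ∂ν := by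
    intro s
    rw [lintegral_lintegral_swap]
    · refine lintegral_congr fun x => ?_
      rw [lintegral_const_mul _ (ha2 x)]
    · exact (((ha1 s).comp measurable_snd).mul ha).aemeasurable
  rw [h1]
  simp_rw [h2]
  calc ∫⁻ s, ∫⁻ s', ∫⁻ x, a s x * a s' x ∂μ ∂ν ∂ν
      ≤ ∫⁻ s, ∫⁻ s', (∫⁻ x, a s x ^ 2 ∂μ) ^ (1 / 2 : ℝ) * (∫⁻ x, a s' x ^ 2 ∂μ) ^ (1 / 2 : ℝ)
          ∂ν ∂ν :=
        lintegral_mono fun s => lintegral_mono fun s' => lintegral_mul_le_sqrt μ (ha1 s) (ha1 s')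
    _ = _ := by
      rw [lintegral_congr fun s => lintegral_const_mul ((∫⁻ x, a s x ^ 2 ∂μ) ^ (1 / 2 : ℝ)) hN,
        lintegral_mul_const _ hN, sq]

/-- Bernoulli's inequality for `(1 + ε/η)ⁿ`. Enlarging the weight from `η` to `η + ε` pays for a
factor `n`, the number of points; every loss of `ε` in the estimates comes from here. -/
theorem natCast_mul_pow_le {η ε : ℝ} (hη : 0 < η) (hε : 0 < ε) (n : ℕ) :
    n * η ^ n ≤ η / ε * (η + ε) ^ n := by
  have h1 := one_add_mul_le_pow (a := ε / η) (by linarith [div_pos hε hη]) n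
  have h2 : (η + ε) ^ n = η ^ n * (1 + ε / η) ^ n := by
    rw [← mul_pow]; congr 1; field_simp
  rw [h2]
  have h3 : η / ε * (n * (ε / η)) = n := by field_simp
  have h4 : (n : ℝ) ≤ η / ε * (1 + ε / η) ^ n := by
    calc (n : ℝ) = η / ε * (n * (ε / η)) := h3.symm
      _ ≤ η / ε * (1 + ε / η) ^ n := by
        gcongr
        linarith
  calc n * η ^ n ≤ (η / ε * (1 + ε / η) ^ n) * η ^ n := by gcongr
    _ = _ := by ring

section Estimates

variable {J : Type*} [MeasurableSpace J] [Countable J] [MeasurableSingletonClass J] {B : Set ℝ}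
  {I : Type*} [MeasurableSpace I] [Countable I] [MeasurableSingletonClass I]

theorem scaleNorm_eq_sqrt (η : ℝ) (f : Chain J × I → ℂ) :
    scaleNorm J B I η f = (∫⁻ x, ‖f x‖ₑ ^ 2 ∂scaleMeasure J B I η) ^ (1 / 2 : ℝ) := by
  rw [← eLpNorm_two_sq, ← ENNReal.rpow_two, ← ENNReal.rpow_mul]
  norm_num
  rfl

theorem measurable_scaleNorm {Ω : Type*} [MeasurableSpace Ω] (η : ℝ) {f : Ω → Chain J × I → ℂ}
    (hf : Measurable (Function.uncurry f)) : Measurable fun s => scaleNorm J B I η (f s) := by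
  simp_rw [scaleNorm_eq_sqrt]
  exact Measurable.pow_const (Measurable.lintegral_prod_right' (hf.enorm.pow_const 2)) _

theorem lintegral_enorm_sq_le {Ω : Type*} [MeasurableSpace Ω] (ν : Measure Ω) [SFinite ν] (η : ℝ)
    {f : Ω → Chain J × I → ℂ} (hf : Measurable (Function.uncurry f)) :
    ∫⁻ x, (∫⁻ s, ‖f s x‖ₑ ∂ν) ^ 2 ∂scaleMeasure J B I η ≤
      (∫⁻ s, scaleNorm J B I η (f s) ∂ν) ^ 2 := by
  simp_rw [scaleNorm_eq_sqrt]
  exact lintegral_lintegral_sq_le ν _ hf.enorm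

theorem scaleNorm_integral_le {Ω : Type*} [MeasurableSpace Ω] (ν : Measure Ω) [SFinite ν] (η : ℝ)
    {f : Ω → Chain J × I → ℂ} (hf : Measurable (Function.uncurry f)) :
    scaleNorm J B I η (fun x => ∫ s, f s x ∂ν) ≤ ∫⁻ s, scaleNorm J B I η (f s) ∂ν := by
  rw [← ENNReal.pow_le_pow_left_iff two_ne_zero]
  refine le_trans ?_ (lintegral_enorm_sq_le ν η hf)
  rw [scaleNorm, eLpNorm_two_sq]
  refine lintegral_mono fun x => ?_
  gcongr
  exact enorm_integral_le_lintegral_enorm _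

theorem ae_integrable_of_scaleNorm {Ω : Type*} [MeasurableSpace Ω] (ν : Measure Ω) [SFinite ν]
    {η : ℝ} (hη : 0 < η) {f : Ω → Chain J × I → ℂ} (hf : Measurable (Function.uncurry f))
    (h : ∫⁻ s, scaleNorm J B I η (f s) ∂ν < ⊤) :
    ∀ᵐ x ∂fockMeasure J B I, Integrable (fun s => f s x) ν := by
  have h1 : Measurable fun x => (∫⁻ s, ‖f s x‖ₑ ∂ν) ^ 2 := (hf.enorm.lintegral_prod_left').pow_const 2
  have h2 := ae_lt_top h1 ((lintegral_enorm_sq_le (B := B) ν η hf).trans_lt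
    (ENNReal.pow_lt_top h)).ne
  filter_upwards [(ac_scaleMeasure hη).ae_le h2] with x hx
  exact ⟨(hf.comp (measurable_id.prodMk measurable_const)).aestronglyMeasurable,
    lt_top_of_sq_lt_top hx⟩

theorem lintegral_fockMeasure_unit {F : Chain J × Unit → ℝ≥0∞} (hF : Measurable F) :
    ∫⁻ x, F x ∂fockMeasure J B Unit = ∫⁻ τ, F (τ, ()) ∂chainMeasure J B := by
  rw [fockMeasure, lintegral_prod _ hF.aemeasurable]
  refine lintegral_congr fun τ => ?_
  rw [lintegral_count, tsum_fintype]
  simp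

/-- The function `(s, (τ, j)) ↦ φ(τ ⊔ (s, j))`. -/
def sliceFun (φ : Chain J × Unit → ℂ) (s : ℝ) (x : Chain J × J) : ℂ := φ (x.1.insert (s, x.2), ())

theorem measurable_sliceFun {φ : Chain J × Unit → ℂ} (hφ : Measurable φ) :
    Measurable (Function.uncurry (sliceFun φ)) :=
  hφ.comp (measurable_insert_time.prodMk measurable_const)

/-- Integrating over the inserted point multiplies by `|τ|` (`lintegral_insert`), and this factor is
absorbed by `natCast_mul_pow_le`. -/
theorem lintegral_sliceFun_le {η ε : ℝ} (hη : 1 ≤ η) (hε : 0 < ε) {φ : Chain J × Unit → ℂ}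
    (hφ : Measurable φ) :
    ∫⁻ s in B, scaleNorm J B J η (sliceFun φ s) ^ 2 ≤
      ENNReal.ofReal (η / ε) * scaleNorm J B Unit (η + ε) φ ^ 2 := by
  have h0 : 0 < η := by linarith
  have hm : ∀ η : ℝ, Measurable fun τ : Chain J => ENNReal.ofReal (η ^ τ.card) * ‖φ (τ, ())‖ₑ ^ 2 :=
    fun η => ((measurable_from_nat (f := fun n => ENNReal.ofReal (η ^ n))).comp
      Chain.measurable_card).mul ((hφ.comp (measurable_id.prodMk measurable_const)).enorm.pow_const 2)
  calc ∫⁻ s in B, scaleNorm J B J η (sliceFun φ s) ^ 2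
      ≤ ∫⁻ s in B, ∫⁻ x, ENNReal.ofReal (η ^ (x.1.insert (s, x.2)).card) *
          ‖φ (x.1.insert (s, x.2), ())‖ₑ ^ 2 ∂fockMeasure J B J := by
        refine lintegral_mono fun s => ?_
        simp_rw [scaleNorm_sq]
        refine lintegral_mono fun x => ?_
        refine mul_le_mul_left (ENNReal.ofReal_le_ofReal ?_) _
        -- Only `|τ| ≤ |τ ⊔ (s, j)|` is used; this is where `η ≥ 1` enters.
        exact pow_le_pow_right₀ hη (Finset.card_le_card (Finset.subset_insert _ _))
    _ = ∫⁻ τ, τ.card * (ENNReal.ofReal (η ^ τ.card) * ‖φ (τ, ())‖ₑ ^ 2) ∂chainMeasure J B :=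
        lintegral_insert B (hm η)
    _ ≤ ∫⁻ τ, ENNReal.ofReal (η / ε) * (ENNReal.ofReal ((η + ε) ^ τ.card) * ‖φ (τ, ())‖ₑ ^ 2)
          ∂chainMeasure J B := by
        refine lintegral_mono fun τ => ?_
        simp only
        rw [← mul_assoc, ← mul_assoc, ← ENNReal.ofReal_natCast, ← ENNReal.ofReal_mul (by positivity),
          ← ENNReal.ofReal_mul (by positivity)]
        exact mul_le_mul_left (ENNReal.ofReal_le_ofReal (natCast_mul_pow_le h0 hε _)) _
    _ = _ := by
        rw [lintegral_const_mul _ (hm _), scaleNorm_sq, lintegral_fockMeasure_unit]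
        exact (measurable_weight _).mul (hφ.enorm.pow_const 2)

theorem isSlice_iff {φ : FockPlus J (Ioi 0) Unit} {s : ℝ} {φs : FockPlus J (Ioi 0) J} :
    IsSlice φ s φs ↔ φs.1 =ᵐ[fockMeasure J (Ioi 0) J] sliceFun φ.1 s := Iff.rfl

theorem IsSlice.unique {φ : FockPlus J (Ioi 0) Unit} {s : ℝ} {φs φs' : FockPlus J (Ioi 0) J}
    (h : IsSlice φ s φs) (h' : IsSlice φ s φs') : φs = φs' :=
  Subtype.ext (FockFun.ext_ae (h.trans h'.symm))

/-- The norms increase with `η`, so countably many of them decide membership in `𝒢⁺`; statements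
that hold almost everywhere can then be combined. -/
theorem mem_plus_of_nat {f : FockFun J B I} (h : ∀ m : ℕ, scaleNorm J B I (m + 2) f < ⊤) :
    f ∈ FockPlus J B I := by
  intro η hη
  obtain ⟨m, hm⟩ := exists_nat_ge η
  have h1 : (1 : ℝ) < η := hη
  exact (scaleNorm_mono_weight (by linarith) (by linarith) _).trans_lt (h m)

theorem exists_isSlice (φ : FockPlus J (Ioi 0) Unit) :
    ∀ᵐ s ∂volume.restrict (Ioi 0), ∃ φs, IsSlice φ s φs := by
  have hm := measurable_sliceFun φ.1.measurable
  have h1 : ∀ m : ℕ, ∀ᵐ s ∂volume.restrict (Ioi (0 : ℝ)),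
      scaleNorm J (Ioi 0) J (m + 2) (sliceFun φ.1 s) ^ 2 < ⊤ := by
    intro m
    refine ae_lt_top ((measurable_scaleNorm _ hm).pow_const 2) (ne_of_lt ?_)
    have hm0 : (0 : ℝ) ≤ m := m.cast_nonneg
    refine (lintegral_sliceFun_le (by linarith) one_pos φ.1.measurable).trans_lt ?_
    exact ENNReal.mul_lt_top (by simp) (ENNReal.pow_lt_top (φ.2 _ (by
      rw [Set.mem_Ioi]; linarith)))
  filter_upwards [ae_all_iff.2 h1] with s hs
  have hms : Measurable (sliceFun φ.1 s) := hm.comp (measurable_const.prodMk measurable_id)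
  refine ⟨⟨FockFun.mk _ hms, mem_plus_of_nat fun m => ?_⟩, FockFun.coe_mk _ hms⟩
  rw [scaleNorm_congr _ (FockFun.coe_mk _ hms)]
  exact lt_top_of_sq_lt_top (hs m)

/-- The estimate of the sums over the points of a chain. -/
theorem scaleNorm_sum_le {η ε : ℝ} (hη : 0 < η) (hε : 0 < ε) {A : Set ℝ} (hA : MeasurableSet A)
    {g : ℝ → Chain J × J → ℂ} (hg : Measurable (Function.uncurry g)) :
    scaleNorm J B Unit η (fun x => ∑ p ∈ x.1.points with p.1 ∈ A, g p.1 (x.1.erase p, p.2)) ^ 2 ≤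
      ENNReal.ofReal (η / ε * (η + ε)) *
        ∫⁻ s in A ∩ B, scaleNorm J B J (η + ε) (g s) ^ 2 := by
  -- `σ` stands for `τ \ p`, so `|τ| = |σ| + 1`. One factor `|τ|` comes from `|∑ g|² ≤ |τ| ∑ |g|²`,
  -- and `η^|τ|` is the weight.
  let G : ℝ × J → Chain J → ℝ≥0∞ := fun p σ => A.indicator 1 p.1 *
    (ENNReal.ofReal ((σ.card + 1) * η ^ (σ.card + 1)) * ‖g p.1 (σ, p.2)‖ₑ ^ 2)
  have hG : Measurable (Function.uncurry G) := by
    have h1 : Measurable fun y : (ℝ × J) × Chain J => A.indicator (1 : ℝ → ℝ≥0∞) y.1.1 :=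
      (measurable_one.indicator hA).comp (by fun_prop)
    have h2 : Measurable fun y : (ℝ × J) × Chain J =>
        ENNReal.ofReal ((y.2.card + 1) * η ^ (y.2.card + 1)) :=
      (measurable_from_nat (f := fun n => ENNReal.ofReal ((n + 1) * η ^ (n + 1)))).comp
        (Chain.measurable_card.comp measurable_snd)
    have h3 : Measurable fun y : (ℝ × J) × Chain J => ‖g y.1.1 (y.2, y.1.2)‖ₑ ^ 2 :=
      (hg.comp (show Measurable fun y : (ℝ × J) × Chain J => (y.1.1, (y.2, y.1.2)) by
        fun_prop)).enorm.pow_const 2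
    exact h1.mul (h2.mul h3)
  have hsum : Measurable fun x : Chain J × Unit =>
      ∑ p ∈ x.1.points with p.1 ∈ A, g p.1 (x.1.erase p, p.2) := by
    have := (Chain.measurable_sum_points (Y := Unit) (q := fun p : ℝ × J => p.1 ∈ A)
      (F := fun _ p τ => g p.1 (τ, p.2)) (measurable_fst hA)
      (hg.comp (show Measurable fun y : Unit × (ℝ × J) × Chain J =>
        (y.2.1.1, (y.2.2, y.2.1.2)) by fun_prop))).comp measurable_swap
    exact this
  calc scaleNorm J B Unit η (fun x => ∑ p ∈ x.1.points with p.1 ∈ A, g p.1 (x.1.erase p, p.2)) ^ 2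
      = ∫⁻ τ, ENNReal.ofReal (η ^ τ.card) *
          ‖∑ p ∈ τ.points with p.1 ∈ A, g p.1 (τ.erase p, p.2)‖ₑ ^ 2 ∂chainMeasure J B := by
        rw [scaleNorm_sq, lintegral_fockMeasure_unit]
        exact (measurable_weight _).mul (hsum.enorm.pow_const 2)
    _ ≤ ∫⁻ τ, ∑ p ∈ τ.points, G p (τ.erase p) ∂chainMeasure J B := by
        refine lintegral_mono fun τ => ?_
        have h1 : ‖∑ p ∈ τ.points with p.1 ∈ A, g p.1 (τ.erase p, p.2)‖ₑ ^ 2 ≤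
            τ.card * ∑ p ∈ τ.points with p.1 ∈ A, ‖g p.1 (τ.erase p, p.2)‖ₑ ^ 2 := by
          have h2 := ENNReal.rpow_sum_le_const_mul_sum_rpow (τ.points.filter fun p => p.1 ∈ A)
            (fun p => ‖g p.1 (τ.erase p, p.2)‖ₑ) (p := 2) (by norm_num)
          simp only [ENNReal.rpow_two] at h2
          norm_num at h2
          calc _ ≤ (∑ p ∈ τ.points with p.1 ∈ A, ‖g p.1 (τ.erase p, p.2)‖ₑ) ^ 2 := by
                gcongr; exact enorm_sum_le _ _
            _ ≤ _ := h2
            _ ≤ _ := by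
                gcongr
                exact Finset.card_le_card (Finset.filter_subset _ _)
        refine (mul_le_mul_right h1 _).trans (le_of_eq ?_)
        rw [← mul_assoc, Finset.mul_sum, Finset.sum_filter]
        refine Finset.sum_congr rfl fun p hp => ?_
        have hc : (τ.erase p).card + 1 = τ.card := Finset.card_erase_add_one hp
        simp only [G]
        split_ifs with hpA
        · rw [indicator_of_mem hpA, Pi.one_apply, one_mul]
          congr 1
          rw [hc, ← Nat.cast_succ, Nat.succ_eq_add_one, hc, ENNReal.ofReal_mul (by positivity),
            ENNReal.ofReal_natCast, mul_comm]
        · rw [indicator_of_notMem hpA, zero_mul]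
    _ = ∫⁻ s in B, ∫⁻ x, G (s, x.2) x.1 ∂fockMeasure J B J := by
        rw [lintegral_sum_erase B hG, lintegral_pointMeasure B hG]
    _ ≤ ∫⁻ s in B, A.indicator (fun s => ENNReal.ofReal (η / ε * (η + ε)) *
          scaleNorm J B J (η + ε) (g s) ^ 2) s := by
        refine lintegral_mono fun s => ?_
        by_cases hs : s ∈ A
        · rw [indicator_of_mem hs, scaleNorm_sq, ← lintegral_const_mul' _ _ (by simp)]
          refine lintegral_mono fun x => ?_
          simp only [G]
          rw [indicator_of_mem hs, Pi.one_apply, one_mul, ← mul_assoc,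
            ← ENNReal.ofReal_mul (by positivity)]
          refine mul_le_mul_left (ENNReal.ofReal_le_ofReal ?_) _
          -- The exponent is `|σ| + 1` while the norm on the right has weight `(η + ε)^|σ|`; the
          -- surplus factor `η + ε` goes into the constant.
          have := natCast_mul_pow_le hη hε (x.1.card + 1)
          push_cast at this
          rw [mul_assoc, ← pow_succ']
          exact this
        · simp [G, indicator_of_notMem hs]
    _ = _ := by
        rw [lintegral_indicator hA, Measure.restrict_restrict hA, lintegral_const_mul' _ _ (by simp)]

/-- The quotients in `opNorm` lose no information for `ζ > 1`: the denominator is finite on `𝒢⁺` and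
vanishes only at `φ = 0`. -/
theorem scaleNorm_le_opNorm {I' : Type*} [MeasurableSpace I'] {ζ ξ : ℝ} (hζ : 1 < ζ)
    (T : FockOp J B I I') (φ : FockPlus J B I) :
    scaleNorm J B I' ξ (T φ).1 ≤ opNorm ζ ξ T * scaleNorm J B I ζ φ.1 := by
  by_cases h0 : scaleNorm J B I ζ φ.1 = 0
  · have : φ = 0 := by
      refine Subtype.ext (FockFun.ext_ae ?_)
      exact (ae_eq_zero_of_scaleNorm (by linarith) φ.1.measurable h0).trans FockFun.coe_zero.symm
    rw [this, map_zero]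
    refine le_of_eq_of_le (scaleNorm_zero ξ) bot_le
  · refine (ENNReal.div_le_iff h0 (φ.2 ζ hζ).ne).1 ?_
    exact le_iSup (fun φ : FockPlus J B I => scaleNorm J B I' ξ (T φ).1 / scaleNorm J B I ζ φ.1) φ

theorem opNorm_le {I' : Type*} [MeasurableSpace I'] {ζ ξ : ℝ} {T : FockOp J B I I'} {c : ℝ≥0∞}
    (h : ∀ φ : FockPlus J B I, scaleNorm J B I' ξ (T φ).1 ≤ c * scaleNorm J B I ζ φ.1) :
    opNorm ζ ξ T ≤ c :=
  iSup_le fun φ => ENNReal.div_le_of_le_mul (h φ)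

end Estimates

/-! ### Versions of the integrands -/

section Versions

variable {J : Type*} [MeasurableSpace J] [Countable J] [MeasurableSingletonClass J] {B : Set ℝ}
  {I : Type*} [MeasurableSpace I] [Countable I] [MeasurableSingletonClass I]
  {I' : Type*} [MeasurableSpace I'] [Countable I'] [MeasurableSingletonClass I']

theorem aemeasurable_index {Ω : Type*} [MeasurableSpace Ω] {ν : Measure Ω} {F : ℕ → Ω → ℂ}
    {k : Ω → ℕ} (hF : ∀ n, AEMeasurable (F n) ν) (hk : Measurable k) :
    AEMeasurable (fun s => F (k s) s) ν := by
  refine ⟨fun s => (hF (k s)).mk _ s, ?_, ?_⟩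
  · have h1 : Measurable fun y : ℕ × Ω => (hF y.1).mk _ y.2 :=
      measurable_from_prod_countable_right fun k => (hF k).measurable_mk
    exact h1.comp (hk.prodMk measurable_id)
  · filter_upwards [ae_all_iff.2 fun k => (hF k).ae_eq_mk] with s hs
    exact hs (k s)

theorem pairing_sub (χ : FockPlus J B I) (ψ ψ' : FockMinus J B I) :
    pairing χ (ψ - ψ') = pairing χ ψ - pairing χ ψ' :=
  map_sub (pairingHom χ) ψ ψ'

/-- A weakly measurable family of bounded operators, applied to a measurable family of elements
of `𝒢⁺`. -/
theorem aemeasurable_pairing_apply {Ω : Type*} [MeasurableSpace Ω] {ν : Measure Ω}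
    {C : Ω → FockOp J B I I'} {v : Ω → FockPlus J B I} {f : Ω → Chain J × I → ℂ}
    (hf : Measurable (Function.uncurry f)) (hv : ∀ᵐ s ∂ν, f s =ᵐ[fockMeasure J B I] (v s).1)
    (hC : ∀ φ χ, AEMeasurable (fun s => pairing χ (C s φ)) ν) {ζ ξ : ℝ} (hζ : 1 < ζ) (hξ : 0 < ξ)
    (hξ1 : ξ < 1) (hfin : ∀ᵐ s ∂ν, opNorm ζ ξ (C s) < ⊤) (χ : FockPlus J B I') :
    AEMeasurable (fun s => pairing χ (C s (v s))) ν := by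
  have hζ' : ζ ∈ Ioi (1 : ℝ) := hζ
  have hζ0 : 0 < ζ := by linarith
  -- A dense sequence is chosen inside the image `R` of the scale, not in the whole Hilbert space,
  -- so that its members come from elements of the scale and `C s` can be applied to them.
  let R := LinearMap.range (toHilbert (J := J) (B := B) (I := I) hζ')
  let V : Ω → R := fun s => ⟨toHilbert hζ' (v s), _, rfl⟩
  have hV : ∀ h : R, AEMeasurable (fun s => (inner ℂ h (V s) : ℂ)) ν := by
    intro h
    have h1 : StronglyMeasurable fun s => ∫ x, inner ℂ ((h : Lp ℂ 2 (scaleMeasure J B I ζ)) x) (f s x)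
        ∂scaleMeasure J B I ζ := by
      refine StronglyMeasurable.integral_prod_right
        (f := fun s x => (inner ℂ ((h : Lp ℂ 2 (scaleMeasure J B I ζ)) x) (f s x) : ℂ)) ?_
      have h2 : Measurable fun y : Ω × (Chain J × I) => (h : Lp ℂ 2 (scaleMeasure J B I ζ)) y.2 :=
        (Lp.stronglyMeasurable _).measurable.comp measurable_snd
      exact (h2.inner hf).stronglyMeasurable
    refine h1.measurable.aemeasurable.congr ?_
    filter_upwards [hv] with s hs
    rw [Submodule.coe_inner, L2.inner_def]
    refine integral_congr_ae ?_
    filter_upwards [(scaleMeasure_ac ζ).ae_eq (coe_toHilbert hζ' hζ0 (v s)),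
      (scaleMeasure_ac ζ).ae_eq hs] with x hx hx'
    rw [hx', ← hx]
  have hd := TopologicalSpace.denseRange_denseSeq R
  have he : ∀ k, ∃ e : FockPlus J B I, toHilbert hζ' e =
      (TopologicalSpace.denseSeq R k : Lp ℂ 2 (scaleMeasure J B I ζ)) := fun k =>
    (TopologicalSpace.denseSeq R k).2
  choose e he using he
  choose K hK hKV using fun n : ℕ => exists_measurable_index ν hd V hV
    (show (0 : ℝ) < (1 / 2) ^ n by positivity)
  refine aemeasurable_of_tendsto_metrizable_ae atTop
    (f := fun n s => pairing χ (C s (e (K n s)))) (fun n => ?_) ?_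
  · exact aemeasurable_index (F := fun k s => pairing χ (C s (e k))) (fun k => hC (e k) χ) (hK n)
  · filter_upwards [hfin, ae_all_iff.2 hKV] with s hs hs'
    rw [tendsto_iff_edist_tendsto_0]
    -- Boundedness of `C s` from the `ζ`-norm to the `ξ`-norm turns the approximation of `v s` by
    -- countably valued functions into convergence of the pairings.
    have h1 : ∀ n, edist (pairing χ (C s (e (K n s)))) (pairing χ (C s (v s))) ≤
        scaleNorm J B I' ξ⁻¹ χ.1 * opNorm ζ ξ (C s) * ENNReal.ofReal ((1 / 2) ^ n) := by
      intro n
      rw [edist_comm, edist_eq_enorm_sub, ← pairing_sub, ← map_sub]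
      refine (enorm_pairing_le hξ _ _).trans ?_
      rw [mul_assoc]
      gcongr
      refine (scaleNorm_le_opNorm hζ _ _).trans ?_
      gcongr
      rw [← enorm_toHilbert hζ', map_sub, he, ← ofReal_norm]
      exact ENNReal.ofReal_le_ofReal (hs' n)
    refine tendsto_of_tendsto_of_tendsto_of_le_of_le tendsto_const_nhds ?_ (fun n => bot_le) h1
    have h2 : Tendsto (fun n : ℕ => ENNReal.ofReal ((1 / 2 : ℝ) ^ n)) atTop (𝓝 0) := by
      have := ENNReal.tendsto_ofReal (tendsto_pow_atTop_nhds_zero_of_lt_one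
        (r := (1 / 2 : ℝ)) (by norm_num) (by norm_num))
      simpa using this
    have h3 := ENNReal.Tendsto.const_mul (a := scaleNorm J B I' ξ⁻¹ χ.1 * opNorm ζ ξ (C s)) h2
      (Or.inr (ENNReal.mul_lt_top (χ.2 _ ((one_lt_inv₀ hξ).2 hξ1)) hs).ne)
    simpa using h3

end Versions

/-! ### Quantum stochastic integrals -/

section Integral

variable {J : Type*} [MeasurableSpace J]

/-- `f` and `g` are jointly measurable versions of the integrands of the QS-integral. -/
def QSProcess.IsVersion (C : QSProcess J) (t : ℝ) (φ : FockPlus J (Ioi 0) Unit)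
    (f : ℝ → Chain J × Unit → ℂ) (g : ℝ → Chain J × J → ℂ) : Prop :=
  Measurable (Function.uncurry f) ∧ Measurable (Function.uncurry g) ∧
    (∀ᵐ s ∂(volume.restrict (Ioc 0 t)), ∃ φs, IsSlice φ s φs ∧
      f s =ᵐ[fockMeasure J (Ioi 0) Unit] ((C s).drift φ + (C s).annihilation φs).1 ∧
      g s =ᵐ[fockMeasure J (Ioi 0) J] ((C s).creation φ + (C s).number φs).1)

/-- The right-hand side of the definition of the QS-integral. -/
def integralFun (t : ℝ) (f : ℝ → Chain J × Unit → ℂ) (g : ℝ → Chain J × J → ℂ)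
    (x : Chain J × Unit) : ℂ :=
  (∫ s in Ioc 0 t, f s x) + ∑ p ∈ x.1.points with p.1 ≤ t, g p.1 (x.1.erase p, p.2)

/-- Separate jointly measurable versions of the integrands of the QS-integral. -/
structure QSProcess.IsParts (C : QSProcess J) (t : ℝ) (φ : FockPlus J (Ioi 0) Unit)
    (f₀ f₁ : ℝ → Chain J × Unit → ℂ) (g₀ g₁ : ℝ → Chain J × J → ℂ) : Prop where
  measurable_drift : Measurable (Function.uncurry f₀)
  measurable_annihilation : Measurable (Function.uncurry f₁)
  measurable_creation : Measurable (Function.uncurry g₀)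
  measurable_number : Measurable (Function.uncurry g₁)
  ae : ∀ᵐ s ∂(volume.restrict (Ioc 0 t)), ∃ φs, IsSlice φ s φs ∧
      f₀ s =ᵐ[fockMeasure J (Ioi 0) Unit] ((C s).drift φ).1 ∧
      f₁ s =ᵐ[fockMeasure J (Ioi 0) Unit] ((C s).annihilation φs).1 ∧
      g₀ s =ᵐ[fockMeasure J (Ioi 0) J] ((C s).creation φ).1 ∧
      g₁ s =ᵐ[fockMeasure J (Ioi 0) J] ((C s).number φs).1

theorem QSProcess.IsParts.isVersion {C : QSProcess J} {t : ℝ} {φ : FockPlus J (Ioi 0) Unit}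
    {f₀ f₁ : ℝ → Chain J × Unit → ℂ} {g₀ g₁ : ℝ → Chain J × J → ℂ}
    (h : C.IsParts t φ f₀ f₁ g₀ g₁) :
    C.IsVersion t φ (fun s x => f₀ s x + f₁ s x) (fun s x => g₀ s x + g₁ s x) := by
  refine ⟨h.measurable_drift.add h.measurable_annihilation,
    h.measurable_creation.add h.measurable_number, ?_⟩
  filter_upwards [h.ae] with s hs
  obtain ⟨φs, h0, h1, h2, h3, h4⟩ := hs
  refine ⟨φs, h0, ?_, ?_⟩
  · filter_upwards [h1, h2, FockFun.coe_add ((C s).drift φ).1 ((C s).annihilation φs).1]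
      with x h1 h2 h3
    rw [h1, h2, ← h3]; rfl
  · filter_upwards [h3, h4, FockFun.coe_add ((C s).creation φ).1 ((C s).number φs).1]
      with x h1 h2 h3
    rw [h1, h2, ← h3]; rfl

variable [Countable J] [MeasurableSingletonClass J]

theorem measurable_sum_with {A : Set ℝ} (hA : MeasurableSet A) {I : Type*} [MeasurableSpace I]
    {g : ℝ × J → Chain J × I → ℂ} (hg : Measurable (Function.uncurry g)) :
    Measurable fun x : Chain J × I => ∑ p ∈ x.1.points with p.1 ∈ A, g p (x.1.erase p, x.2) := by
  have := (Chain.measurable_sum_points (Y := I) (q := fun p : ℝ × J => p.1 ∈ A)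
    (F := fun i p τ => g p (τ, i)) (measurable_fst hA)
    (hg.comp (show Measurable fun y : I × (ℝ × J) × Chain J =>
      (y.2.1, (y.2.2, y.1)) by fun_prop))).comp measurable_swap
  exact this

theorem measurable_integralFun {t : ℝ} {f : ℝ → Chain J × Unit → ℂ} {g : ℝ → Chain J × J → ℂ}
    (hf : Measurable (Function.uncurry f)) (hg : Measurable (Function.uncurry g)) :
    Measurable (integralFun t f g) := by
  refine Measurable.add ?_ ?_
  · exact (StronglyMeasurable.integral_prod_left (μ := volume.restrict (Ioc 0 t))
      (f := f) hf.stronglyMeasurable).measurable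
  · exact measurable_sum_with (A := Iic t) measurableSet_Iic
      (g := fun p (x : Chain J × Unit) => g p.1 (x.1, p.2))
      (hg.comp (show Measurable fun y : (ℝ × J) × Chain J × Unit => (y.1.1, (y.2.1, y.1.2)) by
        fun_prop))

/-- The Fubini form of `ae_forall_erase`. Joint measurability of `P` is what allows the two
successive "almost every" to be joined into one for the product measure. -/
theorem ae_points_of_ae_ae {B A : Set ℝ} (hA : MeasurableSet A) {P : ℝ → Chain J × J → Prop}
    (hP : MeasurableSet {y : ℝ × Chain J × J | P y.1 y.2})
    (h : ∀ᵐ s ∂volume.restrict (A ∩ B), ∀ᵐ x ∂fockMeasure J B J, P s x) :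
    ∀ᵐ τ ∂chainMeasure J B, ∀ p ∈ τ.points, p.1 ∈ A → P p.1 (τ.erase p, p.2) := by
  refine ae_forall_erase (P := fun p τ => p.1 ∈ A → P p.1 (τ, p.2)) ?_
  rw [Measure.ae_prod_iff_ae_ae]
  · rw [← Measure.restrict_restrict hA, ae_restrict_iff' hA] at h
    filter_upwards [h] with s hs
    by_cases hsA : s ∈ A
    · filter_upwards [hs hsA] with x hx _ using hx
    · exact Eventually.of_forall fun x hx => absurd hx hsA
  · have : {y : ℝ × Chain J × J | y.1 ∈ A → P y.1 y.2} =
        {y | y.1 ∈ A}ᶜ ∪ {y | P y.1 y.2} := by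
      ext y; simp [imp_iff_not_or]
    exact this ▸ (measurable_fst hA).compl.union hP

/-- The sum in (1) evaluates its integrand at single instants, which are null sets; nevertheless
almost every chain avoids all exceptional instants, and the sum does not depend on the version. -/
theorem ae_sum_points_congr {t : ℝ} {g g' : ℝ → Chain J × J → ℂ}
    (hg : Measurable (Function.uncurry g)) (hg' : Measurable (Function.uncurry g'))
    (h : ∀ᵐ s ∂volume.restrict (Ioc 0 t), g s =ᵐ[fockMeasure J (Ioi 0) J] g' s) :
    ∀ᵐ τ ∂chainMeasure J (Ioi 0), ∀ p ∈ τ.points, p.1 ≤ t →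
      g p.1 (τ.erase p, p.2) = g' p.1 (τ.erase p, p.2) := by
  refine ae_points_of_ae_ae (A := Iic t) measurableSet_Iic (P := fun s x => g s x = g' s x)
    (measurableSet_eq_fun hg hg') ?_
  rwa [inter_comm, Ioi_inter_Iic]

theorem QSProcess.IsVersion.ae_eq {C : QSProcess J} {t : ℝ} {φ : FockPlus J (Ioi 0) Unit}
    {f f' : ℝ → Chain J × Unit → ℂ} {g g' : ℝ → Chain J × J → ℂ} (h : C.IsVersion t φ f g)
    (h' : C.IsVersion t φ f' g') :
    (∀ᵐ s ∂volume.restrict (Ioc 0 t), f s =ᵐ[fockMeasure J (Ioi 0) Unit] f' s) ∧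
    (∀ᵐ s ∂volume.restrict (Ioc 0 t), g s =ᵐ[fockMeasure J (Ioi 0) J] g' s) := by
  constructor <;>
  · filter_upwards [h.2.2, h'.2.2] with s hs hs'
    obtain ⟨φs, h1, h2, h3⟩ := hs
    obtain ⟨φs', h1', h2', h3'⟩ := hs'
    have := h1.unique h1'
    subst this
    first
    | exact h2.trans h2'.symm
    | exact h3.trans h3'.symm

/-- The defining identity, required for some version of the integrands, holds for every version.
Uniqueness follows, and later arguments may use whichever version is convenient. -/
theorem QSProcess.IsIntegralAt.ae_eq {C : QSProcess J} {t : ℝ} {φ : FockPlus J (Ioi 0) Unit}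
    {ψ : FockMinus J (Ioi 0) Unit} (h : C.IsIntegralAt t φ ψ)
    {f : ℝ → Chain J × Unit → ℂ} {g : ℝ → Chain J × J → ℂ} (h' : C.IsVersion t φ f g) :
    ∀ᵐ x ∂fockMeasure J (Ioi 0) Unit, IntegrableOn (fun s => f s x) (Ioc 0 t) ∧
      ψ.1 x = integralFun t f g x := by
  obtain ⟨f', g', hf', hg', hv, hψ⟩ := h
  obtain ⟨h1, h2⟩ := QSProcess.IsVersion.ae_eq ⟨hf', hg', hv⟩ h'
  have h3 := (Measure.ae_ae_comm (p := fun s x => f' s x = f s x)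
    (measurableSet_eq_fun hf' h'.1)).1 h1
  rw [ae_fockMeasure_unit] at h3 ⊢
  filter_upwards [hψ, h3, ae_sum_points_congr hg' h'.2.1 h2] with τ hτ hτ' hτ''
  refine ⟨hτ.1.congr hτ', hτ.2.trans ?_⟩
  unfold integralFun
  congr 1
  · exact integral_congr_ae hτ'
  · refine Finset.sum_congr rfl fun p hp => ?_
    rw [Finset.mem_filter] at hp
    exact hτ'' p hp.1 hp.2

theorem QSProcess.IsIntegralAt.unique {C : QSProcess J} {t : ℝ} {φ : FockPlus J (Ioi 0) Unit}
    {ψ ψ' : FockMinus J (Ioi 0) Unit} (h : C.IsIntegralAt t φ ψ) (h' : C.IsIntegralAt t φ ψ') :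
    ψ = ψ' := by
  obtain ⟨f, g, hf, hg, hv, hψ⟩ := id h'
  refine Subtype.ext (FockFun.ext_ae ?_)
  filter_upwards [h.ae_eq ⟨hf, hg, hv⟩, h'.ae_eq ⟨hf, hg, hv⟩] with x hx hx'
  rw [hx.2, hx'.2]

theorem ae_slice_of_ae {P : Chain J × Unit → Prop}
    (h : ∀ᵐ x ∂fockMeasure J (Ioi 0) Unit, P x) (t : ℝ) :
    ∀ᵐ s ∂volume.restrict (Ioc 0 t), ∀ᵐ x ∂fockMeasure J (Ioi 0) J, P (x.1.insert (s, x.2), ()) := by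
  rw [ae_fockMeasure_unit] at h
  exact ae_restrict_of_ae_restrict_of_subset Ioc_subset_Ioi_self
    (Measure.ae_ae_of_ae_prod ((quasiMeasurePreserving_insert (Ioi 0)).ae h))

theorem QSProcess.IsIntegralAt.add {C : QSProcess J} {t : ℝ} {φ φ' : FockPlus J (Ioi 0) Unit}
    {ψ ψ' : FockMinus J (Ioi 0) Unit} (h : C.IsIntegralAt t φ ψ) (h' : C.IsIntegralAt t φ' ψ') :
    C.IsIntegralAt t (φ + φ') (ψ + ψ') := by
  obtain ⟨f, g, hf, hg, hv, hψ⟩ := h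
  obtain ⟨f', g', hf', hg', hv', hψ'⟩ := h'
  refine ⟨fun s x => f s x + f' s x, fun s x => g s x + g' s x, hf.add hf', hg.add hg', ?_, ?_⟩
  · filter_upwards [hv, hv', ae_slice_of_ae (FockFun.coe_add φ.1 φ'.1) t] with s hs hs' hss
    obtain ⟨φs, h1, h2, h3⟩ := hs
    obtain ⟨φs', h1', h2', h3'⟩ := hs'
    refine ⟨φs + φs', ?_, ?_, ?_⟩
    · refine (FockFun.coe_add φs.1 φs'.1).trans ?_
      filter_upwards [hss, h1, h1'] with x hx h1 h1'
      rw [h1, h1']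
      exact hx.symm
    · have : (C s).drift (φ + φ') + (C s).annihilation (φs + φs') =
          ((C s).drift φ + (C s).annihilation φs) + ((C s).drift φ' + (C s).annihilation φs') := by
        rw [map_add, map_add]; abel
      rw [this]
      refine EventuallyEq.trans ?_ (FockFun.coe_add _ _).symm
      filter_upwards [h2, h2'] with x h2 h2'
      rw [h2, h2']
    · have : (C s).creation (φ + φ') + (C s).number (φs + φs') =
          ((C s).creation φ + (C s).number φs) + ((C s).creation φ' + (C s).number φs') := by
        rw [map_add, map_add]; abel
      rw [this]
      refine EventuallyEq.trans ?_ (FockFun.coe_add _ _).symm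
      filter_upwards [h3, h3'] with x h2 h2'
      rw [h2, h2']
  · filter_upwards [hψ, hψ', ae_fockMeasure_unit.1 (FockFun.coe_add ψ.1 ψ'.1)] with τ h1 h2 h3
    refine ⟨h1.1.add h2.1, ?_⟩
    rw [integral_add h1.1 h2.1, Finset.sum_add_distrib]
    refine h3.trans ?_
    rw [h1.2, h2.2]
    ring

theorem QSProcess.IsIntegralAt.smul {C : QSProcess J} {t : ℝ} {φ : FockPlus J (Ioi 0) Unit}
    {ψ : FockMinus J (Ioi 0) Unit} (h : C.IsIntegralAt t φ ψ) (c : ℂ) :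
    C.IsIntegralAt t (c • φ) (c • ψ) := by
  obtain ⟨f, g, hf, hg, hv, hψ⟩ := h
  refine ⟨fun s x => c * f s x, fun s x => c * g s x, hf.const_mul c, hg.const_mul c, ?_, ?_⟩
  · filter_upwards [hv, ae_slice_of_ae (FockFun.coe_smul c φ.1) t] with s hs hss
    obtain ⟨φs, h1, h2, h3⟩ := hs
    refine ⟨c • φs, ?_, ?_, ?_⟩
    · refine (FockFun.coe_smul c φs.1).trans ?_
      filter_upwards [hss, h1] with x hx h1
      rw [h1]
      exact hx.symm
    · rw [map_smul, map_smul, ← smul_add]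
      refine EventuallyEq.trans ?_ (FockFun.coe_smul c _).symm
      filter_upwards [h2] with x h2
      rw [h2]
    · rw [map_smul, map_smul, ← smul_add]
      refine EventuallyEq.trans ?_ (FockFun.coe_smul c _).symm
      filter_upwards [h3] with x h2
      rw [h2]
  · filter_upwards [hψ, ae_fockMeasure_unit.1 (FockFun.coe_smul c ψ.1)] with τ h1 h3
    refine ⟨h1.1.const_mul c, ?_⟩
    rw [integral_const_mul, ← Finset.mul_sum, ← mul_add, ← h1.2]
    exact h3

/-- A QS-integral that exists at every `φ` is a linear operator, and unique. -/
theorem QSProcess.exists_unique_integral {C : QSProcess J} {t : ℝ}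
    (h : ∀ φ, ∃ ψ, C.IsIntegralAt t φ ψ) :
    ∃ L : FockOp J (Ioi 0) Unit Unit, ∀ L', C.IsIntegral t L' ↔ L' = L := by
  choose L hL using h
  -- Linearity of the chosen values is a consequence of uniqueness at each vector.
  refine ⟨⟨⟨L, fun φ φ' => ?_⟩, fun c φ => ?_⟩, fun L' => ⟨fun h' => ?_, ?_⟩⟩
  · exact (hL (φ + φ')).unique ((hL φ).add (hL φ'))
  · exact (hL (c • φ)).unique ((hL φ).smul c)
  · ext1 φ
    exact (h' φ).unique (hL φ)
  · rintro rfl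
    exact hL

/-- Two of the entries act on `φ°_s`, which varies with `s`, so their weak measurability does not
apply directly; the finite norms `h1` and `h2` allow `φ°_s` to be approximated by countably valued
functions of `s`. -/
theorem QSProcess.exists_isParts {C : QSProcess J} (hC : C.WeaklyMeasurable) {t ζ ξ : ℝ}
    (hζ : 1 < ζ) (hξ : 0 < ξ) (hξ1 : ξ < 1)
    (h1 : ∀ᵐ s ∂volume.restrict (Ioc 0 t), opNorm ζ ξ (C s).annihilation < ⊤)
    (h2 : ∀ᵐ s ∂volume.restrict (Ioc 0 t), opNorm ζ ξ (C s).number < ⊤)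
    (φ : FockPlus J (Ioi 0) Unit) : ∃ f₀ f₁ g₀ g₁, C.IsParts t φ f₀ f₁ g₀ g₁ := by
  have hres : (volume.restrict (Ioc 0 t) : Measure ℝ) ≤ volume.restrict (Ioi 0) :=
    Measure.restrict_mono Ioc_subset_Ioi_self le_rfl
  -- The value `0` is used where the slice is not in `𝒢⁺ ⊗ ℰ(s)`, which happens only for a null set
  -- of instants.
  let v : ℝ → FockPlus J (Ioi 0) J := fun s => if h : ∃ φs, IsSlice φ s φs then h.choose else 0
  have hv : ∀ᵐ s ∂volume.restrict (Ioc 0 t), IsSlice φ s (v s) := by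
    filter_upwards [ae_mono hres (exists_isSlice φ)] with s hs
    simp only [v, dif_pos hs]
    exact hs.choose_spec
  have hv' : ∀ᵐ s ∂volume.restrict (Ioc 0 t), sliceFun φ.1 s =ᵐ[fockMeasure J (Ioi 0) J] (v s).1 := by
    filter_upwards [hv] with s hs using hs.symm
  have hm := measurable_sliceFun φ.1.measurable
  obtain ⟨f₀, hf₀, hf₀'⟩ := exists_version (volume.restrict (Ioc 0 t)) (fun s => (C s).drift φ)
    fun χ => (hC.1 φ χ).mono_measure hres
  obtain ⟨g₀, hg₀, hg₀'⟩ := exists_version (volume.restrict (Ioc 0 t)) (fun s => (C s).creation φ)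
    fun χ => (hC.2.1 φ χ).mono_measure hres
  obtain ⟨f₁, hf₁, hf₁'⟩ := exists_version (volume.restrict (Ioc 0 t))
    (fun s => (C s).annihilation (v s)) fun χ => aemeasurable_pairing_apply hm hv'
      (fun φ χ => (hC.2.2.1 φ χ).mono_measure hres) hζ hξ hξ1 h1 χ
  obtain ⟨g₁, hg₁, hg₁'⟩ := exists_version (volume.restrict (Ioc 0 t))
    (fun s => (C s).number (v s)) fun χ => aemeasurable_pairing_apply hm hv'
      (fun φ χ => (hC.2.2.2 φ χ).mono_measure hres) hζ hξ hξ1 h2 χ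
  refine ⟨f₀, f₁, g₀, g₁, hf₀, hf₁, hg₀, hg₁, ?_⟩
  filter_upwards [hv, hf₀', hf₁', hg₀', hg₁'] with s h0 h1 h2 h3 h4
  exact ⟨v s, h0, h1, h2, h3, h4⟩

end Integral

/-! ### The basic estimate and the existence of the QS-integral -/

section BasicEstimate

variable {J : Type*} [MeasurableSpace J]

theorem eLpNorm_one_ennreal {X : Type*} [MeasurableSpace X] (μ : Measure X) (f : X → ℝ≥0∞) :
    eLpNorm f 1 μ = ∫⁻ x, f x ∂μ := by
  simp [eLpNorm_one_eq_lintegral_enorm]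

theorem eLpNorm_two_ennreal {X : Type*} [MeasurableSpace X] (μ : Measure X) (f : X → ℝ≥0∞) :
    eLpNorm f 2 μ = (∫⁻ x, f x ^ 2 ∂μ) ^ (1 / 2 : ℝ) := by
  rw [eLpNorm_eq_lintegral_rpow_enorm_toReal (by norm_num) (by norm_num)]
  simp

theorem ae_le_eLpNorm_top {X : Type*} [MeasurableSpace X] (μ : Measure X) (f : X → ℝ≥0∞) :
    ∀ᵐ x ∂μ, f x ≤ eLpNorm f ⊤ μ := by
  rw [eLpNorm_exponent_top]
  exact ae_le_eLpNormEssSup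

theorem sqrt_lintegral_const_mul_sq {X : Type*} [MeasurableSpace X] (μ : Measure X) (c : ℝ≥0∞)
    {f : X → ℝ≥0∞} (hf : Measurable f) :
    (∫⁻ x, (c * f x) ^ 2 ∂μ) ^ (1 / 2 : ℝ) = c * (∫⁻ x, f x ^ 2 ∂μ) ^ (1 / 2 : ℝ) := by
  simp_rw [mul_pow]
  rw [lintegral_const_mul _ (hf.pow_const 2), ENNReal.mul_rpow_of_nonneg _ _ (by norm_num),
    ← ENNReal.rpow_two, ← ENNReal.rpow_mul]
  norm_num

variable [Countable J] [MeasurableSingletonClass J]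

theorem sqrt_lintegral_add_sq_le {X : Type*} [MeasurableSpace X] (μ : Measure X)
    {f g : X → ℝ≥0∞} (hf : Measurable f) (hg : Measurable g) :
    (∫⁻ x, (f x + g x) ^ 2 ∂μ) ^ (1 / 2 : ℝ) ≤
      (∫⁻ x, f x ^ 2 ∂μ) ^ (1 / 2 : ℝ) + (∫⁻ x, g x ^ 2 ∂μ) ^ (1 / 2 : ℝ) := by
  have := ENNReal.lintegral_Lp_add_le (μ := μ) hf.aemeasurable hg.aemeasurable
    (p := 2) (by norm_num)
  simpa only [Pi.add_apply, ENNReal.rpow_two] using this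

theorem sqrt_sq (a : ℝ≥0∞) : (a ^ 2) ^ (1 / 2 : ℝ) = a := by
  rw [← ENNReal.rpow_two, ← ENNReal.rpow_mul]
  norm_num

theorem scaleNorm_integralFun_le {η ε t : ℝ} (hη : 0 < η) (hε : 0 < ε)
    {f : ℝ → Chain J × Unit → ℂ} {g : ℝ → Chain J × J → ℂ}
    (hf : Measurable (Function.uncurry f)) (hg : Measurable (Function.uncurry g)) :
    scaleNorm J (Ioi 0) Unit η (integralFun t f g) ≤
      (∫⁻ s in Ioc 0 t, scaleNorm J (Ioi 0) Unit (η + ε) (f s)) +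
        ENNReal.ofReal (η / ε * (η + ε)) ^ (1 / 2 : ℝ) *
          (∫⁻ s in Ioc 0 t, scaleNorm J (Ioi 0) J (η + ε) (g s) ^ 2) ^ (1 / 2 : ℝ) := by
  have h1 : Measurable fun x : Chain J × Unit => ∫ s in Ioc 0 t, f s x :=
    (StronglyMeasurable.integral_prod_left (μ := volume.restrict (Ioc 0 t))
      (f := f) hf.stronglyMeasurable).measurable
  have h2 : Measurable fun x : Chain J × Unit =>
      ∑ p ∈ x.1.points with p.1 ∈ Iic t, g p.1 (x.1.erase p, p.2) :=
    measurable_sum_with (A := Iic t) measurableSet_Iic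
      (g := fun p (x : Chain J × Unit) => g p.1 (x.1, p.2))
      (hg.comp (show Measurable fun y : (ℝ × J) × Chain J × Unit => (y.1.1, (y.2.1, y.1.2)) by
        fun_prop))
  refine (scaleNorm_add_le η h1 h2).trans (add_le_add ?_ ?_)
  · exact (scaleNorm_integral_le _ η hf).trans
      (lintegral_mono fun s => scaleNorm_mono_weight hη.le (by linarith) _)
  · have h3 := scaleNorm_sum_le (B := Ioi 0) hη hε (A := Iic t) measurableSet_Iic hg
    rw [inter_comm, Ioi_inter_Iic] at h3
    rw [← ENNReal.mul_rpow_of_nonneg _ _ (by norm_num)]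
    refine le_trans (le_of_eq (sqrt_sq _).symm) (ENNReal.rpow_le_rpow h3 (by norm_num))

/-- The constant in the basic estimate. -/
def estimateConst (ζ ξ ε : ℝ) : ℝ≥0∞ :=
  (1 + ENNReal.ofReal ((ξ - ε) / ε * ξ) ^ (1 / 2 : ℝ)) * (1 + ENNReal.ofReal (ζ / ε) ^ (1 / 2 : ℝ))

theorem estimateConst_lt_top (ζ ξ ε : ℝ) : estimateConst ζ ξ ε < ⊤ := by
  refine ENNReal.mul_lt_top ?_ ?_ <;>
  exact ENNReal.add_lt_top.2 ⟨ENNReal.one_lt_top,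
    ENNReal.rpow_lt_top_of_nonneg (by norm_num) ENNReal.ofReal_ne_top⟩

/-- The sum of the four norms of a process. -/
def QSProcess.normSum (C : QSProcess J) (t ζ ξ : ℝ) : ℝ≥0∞ :=
  opLpNorm 1 t ζ ξ (fun s => (C s).drift) + opLpNorm 2 t ζ ξ (fun s => (C s).creation) +
    opLpNorm 2 t ζ ξ (fun s => (C s).annihilation) + opLpNorm ⊤ t ζ ξ (fun s => (C s).number)

variable {C : QSProcess J} {t : ℝ} {φ : FockPlus J (Ioi 0) Unit}
  {f₀ f₁ : ℝ → Chain J × Unit → ℂ} {g₀ g₁ : ℝ → Chain J × J → ℂ}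

theorem lintegral_slice_sq_le {ζ ε : ℝ} (hζ : 1 < ζ) (hε : 0 < ε) (t : ℝ)
    (φ : FockPlus J (Ioi 0) Unit) :
    (∫⁻ s in Ioc 0 t, scaleNorm J (Ioi 0) J ζ (sliceFun φ.1 s) ^ 2) ^ (1 / 2 : ℝ) ≤
      ENNReal.ofReal (ζ / ε) ^ (1 / 2 : ℝ) * scaleNorm J (Ioi 0) Unit (ζ + ε) φ.1 := by
  have h1 := (lintegral_mono_set (μ := volume) (show Ioc 0 t ⊆ Ioi (0 : ℝ) from Ioc_subset_Ioi_self)).trans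
    (lintegral_sliceFun_le (B := Ioi 0) hζ.le hε φ.1.measurable)
  refine (ENNReal.rpow_le_rpow h1 (by norm_num)).trans ?_
  rw [ENNReal.mul_rpow_of_nonneg _ _ (by norm_num), sqrt_sq]

/-- The time integral explains two of the exponents: the drift acts on the fixed `φ`, so its norm
need only be integrable, while the annihilation part acts on the square-integrable slice and pairs
with it by Cauchy–Schwarz. -/
theorem QSProcess.IsParts.lintegral_le (h : C.IsParts t φ f₀ f₁ g₀ g₁) {ζ ξ ε : ℝ} (hζ : 1 < ζ)
    (hε : 0 < ε) :
    ∫⁻ s in Ioc 0 t, scaleNorm J (Ioi 0) Unit ξ (fun x => f₀ s x + f₁ s x) ≤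
      opLpNorm 1 t ζ ξ (fun s => (C s).drift) * scaleNorm J (Ioi 0) Unit ζ φ.1 +
      opLpNorm 2 t ζ ξ (fun s => (C s).annihilation) *
        (ENNReal.ofReal (ζ / ε) ^ (1 / 2 : ℝ) * scaleNorm J (Ioi 0) Unit (ζ + ε) φ.1) := by
  have hm0 : ∀ s, Measurable (f₀ s) := fun s =>
    h.measurable_drift.comp (measurable_const.prodMk measurable_id)
  have hm1 : ∀ s, Measurable (f₁ s) := fun s =>
    h.measurable_annihilation.comp (measurable_const.prodMk measurable_id)
  refine (lintegral_mono fun s => scaleNorm_add_le ξ (hm0 s) (hm1 s)).trans ?_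
  rw [lintegral_add_left (measurable_scaleNorm _ h.measurable_drift)]
  refine add_le_add ?_ ?_
  · rw [opLpNorm, eLpNorm_one_ennreal]
    rw [← lintegral_mul_const' _ _ (φ.2 ζ hζ).ne]
    refine lintegral_mono_ae ?_
    filter_upwards [h.ae] with s hs
    obtain ⟨φs, -, h1, -⟩ := hs
    rw [scaleNorm_congr ξ h1]
    exact scaleNorm_le_opNorm hζ _ _
  · rw [opLpNorm, eLpNorm_two_ennreal]
    refine le_trans (lintegral_le_sqrt_of_le_mul (volume.restrict (Ioc 0 t))
      (F := fun s => scaleNorm J (Ioi 0) Unit ξ (f₁ s))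
      (M := fun s => opNorm ζ ξ (C s).annihilation)
      (b := fun s => scaleNorm J (Ioi 0) J ζ (sliceFun φ.1 s))
      (measurable_scaleNorm _ h.measurable_annihilation)
      (measurable_scaleNorm _ (measurable_sliceFun φ.1.measurable)) ?_ ?_) ?_
    · filter_upwards [h.ae] with s hs
      obtain ⟨φs, h0, -⟩ := hs
      rw [← scaleNorm_congr ζ (isSlice_iff.1 h0)]
      exact φs.2 ζ hζ
    · filter_upwards [h.ae] with s hs
      obtain ⟨φs, h0, -, h1, -⟩ := hs
      rw [← scaleNorm_congr ζ (isSlice_iff.1 h0), scaleNorm_congr ξ h1]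
      exact scaleNorm_le_opNorm hζ _ _
    · gcongr
      exact lintegral_slice_sq_le hζ hε t φ

/-- The point sum requires square integrals over `s`: an `L²` norm suffices for creation, acting on
the fixed `φ`, and an `L^∞` norm is used for the number part, whose argument is only square
integrable. -/
theorem QSProcess.IsParts.sqrt_lintegral_le (h : C.IsParts t φ f₀ f₁ g₀ g₁) {ζ ξ ε : ℝ}
    (hζ : 1 < ζ) (hε : 0 < ε) :
    (∫⁻ s in Ioc 0 t, scaleNorm J (Ioi 0) J ξ (fun x => g₀ s x + g₁ s x) ^ 2) ^ (1 / 2 : ℝ) ≤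
      opLpNorm 2 t ζ ξ (fun s => (C s).creation) * scaleNorm J (Ioi 0) Unit ζ φ.1 +
      opLpNorm ⊤ t ζ ξ (fun s => (C s).number) *
        (ENNReal.ofReal (ζ / ε) ^ (1 / 2 : ℝ) * scaleNorm J (Ioi 0) Unit (ζ + ε) φ.1) := by
  have hm0 : ∀ s, Measurable (g₀ s) := fun s =>
    h.measurable_creation.comp (measurable_const.prodMk measurable_id)
  have hm1 : ∀ s, Measurable (g₁ s) := fun s =>
    h.measurable_number.comp (measurable_const.prodMk measurable_id)
  refine (ENNReal.rpow_le_rpow (lintegral_mono fun s =>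
    pow_le_pow_left' (scaleNorm_add_le ξ (hm0 s) (hm1 s)) 2) (by norm_num)).trans ?_
  refine (sqrt_lintegral_add_sq_le _ (measurable_scaleNorm _ h.measurable_creation)
    (measurable_scaleNorm _ h.measurable_number)).trans ?_
  refine add_le_add ?_ ?_
  · rw [opLpNorm, eLpNorm_two_ennreal]
    have h1 : (∫⁻ s in Ioc 0 t, opNorm ζ ξ (C s).creation ^ 2) ^ (1 / 2 : ℝ) *
        scaleNorm J (Ioi 0) Unit ζ φ.1 =
        (∫⁻ s in Ioc 0 t, (opNorm ζ ξ (C s).creation * scaleNorm J (Ioi 0) Unit ζ φ.1) ^ 2) ^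
          (1 / 2 : ℝ) := by
      simp_rw [mul_pow]
      rw [lintegral_mul_const' _ _ (ENNReal.pow_lt_top (φ.2 ζ hζ)).ne,
        ENNReal.mul_rpow_of_nonneg _ _ (by norm_num), sqrt_sq]
    rw [h1]
    refine ENNReal.rpow_le_rpow (lintegral_mono_ae ?_) (by norm_num)
    filter_upwards [h.ae] with s hs
    obtain ⟨φs, -, -, -, h1, -⟩ := hs
    rw [scaleNorm_congr ξ h1]
    exact pow_le_pow_left' (scaleNorm_le_opNorm hζ _ _) 2
  · refine le_trans ?_ (mul_le_mul_right (lintegral_slice_sq_le hζ hε t φ) _)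
    rw [← sqrt_lintegral_const_mul_sq _ _ (measurable_scaleNorm _ (measurable_sliceFun φ.1.measurable))]
    refine ENNReal.rpow_le_rpow (lintegral_mono_ae ?_) (by norm_num)
    filter_upwards [h.ae, ae_le_eLpNorm_top (volume.restrict (Ioc 0 t))
      fun s => opNorm ζ ξ (C s).number] with s hs hs'
    obtain ⟨φs, h0, -, -, -, h1⟩ := hs
    rw [← scaleNorm_congr ζ (isSlice_iff.1 h0), scaleNorm_congr ξ h1]
    exact pow_le_pow_left' ((scaleNorm_le_opNorm hζ _ _).trans (mul_le_mul_left hs' _)) 2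

/-- The basic estimate for QS-integrals. -/
theorem QSProcess.IsParts.estimate (h : C.IsParts t φ f₀ f₁ g₀ g₁) {ζ ξ ε : ℝ}
    (hζ : 1 < ζ) (hε : 0 < ε) (hεξ : ε < ξ) :
    scaleNorm J (Ioi 0) Unit (ξ - ε)
      (integralFun t (fun s x => f₀ s x + f₁ s x) (fun s x => g₀ s x + g₁ s x)) ≤
      estimateConst ζ ξ ε * C.normSum t ζ ξ * scaleNorm J (Ioi 0) Unit (ζ + ε) φ.1 := by
  have h1 := scaleNorm_integralFun_le (η := ξ - ε) (ε := ε) (t := t) (by linarith) hε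
    h.isVersion.1 h.isVersion.2.1
  rw [sub_add_cancel] at h1
  refine h1.trans ((add_le_add (h.lintegral_le hζ hε)
    (mul_le_mul_right (h.sqrt_lintegral_le hζ hε) _)).trans ?_)
  unfold estimateConst QSProcess.normSum
  have h2 : scaleNorm J (Ioi 0) Unit ζ φ.1 ≤ scaleNorm J (Ioi 0) Unit (ζ + ε) φ.1 :=
    scaleNorm_mono_weight (by linarith) (by linarith) _
  generalize scaleNorm J (Ioi 0) Unit ζ φ.1 = x at *
  generalize scaleNorm J (Ioi 0) Unit (ζ + ε) φ.1 = y at *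
  generalize ENNReal.ofReal (ζ / ε) ^ (1 / 2 : ℝ) = c₁
  generalize ENNReal.ofReal ((ξ - ε) / ε * ξ) ^ (1 / 2 : ℝ) = c₂
  generalize opLpNorm 1 t ζ ξ (fun s => (C s).drift) = a
  generalize opLpNorm 2 t ζ ξ (fun s => (C s).creation) = b
  generalize opLpNorm 2 t ζ ξ (fun s => (C s).annihilation) = c
  generalize opLpNorm ⊤ t ζ ξ (fun s => (C s).number) = d
  -- The terms added here are those missing from the expansion of the product of the two constants
  -- with the sum of the four norms.
  calc a * x + c * (c₁ * y) + c₂ * (b * x + d * (c₁ * y))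
      ≤ a * y + c * (c₁ * y) + c₂ * (b * y + d * (c₁ * y)) := by gcongr
    _ ≤ (a * y + c * (c₁ * y) + c₂ * (b * y + d * (c₁ * y))) +
        (b * y + c * y + d * y + a * (c₁ * y) + b * (c₁ * y) + d * (c₁ * y) +
          c₂ * (a * y + c * y + d * y + a * (c₁ * y) + c * (c₁ * y) + b * (c₁ * y))) :=
        le_self_add
    _ = (1 + c₂) * (1 + c₁) * (a + b + c + d) * y := by ring

theorem MemOpLp.ae_lt_top {I I' : Type*} [MeasurableSpace I] [MeasurableSpace I'] {p : ℝ≥0∞}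
    (hp : p ≠ 0) {t ζ ξ : ℝ} {T : ℝ → FockOp J (Ioi 0) I I'} (h : MemOpLp p t ζ ξ T) :
    ∀ᵐ s ∂volume.restrict (Ioc 0 t), opNorm ζ ξ (T s) < ⊤ := by
  by_cases hp' : p = ⊤
  · subst hp'
    filter_upwards [ae_le_eLpNorm_top (volume.restrict (Ioc 0 t)) fun s => opNorm ζ ξ (T s)]
      with s hs
    exact hs.trans_lt h.2
  · have h1 := h.2
    rw [eLpNorm_lt_top_iff_lintegral_rpow_enorm_lt_top hp hp'] at h1
    simp only [enorm_eq_self] at h1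
    filter_upwards [ae_lt_top' (h.1.aemeasurable.pow_const _) h1.ne] with s hs
    exact (ENNReal.rpow_lt_top_iff_of_pos (ENNReal.toReal_pos hp hp')).1 hs

theorem QSProcess.LocallyQSIntegrable.exists_normSum (hC : C.LocallyQSIntegrable) {ξ : ℝ}
    (hξ : ξ ∈ Ioo (0 : ℝ) 1) {t : ℝ} (ht : 0 < t) : ∃ ζ > 1, C.normSum t ζ ξ < ⊤ := by
  obtain ⟨ζ, hζ, h1, h2, h3, h4⟩ := hC.2 ξ hξ t ht
  exact ⟨ζ, hζ, ENNReal.add_lt_top.2 ⟨ENNReal.add_lt_top.2 ⟨ENNReal.add_lt_top.2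
    ⟨h1.2, h2.2⟩, h3.2⟩, h4.2⟩⟩

theorem QSProcess.LocallyQSIntegrable.exists_isParts (hC : C.LocallyQSIntegrable) (ht : 0 < t)
    (φ : FockPlus J (Ioi 0) Unit) : ∃ f₀ f₁ g₀ g₁, C.IsParts t φ f₀ f₁ g₀ g₁ := by
  obtain ⟨ζ, hζ, -, -, h3, h4⟩ := hC.2 (1 / 2) (by norm_num) t ht
  exact QSProcess.exists_isParts hC.1 hζ (by norm_num) (by norm_num)
    (h3.ae_lt_top (by norm_num)) (h4.ae_lt_top (by simp)) φ

/-- The right-hand side of (1) is itself the integral: the basic estimate puts it into `𝒢₋` and its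
time integral converges for almost every chain. -/
theorem QSProcess.LocallyQSIntegrable.exists_isIntegralAt (hC : C.LocallyQSIntegrable)
    (ht : 0 < t) (φ : FockPlus J (Ioi 0) Unit) : ∃ ψ, C.IsIntegralAt t φ ψ := by
  obtain ⟨f₀, f₁, g₀, g₁, h⟩ := hC.exists_isParts ht φ
  obtain ⟨hf, hg, hv⟩ := h.isVersion
  have hψ := measurable_integralFun (t := t) hf hg
  have hmem : FockFun.mk _ hψ ∈ FockMinus J (Ioi 0) Unit := by
    intro η hη
    obtain ⟨hη0, hη1⟩ := hη
    -- `ξ` is the midpoint of `η` and `1`, which leaves `ε = ξ - η > 0` for the loss in the scale.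
    obtain ⟨ζ, hζ, hs⟩ := hC.exists_normSum (ξ := (1 + η) / 2) ⟨by linarith, by linarith⟩ ht
    have h1 := h.estimate (ξ := (1 + η) / 2) (ε := (1 + η) / 2 - η) hζ (by linarith) (by linarith)
    rw [sub_sub_cancel] at h1
    rw [scaleNorm_congr η (FockFun.coe_mk _ hψ)]
    refine h1.trans_lt (ENNReal.mul_lt_top (ENNReal.mul_lt_top (estimateConst_lt_top _ _ _) hs)
      (φ.2 _ (show (1 : ℝ) < _ by linarith)))
  refine ⟨⟨_, hmem⟩, _, _, hf, hg, hv, ?_⟩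
  obtain ⟨ζ, hζ, hs⟩ := hC.exists_normSum (ξ := 1 / 2) (by norm_num) ht
  have h1 : ∫⁻ s in Ioc 0 t, scaleNorm J (Ioi 0) Unit (1 / 2) (fun x => f₀ s x + f₁ s x) < ⊤ := by
    refine (h.lintegral_le hζ one_pos).trans_lt ?_
    have hs' := ENNReal.add_lt_top.1 hs
    have hs'' := ENNReal.add_lt_top.1 hs'.1
    refine ENNReal.add_lt_top.2 ⟨ENNReal.mul_lt_top (ENNReal.add_lt_top.1 hs''.1).1 (φ.2 ζ hζ),
      ENNReal.mul_lt_top hs''.2 (ENNReal.mul_lt_top ?_ (φ.2 _ (show (1 : ℝ) < _ by linarith)))⟩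
    exact ENNReal.rpow_lt_top_of_nonneg (by norm_num) ENNReal.ofReal_ne_top
  have h2 := ae_fockMeasure_unit.1 (ae_integrable_of_scaleNorm (volume.restrict (Ioc 0 t))
    (by norm_num) hf h1)
  filter_upwards [h2, ae_fockMeasure_unit.1 (FockFun.coe_mk _ hψ)] with τ h3 h4
  exact ⟨h3, h4⟩

end BasicEstimate

/-! ### Simple processes are locally QS-integrable -/

section Simple

variable {J : Type*} [MeasurableSpace J] [Countable J] [MeasurableSingletonClass J] {B : Set ℝ}
  {I : Type*} [MeasurableSpace I] [Countable I] [MeasurableSingletonClass I]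
  {I' : Type*} [MeasurableSpace I'] [Countable I'] [MeasurableSingletonClass I']

theorem opNorm_zero (ζ ξ : ℝ) : opNorm ζ ξ (0 : FockOp J B I I') = 0 := by
  refine le_antisymm (iSup_le fun φ => ?_) bot_le
  have : scaleNorm J B I' ξ ((0 : FockOp J B I I') φ).1 = 0 := scaleNorm_zero ξ
  rw [this, ENNReal.zero_div]

theorem opNorm_add_le {ζ ξ : ℝ} (S T : FockOp J B I I') :
    opNorm ζ ξ (S + T) ≤ opNorm ζ ξ S + opNorm ζ ξ T := by
  refine iSup_le fun φ => ?_
  have h : scaleNorm J B I' ξ ((S + T) φ).1 ≤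
      scaleNorm J B I' ξ (S φ).1 + scaleNorm J B I' ξ (T φ).1 :=
    (scaleNorm_congr ξ (FockFun.coe_add (S φ).1 (T φ).1)).le.trans
      (scaleNorm_add_le ξ (S φ).1.measurable (T φ).1.measurable)
  refine (ENNReal.div_le_div_right h _).trans ?_
  rw [ENNReal.add_div]
  exact add_le_add (le_iSup (fun φ => scaleNorm J B I' ξ (S φ).1 / scaleNorm J B I ζ φ.1) φ)
    (le_iSup (fun φ => scaleNorm J B I' ξ (T φ).1 / scaleNorm J B I ζ φ.1) φ)

theorem opNorm_sum_le {α : Type*} (s : Finset α) {ζ ξ : ℝ} (T : α → FockOp J B I I') :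
    opNorm ζ ξ (∑ a ∈ s, T a) ≤ ∑ a ∈ s, opNorm ζ ξ (T a) := by
  induction s using Finset.induction_on with
  | empty => simp [opNorm_zero]
  | insert a s ha ih =>
    rw [Finset.sum_insert ha, Finset.sum_insert ha]
    exact (opNorm_add_le _ _).trans (add_le_add le_rfl ih)

theorem opNorm_mono {ζ ζ' ξ ξ' : ℝ} (hζ : 0 ≤ ζ) (hζ' : ζ ≤ ζ') (hξ : 0 ≤ ξ') (hξ' : ξ' ≤ ξ)
    (T : FockOp J B I I') : opNorm ζ' ξ' T ≤ opNorm ζ ξ T :=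
  iSup_mono fun _ => ENNReal.div_le_div (scaleNorm_mono_weight hξ hξ' _)
    (scaleNorm_mono_weight hζ hζ' _)

/-- A step function with values in the operators. -/
def stepOp {n : ℕ} (A : Fin n → Set ℝ) (T : Fin n → FockOp J B I I') (s : ℝ) : FockOp J B I I' :=
  ∑ l, if s ∈ A l then T l else 0

theorem pairing_zero (χ : FockPlus J B I) : pairing χ (0 : FockMinus J B I) = 0 :=
  map_zero (pairingHom χ)

theorem weaklyMeasurableOp_stepOp {n : ℕ} {A : Fin n → Set ℝ} (hA : ∀ l, MeasurableSet (A l))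
    (T : Fin n → FockOp J (Ioi 0) I I') : WeaklyMeasurableOp (stepOp A T) := by
  intro φ χ
  have h : (fun s => pairing χ (stepOp A T s φ)) =
      fun s => ∑ l, (A l).indicator (fun _ => pairing χ (T l φ)) s := by
    funext s
    rw [stepOp, LinearMap.sum_apply]
    refine (map_sum (pairingHom χ) _ _).trans (Finset.sum_congr rfl fun l _ => ?_)
    by_cases hs : s ∈ A l
    · simp only [hs, if_true, indicator_of_mem]; rfl
    · simp only [hs, if_false, not_false_eq_true, indicator_of_notMem]
      exact pairing_zero χ
  rw [h]
  exact (Finset.measurable_sum _ fun l _ => measurable_const.indicator (hA l)).aemeasurable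

theorem opNorm_stepOp_le {n : ℕ} (A : Fin n → Set ℝ) (T : Fin n → FockOp J B I I') (ζ ξ s : ℝ) :
    opNorm ζ ξ (stepOp A T s) ≤ ∑ l, opNorm ζ ξ (T l) := by
  refine (opNorm_sum_le _ _).trans (Finset.sum_le_sum fun l _ => ?_)
  split_ifs
  · exact le_rfl
  · rw [opNorm_zero]; exact bot_le

/-- The norm depends on `s` only through the finitely many truth values of `s ∈ A l`, so
measurability requires nothing of the operators. -/
theorem measurable_opNorm_stepOp {n : ℕ} {A : Fin n → Set ℝ} (hA : ∀ l, MeasurableSet (A l))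
    (T : Fin n → FockOp J B I I') (ζ ξ : ℝ) :
    Measurable fun s => opNorm ζ ξ (stepOp A T s) := by
  have h1 : Measurable fun s : ℝ => fun l => s ∈ A l :=
    measurable_pi_iff.2 fun l => measurable_mem.2 (hA l)
  have h2 : Measurable fun q : Fin n → Prop => opNorm ζ ξ (∑ l, if q l then T l else 0) :=
    Measurable.of_discrete
  exact h2.comp h1

theorem memOpLp_stepOp {n : ℕ} {A : Fin n → Set ℝ} (hA : ∀ l, MeasurableSet (A l))
    {T : Fin n → FockOp J (Ioi 0) I I'} {ζ ξ : ℝ} (h : ∀ l, opNorm ζ ξ (T l) < ⊤) (p : ℝ≥0∞)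
    (t : ℝ) : MemOpLp p t ζ ξ (stepOp A T) := by
  refine ⟨(measurable_opNorm_stepOp hA T ζ ξ).aestronglyMeasurable, ?_⟩
  have hc : ∑ l, opNorm ζ ξ (T l) < ⊤ := ENNReal.sum_lt_top.2 fun l _ => h l
  have h1 : eLpNorm (fun s => opNorm ζ ξ (stepOp A T s)) p (volume.restrict (Ioc 0 t)) ≤
      eLpNorm (fun _ : ℝ => (∑ l, opNorm ζ ξ (T l)).toReal) p (volume.restrict (Ioc 0 t)) := by
    refine eLpNorm_mono_enorm fun s => ?_
    rw [enorm_eq_self]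
    refine (opNorm_stepOp_le A T ζ ξ s).trans (le_of_eq ?_)
    rw [Real.enorm_of_nonneg ENNReal.toReal_nonneg, ENNReal.ofReal_toReal hc.ne]
  exact h1.trans_lt (memLp_const (∑ l, opNorm ζ ξ (T l)).toReal).2

theorem exists_opNorm_lt_top {n : ℕ} {T : Fin n → FockOp J B I I'} (hT : ∀ l, IsContinuousOp (T l))
    {ξ : ℝ} (hξ : ξ ∈ Ioo (0 : ℝ) 1) :
    ∃ ζ > 1, ∀ ζ' ≥ ζ, ∀ l, opNorm ζ' ξ (T l) < ⊤ := by
  choose z hz hz' using fun l => hT l ξ hξ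
  obtain ⟨M, hM⟩ := (Set.finite_range z).bddAbove
  refine ⟨max M 2, lt_max_of_lt_right one_lt_two, fun ζ' hζ' l => ?_⟩
  have h1 : z l ≤ ζ' := (hM ⟨l, rfl⟩).trans ((le_max_left _ _).trans hζ')
  exact (opNorm_mono (by linarith [hz l]) h1 hξ.1.le le_rfl _).trans_lt (hz' l)

theorem SimpleAdapted.locallyQSIntegrable {K : Type*} [NormedAddCommGroup K]
    [InnerProductSpace ℂ K] [CompleteSpace K] {G : GelfandField J K} (S : SimpleAdapted G) :
    S.process.LocallyQSIntegrable := by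
  let A : Fin S.n → Set ℝ := fun l => Ico (S.time l.castSucc) (S.time l.succ)
  have hA : ∀ l, MeasurableSet (A l) := fun l => measurableSet_Ico
  have e1 : (fun s => (S.process s).drift) = stepOp A fun l => (S.value l).drift := by
    funext s
    simp only [SimpleAdapted.process, stepOp]
    refine Finset.sum_congr rfl fun l _ => ?_
    by_cases h : s ∈ A l
    · rw [if_pos h]
    · rw [if_neg h]
  have e2 : (fun s => (S.process s).creation) = stepOp A fun l => (S.value l).creation := by
    funext s
    simp only [SimpleAdapted.process, stepOp]
    refine Finset.sum_congr rfl fun l _ => ?_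
    by_cases h : s ∈ A l
    · rw [if_pos h]
    · rw [if_neg h]
  have e3 : (fun s => (S.process s).annihilation) = stepOp A fun l => (S.value l).annihilation := by
    funext s
    simp only [SimpleAdapted.process, stepOp]
    refine Finset.sum_congr rfl fun l _ => ?_
    by_cases h : s ∈ A l
    · rw [if_pos h]
    · rw [if_neg h]
  have e4 : (fun s => (S.process s).number) = stepOp A fun l => (S.value l).number := by
    funext s
    simp only [SimpleAdapted.process, stepOp]
    refine Finset.sum_congr rfl fun l _ => ?_
    by_cases h : s ∈ A l
    · rw [if_pos h]
    · rw [if_neg h]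
  unfold QSProcess.LocallyQSIntegrable QSProcess.WeaklyMeasurable
  rw [e1, e2, e3, e4]
  refine ⟨⟨weaklyMeasurableOp_stepOp hA _, weaklyMeasurableOp_stepOp hA _,
    weaklyMeasurableOp_stepOp hA _, weaklyMeasurableOp_stepOp hA _⟩, fun ξ hξ t _ => ?_⟩
  obtain ⟨z1, hz1, h1⟩ := exists_opNorm_lt_top (fun l => (S.continuous l).1) hξ
  obtain ⟨z2, hz2, h2⟩ := exists_opNorm_lt_top (fun l => (S.continuous l).2.1) hξ
  obtain ⟨z3, hz3, h3⟩ := exists_opNorm_lt_top (fun l => (S.continuous l).2.2.1) hξ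
  obtain ⟨z4, hz4, h4⟩ := exists_opNorm_lt_top (fun l => (S.continuous l).2.2.2) hξ
  refine ⟨max (max z1 z2) (max z3 z4), lt_max_of_lt_left (lt_max_of_lt_left hz1),
    memOpLp_stepOp hA (h1 _ ?_) 1 t, memOpLp_stepOp hA (h2 _ ?_) 2 t,
    memOpLp_stepOp hA (h3 _ ?_) 2 t, memOpLp_stepOp hA (h4 _ ?_) ⊤ t⟩ <;> simp

end Simple

/-! ### The inclusion in the future factors -/

section Gram

variable {J : Type*} [Countable J]
  {K : Type*} [NormedAddCommGroup K] [InnerProductSpace ℂ K] [CompleteSpace K]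

/-- The images of the countably many basis vectors span a dense subspace, because `incl 0` has dense
range. -/
theorem GelfandField.separableSpace (G : GelfandField J K) : TopologicalSpace.SeparableSpace K := by
  let S : Set K := range fun j : J => G.incl 0 (lp.single 2 j 1)
  have hS : TopologicalSpace.IsSeparable (closure (Submodule.span ℂ S : Set K)) :=
    (TopologicalSpace.IsSeparable.span (R := ℂ) (countable_range _).isSeparable).closure
  have h1 : ∀ x, G.incl 0 x ∈ (Submodule.span ℂ S).topologicalClosure := by
    intro x
    have h : HasSum (fun j => G.incl 0 (lp.single 2 j (x j))) (G.incl 0 x) :=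
      (lp.hasSum_single (by norm_num) x).mapL (G.incl 0)
    refine (Submodule.isClosed_topologicalClosure _).mem_of_tendsto h
      (Eventually.of_forall fun s => Submodule.sum_mem _ fun j _ => ?_)
    refine Submodule.le_topologicalClosure _ ?_
    have : lp.single 2 j (x j) = x j • lp.single (E := fun _ : J => ℂ) 2 j 1 := by
      rw [← lp.single_smul]; simp
    rw [this, map_smul]
    exact Submodule.smul_mem _ _ (Submodule.subset_span ⟨j, rfl⟩)
  have h2 : closure (Submodule.span ℂ S : Set K) = univ := by
    refine eq_univ_of_univ_subset ?_
    rw [← (G.denseRange 0).closure_range]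
    refine closure_minimal ?_ isClosed_closure
    rintro _ ⟨x, rfl⟩
    exact h1 x
  rw [h2] at hS
  exact TopologicalSpace.isSeparable_univ_iff.1 hS

/-- The field is only weakly measurable by definition. Separability reduces a bound on the norm to
countably many bounds on inner products; `GelfandField.measurable_gram` then follows by
polarization. -/
theorem GelfandField.measurable_norm (G : GelfandField J K) (x : lp (fun _ : J => ℂ) 2) :
    Measurable fun t => ‖G.incl t x‖ := by
  have := G.separableSpace
  refine measurable_of_Iic fun c => ?_
  by_cases hc : 0 ≤ c
  · have h : (fun t => ‖G.incl t x‖) ⁻¹' Iic c = ⋂ n : ℕ,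
        {t | ‖(inner ℂ (TopologicalSpace.denseSeq K n) (G.incl t x) : ℂ)‖ ≤
          c * ‖TopologicalSpace.denseSeq K n‖} := by
      ext t
      simp only [mem_preimage, mem_Iic, mem_iInter, Set.mem_ofPred]
      refine ⟨fun h n => ?_, fun h =>
        norm_le_of_inner_le_dense (TopologicalSpace.denseRange_denseSeq K) hc h⟩
      refine (norm_inner_le_norm _ _).trans ?_
      rw [mul_comm]
      gcongr
    rw [h]
    exact MeasurableSet.iInter fun n =>
      measurableSet_le (G.measurable x _).norm measurable_const
  · convert MeasurableSet.empty
    ext t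
    simp only [mem_preimage, mem_Iic, mem_empty_iff_false, iff_false, not_le]
    exact (not_le.1 hc).trans_le (norm_nonneg _)

theorem GelfandField.measurable_gram (G : GelfandField J K) (j k : J) :
    Measurable fun t => G.gram t j k := by
  unfold GelfandField.gram
  simp_rw [inner_eq_sum_norm_sq_div_four (𝕜 := ℂ), ← map_smul, ← map_add, ← map_sub]
  have h : ∀ x, Measurable fun t => ((‖G.incl t x‖ : ℝ) : ℂ) := fun x =>
    Complex.measurable_ofReal.comp (G.measurable_norm x)
  exact (((((h _).pow_const 2).sub ((h _).pow_const 2)).add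
    ((((h _).pow_const 2).sub ((h _).pow_const 2)).mul_const _)).div_const _)

end Gram

section Embed

variable {J : Type*} [MeasurableSpace J]
  {K : Type*} [NormedAddCommGroup K] [InnerProductSpace ℂ K] [CompleteSpace K]

/-- The matrix of the inclusion at the instants `s > r`, and the unit matrix at `s ≤ r`. -/
def GelfandField.stepGram (G : GelfandField J K) (r s : ℝ) (j k : J) : ℂ :=
  if r < s then G.gram s j k else if k = j then 1 else 0

/-- The unit matrix at past points lets the sum run over all relabellings of all `n` points. The
index set no longer depends on the chain, which makes the expression visibly measurable in the
tuple. -/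
theorem GelfandField.embed_ofTuple (G : GelfandField J K) (r : ℝ) {I : Type*} {n : ℕ}
    {v : Fin n → ℝ × J} (hv : Function.Injective v) (φ : Chain J × I → ℂ) (i : I) :
    G.embed r φ (Chain.ofTuple v, i) = ∑' k : Fin n → J,
      (∏ l, G.stepGram r (v l).1 (v l).2 (k l)) *
        φ (Chain.ofTuple fun l => ((v l).1, k l), i) := by
  let P := {p // p ∈ (Chain.ofTuple v).points.filter fun p => r < p.1}
  let _ : Fintype P := Finset.fintypeCoeSort _
  have hP : ∀ l, r < (v l).1 → v l ∈ (Chain.ofTuple v).points.filter fun p => r < p.1 :=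
    fun l h => Finset.mem_filter.2 ⟨Chain.mem_ofTuple.2 ⟨l, rfl⟩, h⟩
  have hP' : ∀ p : P, ∃ l, v l = p.1 ∧ r < (v l).1 := by
    rintro ⟨p, hp⟩
    obtain ⟨h1, h2⟩ := Finset.mem_filter.1 hp
    obtain ⟨l, rfl⟩ := Chain.mem_ofTuple.1 h1
    exact ⟨l, rfl, h2⟩
  choose ix hix hix' using hP'
  -- A relabelling of the future points is completed by the original marks at the past points.
  let g : (P → J) → Fin n → J := fun k l => if h : r < (v l).1 then k ⟨v l, hP l h⟩ else (v l).2
  have hgix : ∀ k p, g k (ix p) = k p := by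
    intro k p
    simp only [g, dif_pos (hix' p)]
    congr 1
    exact Subtype.ext (hix p)
  have hg : Function.Injective g := fun k k' h => funext fun p => by
    rw [← hgix k, h, hgix]
  have hix_inj : Function.Injective ix := fun p q h => Subtype.ext (by rw [← hix p, h, hix q])
  rw [← hg.tsum_eq]
  · unfold GelfandField.embed
    refine tsum_congr fun k => ?_
    congr 1
    · have h1 : ∏ l, G.stepGram r (v l).1 (v l).2 (g k l) =
          ∏ l ∈ Finset.univ.image ix, G.stepGram r (v l).1 (v l).2 (g k l) := by
        refine (Finset.prod_subset (Finset.subset_univ _) fun l _ hl => ?_).symm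
        have : ¬ r < (v l).1 := by
          intro h
          refine hl (Finset.mem_image.2 ⟨⟨v l, hP l h⟩, Finset.mem_univ _, hv ?_⟩)
          exact hix ⟨v l, hP l h⟩
        simp [GelfandField.stepGram, this, g]
      rw [h1, Finset.prod_image fun _ _ _ _ h => hix_inj h]
      refine Finset.prod_congr rfl fun p _ => ?_
      rw [hgix, GelfandField.stepGram, if_pos (hix' p), hix p]
    · congr 2
      refine Chain.ext_points (Finset.ext fun q => ?_)
      simp only [Finset.mem_union, Finset.mem_filter, Finset.mem_image, Finset.mem_univ, true_and,
        Chain.mem_ofTuple]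
      constructor
      · rintro (⟨⟨l, rfl⟩, h⟩ | ⟨p, rfl⟩)
        · exact ⟨l, Prod.ext rfl (by simp [g, not_lt.2 h])⟩
        · exact ⟨ix p, Prod.ext (by rw [hix p]) (hgix k p)⟩
      · rintro ⟨l, rfl⟩
        by_cases h : r < (v l).1
        · right
          exact ⟨⟨v l, hP l h⟩, Prod.ext rfl (by simp [g, h])⟩
        · left
          exact ⟨⟨l, Prod.ext rfl (by simp [g, h])⟩, not_lt.1 h⟩
  -- A relabelling outside the range of `g` changes the mark of some past point, where the unit
  -- matrix contributes a factor zero.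
  · intro k hk
    refine ⟨fun p => k (ix p), funext fun l => ?_⟩
    by_cases h : r < (v l).1
    · simp only [g, dif_pos h]
      congr 1
      exact hv (hix ⟨v l, hP l h⟩)
    · simp only [g, dif_neg h]
      by_contra hne
      refine hk ?_
      have h0 : G.stepGram r (v l).1 (v l).2 (k l) = 0 := by
        simp [GelfandField.stepGram, h, Ne.symm hne]
      show _ * _ = _
      rw [Finset.prod_eq_zero (Finset.mem_univ l) h0, zero_mul]

theorem GelfandField.embed_const_mul (G : GelfandField J K) (r : ℝ) {I : Type*}
    (φ : Chain J × I → ℂ) (c : ℂ) (x : Chain J × I) :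
    G.embed r (fun y => c * φ y) x = c * G.embed r φ x := by
  unfold GelfandField.embed
  rw [← tsum_mul_left]
  exact tsum_congr fun k => mul_left_comm _ _ _

variable [Countable J] [MeasurableSingletonClass J]
  {I : Type*} [MeasurableSpace I] [Countable I] [MeasurableSingletonClass I]

theorem GelfandField.measurable_stepGram (G : GelfandField J K) (r : ℝ) (k : J) :
    Measurable fun p : ℝ × J => G.stepGram r p.1 p.2 k := by
  refine measurable_from_prod_countable_left fun j => ?_
  exact Measurable.ite measurableSet_Ioi (G.measurable_gram j k)
    (measurable_const (a := if k = j then (1 : ℂ) else 0))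

theorem GelfandField.measurable_embed (G : GelfandField J K) (r : ℝ) {Y : Type*}
    [MeasurableSpace Y] {F : Y → Chain J × I → ℂ} (hF : Measurable (Function.uncurry F)) :
    Measurable (Function.uncurry fun y => G.embed r (F y)) := by
  have h1 : Measurable (Function.uncurry fun (y : Y × I) τ => G.embed r (F y.1) (τ, y.2)) := by
    refine Chain.measurable_uncurry (fun n y v => ∑' k : Fin n → J,
      (∏ l, G.stepGram r (v l).1 (v l).2 (k l)) *
        F y.1 (Chain.ofTuple fun l => ((v l).1, k l), y.2)) (fun n => ?_)
      fun n y v hv => G.embed_ofTuple r hv _ _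
    refine Measurable.tsum fun k => Measurable.mul ?_ ?_
    · exact Finset.measurable_prod _ fun l _ => (G.measurable_stepGram r (k l)).comp
        (show Measurable fun x : (Y × I) × (Fin n → ℝ × J) => x.2 l by fun_prop)
    · refine hF.comp (Measurable.prodMk (by fun_prop) (Measurable.prodMk ?_ (by fun_prop)))
      exact (Chain.measurable_ofTuple n).comp (by fun_prop)
  exact h1.comp (show Measurable fun x : Y × Chain J × I => ((x.1, x.2.2), x.2.1) by fun_prop)

theorem GelfandField.measurable_embed_fun (G : GelfandField J K) (r : ℝ) {φ : Chain J × I → ℂ}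
    (hφ : Measurable φ) : Measurable (G.embed r φ) :=
  (G.measurable_embed r (F := fun _ : Unit => φ) (hφ.comp measurable_snd)).comp
    (measurable_const (a := ()).prodMk measurable_id)

/-- Counting measure charges every assignment of marks, so for almost all instants the property
holds for all marks at once. Since `embed` keeps the instants and mixes the marks, it respects
equality almost everywhere (`GelfandField.embed_congr`). -/
theorem ae_remark {B : Set ℝ} {n : ℕ} {P : (Fin n → ℝ × J) → Prop}
    (h : ∀ᵐ v ∂Measure.pi fun _ : Fin n => pointMeasure J B, P v) :
    ∀ᵐ v ∂Measure.pi fun _ : Fin n => pointMeasure J B, ∀ k : Fin n → J,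
      P fun l => ((v l).1, k l) := by
  have hp := measurePreserving_arrowProdEquivProdArrow ℝ J (Fin n)
    (fun _ => volume.restrict B) (fun _ => Measure.count)
  have h1 := Measure.ae_ae_of_ae_prod (hp.symm.quasiMeasurePreserving.ae h)
  have h2 : ∀ᵐ t ∂Measure.pi fun _ : Fin n => volume.restrict B, ∀ k : Fin n → J,
      P fun l => (t l, k l) := by
    filter_upwards [h1] with t ht k
    by_contra hk
    have h3 : (Measure.pi fun _ : Fin n => (Measure.count : Measure J)) {k} = 0 :=
      measure_mono_null (singleton_subset_iff.2 hk) (ae_iff.1 ht)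
    rw [Measure.pi_singleton] at h3
    simp at h3
  exact (Measure.quasiMeasurePreserving_fst.comp hp.quasiMeasurePreserving).ae h2

theorem ae_chainMeasure_iff {B : Set ℝ} {P : Chain J → Prop} (hP : MeasurableSet {τ | P τ}) :
    (∀ᵐ τ ∂chainMeasure J B, P τ) ↔
      ∀ n : ℕ, ∀ᵐ v ∂Measure.pi fun _ : Fin n => pointMeasure J B, P (Chain.ofTuple v) := by
  rw [chainMeasure, Measure.ae_sum_iff' hP]
  refine forall_congr' fun n => ?_
  rw [Measure.ae_ennreal_smul_measure_iff (by simp), ae_map_iff (Chain.measurable_ofTuple n).aemeasurable hP]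
  rfl

theorem GelfandField.embed_congr (G : GelfandField J K) (r : ℝ) {B : Set ℝ}
    {φ φ' : Chain J × I → ℂ} (hφ : Measurable φ) (hφ' : Measurable φ')
    (h : φ =ᵐ[fockMeasure J B I] φ') : G.embed r φ =ᵐ[fockMeasure J B I] G.embed r φ' := by
  refine ae_fockMeasure_iff.2 fun i => ?_
  have hm : ∀ {ψ : Chain J × I → ℂ}, Measurable ψ → Measurable fun τ => ψ (τ, i) := fun h =>
    h.comp (measurable_id.prodMk measurable_const)
  rw [ae_chainMeasure_iff (measurableSet_eq_fun (hm (G.measurable_embed_fun r hφ))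
    (hm (G.measurable_embed_fun r hφ')))]
  intro n
  have h1 := (ae_chainMeasure_iff (measurableSet_eq_fun (hm hφ) (hm hφ'))).1
    (ae_fockMeasure_iff.1 h i) n
  filter_upwards [ae_remark h1, ae_injective_tuple B n] with v hv hv'
  rw [G.embed_ofTuple r hv', G.embed_ofTuple r hv']
  exact tsum_congr fun k => by rw [hv k]

end Embed

/-! ### Operators over the past -/

section Graph

variable {J : Type*} [MeasurableSpace J] [Countable J] [MeasurableSingletonClass J] {B : Set ℝ}
  {I : Type*} [MeasurableSpace I] [Countable I] [MeasurableSingletonClass I]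
  {I' : Type*} [MeasurableSpace I'] [Countable I'] [MeasurableSingletonClass I']

theorem mem_minus_of_nat {f : FockFun J B I}
    (h : ∀ m : ℕ, scaleNorm J B I (1 - 1 / (m + 2)) f < ⊤) : f ∈ FockMinus J B I := by
  intro η hη
  obtain ⟨m, hm⟩ := exists_nat_ge (1 / (1 - η))
  refine (scaleNorm_mono_weight hη.1.le ?_ _).trans_lt (h m)
  have h1 : 0 < 1 - η := by linarith [hη.2]
  have h2 : 1 / ((m : ℝ) + 2) ≤ 1 - η := by
    rw [one_div_le (by positivity) h1]
    linarith
  linarith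

/-- The set of parameters for which a pair of functions belongs to the graph of a bounded operator
is measurable. -/
theorem measurableSet_graph_apply {X : FockOp J B I I'} {ζ ξ : ℝ} (hζ : 1 < ζ) (hξ : 0 < ξ) (hξ1 : ξ < 1)
    {c : ℝ≥0∞} (hc : c < ⊤)
    (hX : ∀ u, scaleNorm J B I' ξ (X u).1 ≤ c * scaleNorm J B I ζ u.1)
    {Ω : Type*} [MeasurableSpace Ω] {E : Ω → Chain J × I → ℂ} {g : Ω → Chain J × I' → ℂ}
    (hE : Measurable (Function.uncurry E)) (hg : Measurable (Function.uncurry g)) :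
    MeasurableSet {ω | ∃ u : FockPlus J B I, u.1 =ᵐ[fockMeasure J B I] E ω ∧
      (X u).1 =ᵐ[fockMeasure J B I'] g ω} := by
  -- Tested against a countable separating family, each functional `u ↦ ⟨χ | X u⟩` being given by a
  -- kernel, the relation `X u = g ω` becomes countably many scalar equations depending measurably
  -- on `ω`.
  obtain ⟨χ, hχ⟩ := exists_separating J B I'
  have hk : ∀ n, ∃ k : Chain J × I → ℂ, Measurable k ∧ scaleNorm J B I ζ⁻¹ k < ⊤ ∧
      ∀ u : FockPlus J B I, pairing (χ n) (X u) = ∫ x, k x * u.1 x ∂fockMeasure J B I := by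
    intro n
    have hχn := (χ n).2 ξ⁻¹ ((one_lt_inv₀ hξ).2 hξ1)
    refine exists_kernel (S := Ioi 1) hζ (by linarith) (pairingHom (χ n) ∘ₗ X)
      (scaleNorm J B I' ξ⁻¹ (χ n).1 * c).toReal fun u => ?_
    rw [← ENNReal.toReal_mul, ← toReal_enorm]
    refine ENNReal.toReal_mono (ENNReal.mul_lt_top (ENNReal.mul_lt_top hχn hc) (u.2 ζ hζ)).ne ?_
    refine (enorm_pairing_le hξ (χ n) (X u)).trans ?_
    rw [mul_assoc]
    exact mul_le_mul_right (hX u) _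
  choose k hkm _ hk using hk
  have hE' : ∀ ω, Measurable (E ω) := fun ω => hE.comp (measurable_const.prodMk measurable_id)
  have hg' : ∀ ω, Measurable (g ω) := fun ω => hg.comp (measurable_const.prodMk measurable_id)
  have heq : {ω | ∃ u : FockPlus J B I, u.1 =ᵐ[fockMeasure J B I] E ω ∧
      (X u).1 =ᵐ[fockMeasure J B I'] g ω} =
      (⋂ m : ℕ, {ω | scaleNorm J B I (m + 2) (E ω) < ⊤}) ∩
      ((⋂ m : ℕ, {ω | scaleNorm J B I' (1 - 1 / (m + 2)) (g ω) < ⊤}) ∩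
      ⋂ n, {ω | ∫ x, k n x * E ω x ∂fockMeasure J B I =
        ∫ x, starRingEnd ℂ ((χ n).1 x) * g ω x ∂fockMeasure J B I'}) := by
    ext ω
    simp only [mem_inter_iff, mem_iInter, Set.mem_ofPred]
    constructor
    · rintro ⟨u, hu, hXu⟩
      refine ⟨fun m => ?_, fun m => ?_, fun n => ?_⟩
      · rw [← scaleNorm_congr _ hu]
        exact u.2 _ (show (1 : ℝ) < _ by linarith [m.cast_nonneg (α := ℝ)])
      · rw [← scaleNorm_congr _ hXu]
        have hm : (0 : ℝ) ≤ m := m.cast_nonneg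
        refine (X u).2 _ ⟨?_, ?_⟩
        · have : 1 / ((m : ℝ) + 2) < 1 := by
            rw [div_lt_one (by linarith)]; linarith
          linarith
        · have : 0 < 1 / ((m : ℝ) + 2) := by positivity
          linarith
      · have h1 := hk n u
        refine Eq.trans (integral_congr_ae ?_) (h1.symm.trans (integral_congr_ae ?_))
        · filter_upwards [hu] with x hx
          rw [hx]
        · filter_upwards [hXu] with x hx
          rw [hx]
    · rintro ⟨h1, h2, h3⟩
      have hu : FockFun.mk (E ω) (hE' ω) ∈ FockPlus J B I := mem_plus_of_nat fun m => by
        rw [scaleNorm_congr _ (FockFun.coe_mk _ _)]; exact h1 m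
      have hv : FockFun.mk (g ω) (hg' ω) ∈ FockMinus J B I' := mem_minus_of_nat fun m => by
        rw [scaleNorm_congr _ (FockFun.coe_mk _ _)]; exact h2 m
      refine ⟨⟨_, hu⟩, FockFun.coe_mk _ (hE' ω), ?_⟩
      have h4 : X ⟨_, hu⟩ = ⟨_, hv⟩ := by
        refine hχ _ _ fun n => ?_
        rw [hk n]
        refine Eq.trans (integral_congr_ae ?_) ((h3 n).trans (integral_congr_ae ?_))
        · filter_upwards [FockFun.coe_mk (B := B) (E ω) (hE' ω)] with x hx
          rw [hx]
        · filter_upwards [FockFun.coe_mk (B := B) (g ω) (hg' ω)] with x hx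
          rw [hx]
      rw [h4]
      exact FockFun.coe_mk _ (hg' ω)
  rw [heq]
  refine (MeasurableSet.iInter fun m => ?_).inter ((MeasurableSet.iInter fun m => ?_).inter
    (MeasurableSet.iInter fun n => ?_))
  · exact measurableSet_lt (measurable_scaleNorm _ hE) measurable_const
  · exact measurableSet_lt (measurable_scaleNorm _ hg) measurable_const
  · refine measurableSet_eq_fun ?_ ?_
    · have h1 : Measurable fun y : Ω × Chain J × I => k n y.2 * E y.1 y.2 :=
        ((hkm n).comp measurable_snd).mul hE
      exact (StronglyMeasurable.integral_prod_right (f := fun ω x => k n x * E ω x)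
        h1.stronglyMeasurable).measurable
    · have h1 : Measurable fun y : Ω × Chain J × I' => starRingEnd ℂ ((χ n).1 y.2) * g y.1 y.2 :=
        ((Complex.continuous_conj.measurable.comp (χ n).1.measurable).comp measurable_snd).mul hg
      exact (StronglyMeasurable.integral_prod_right
        (f := fun ω x => starRingEnd ℂ ((χ n).1 x) * g ω x) h1.stronglyMeasurable).measurable

end Graph

section Past

variable {J : Type*} [MeasurableSpace J] [Countable J] [MeasurableSingletonClass J]
  {K : Type*} [NormedAddCommGroup K] [InnerProductSpace ℂ K] [CompleteSpace K]
  {G : GelfandField J K} {r : ℝ}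
  {I : Type*} [MeasurableSpace I] [Countable I] [MeasurableSingletonClass I]
  {I' : Type*} [MeasurableSpace I'] [Countable I'] [MeasurableSingletonClass I']

theorem GelfandField.embed_of_le (G : GelfandField J K) {I : Type*} (φ : Chain J × I → ℂ)
    {τ : Chain J} (hτ : ∀ p ∈ τ.points, p.1 ≤ r) (i : I) : G.embed r φ (τ, i) = φ (τ, i) := by
  have h : (τ.points.filter fun p => r < p.1) = ∅ :=
    Finset.filter_eq_empty_iff.2 fun {p} hp => not_lt.2 (hτ p hp)
  have h' : (τ.points.filter fun p => p.1 ≤ r) = τ.points := Finset.filter_true_of_mem hτ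
  have : IsEmpty {p // p ∈ τ.points.filter fun p => r < p.1} :=
    ⟨fun p => Finset.notMem_empty p.1 (h ▸ p.2)⟩
  unfold GelfandField.embed
  rw [tsum_eq_single default fun k hk => absurd (Subsingleton.elim _ _) hk]
  simp [h']

theorem lintegral_fockMeasure_join (hr : 0 ≤ r) {F : Chain J × I → ℝ≥0∞} (hF : Measurable F) :
    ∫⁻ x, F x ∂fockMeasure J (Ioi 0) I =
      ∫⁻ ρ, ∫⁻ x, F (x.1.union ρ, x.2) ∂fockMeasure J (Ioc 0 r) I ∂chainMeasure J (Ioi r) := by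
  rw [← (measurePreserving_joinChain hr).lintegral_comp hF,
    lintegral_prod (fun y => F (joinChain y)) (hF.comp measurable_joinChain).aemeasurable]
  rfl

theorem measurableSet_points_le (r : ℝ) : MeasurableSet {τ : Chain J | ∀ p ∈ τ.points, p.1 ≤ r} := by
  have h1 : Measurable fun τ : Chain J => ∑ p ∈ τ.points with r < p.1, 1 :=
    (Chain.measurable_sum_points (Y := Unit) (q := fun p : ℝ × J => r < p.1)
      (F := fun _ _ _ => (1 : ℕ)) (measurable_fst measurableSet_Ioi) measurable_const).comp
      (measurable_const (a := ()).prodMk measurable_id)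
  convert h1 (measurableSet_singleton 0) using 1
  ext τ
  simp [Finset.filter_eq_empty_iff]

/-- The empty chain is an atom, so an almost sure property may be evaluated at the empty future. -/
theorem of_ae_chainMeasure {B : Set ℝ} {P : Chain J → Prop} (h : ∀ᵐ ρ ∂chainMeasure J B, P ρ) :
    P ⟨∅⟩ := by
  by_contra hP
  have := measure_mono_null (singleton_subset_iff.2 hP) (ae_iff.1 h)
  rw [chainMeasure_singleton_empty] at this
  exact one_ne_zero this

/-- The function of the chains in `]0, ∞[` that vanishes unless there is no point after `r`. -/
def extendPast (r : ℝ) (u : Chain J × I → ℂ) (x : Chain J × I) : ℂ :=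
  if ∀ p ∈ x.1.points, p.1 ≤ r then u x else 0

theorem measurable_extendPast {u : Chain J × I → ℂ} (hu : Measurable u) :
    Measurable (extendPast r u) :=
  Measurable.ite (measurable_fst (measurableSet_points_le r)) hu measurable_const

theorem union_empty_chain (σ : Chain J) : σ.union ⟨∅⟩ = σ :=
  Chain.ext_points (Finset.union_empty _)

/-- The extension is the product of `u` with the vacuum of the future, and the empty future chain
has mass `1`. -/
theorem scaleNorm_extendPast_le (hr : 0 ≤ r) {ζ : ℝ} {u : Chain J × I → ℂ} (hu : Measurable u) :
    scaleNorm J (Ioi 0) I ζ (extendPast r u) ≤ scaleNorm J (Ioc 0 r) I ζ u := by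
  rw [← ENNReal.pow_le_pow_left_iff two_ne_zero, scaleNorm_sq, scaleNorm_sq,
    lintegral_fockMeasure_join hr (F := fun x => ENNReal.ofReal (ζ ^ x.1.card) *
      ‖extendPast r u x‖ₑ ^ 2) ((measurable_weight ζ).mul
      ((measurable_extendPast hu).enorm.pow_const 2))]
  calc _ ≤ ∫⁻ ρ, ({⟨∅⟩} : Set (Chain J)).indicator (fun _ => ∫⁻ x,
        ENNReal.ofReal (ζ ^ x.1.card) * ‖u x‖ₑ ^ 2 ∂fockMeasure J (Ioc 0 r) I) ρ
        ∂chainMeasure J (Ioi r) := by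
        refine lintegral_mono_ae ?_
        filter_upwards [ae_points_mem (J := J) (measurableSet_Ioi (a := r))] with ρ hρ
        by_cases h : ρ = ⟨∅⟩
        · subst h
          rw [indicator_of_mem (mem_singleton _)]
          refine lintegral_mono fun x => ?_
          simp only [union_empty_chain]
          unfold extendPast
          split_ifs
          · exact le_rfl
          · simp
        · rw [indicator_of_notMem (by simpa using h)]
          have hne : ρ.points.Nonempty := by
            rw [Finset.nonempty_iff_ne_empty]
            exact fun h' => h (Chain.ext_points h')
          obtain ⟨p, hp⟩ := hne
          refine le_of_eq (lintegral_eq_zero_of_ae_eq_zero (Eventually.of_forall fun x => ?_))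
          have : extendPast r u (x.1.union ρ, x.2) = 0 :=
            if_neg fun h => absurd (hρ p hp) (not_lt.2 (h p (Finset.mem_union_right _ hp)))
          simp [this]
    _ = _ := by
        rw [lintegral_indicator_const measurableSet_singleton_empty, chainMeasure_singleton_empty,
          mul_one]

/-- The left side is the contribution of the empty future chain to the right side. -/
theorem scaleNorm_restrict_le (hr : 0 ≤ r) {ξ : ℝ} {f : Chain J × I → ℂ} (hf : Measurable f) :
    scaleNorm J (Ioc 0 r) I ξ f ≤ scaleNorm J (Ioi 0) I ξ f := by
  rw [← ENNReal.pow_le_pow_left_iff two_ne_zero, scaleNorm_sq, scaleNorm_sq,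
    lintegral_fockMeasure_join hr (F := fun x => ENNReal.ofReal (ξ ^ x.1.card) * ‖f x‖ₑ ^ 2)
      ((measurable_weight ξ).mul (hf.enorm.pow_const 2))]
  calc _ = ∫⁻ ρ, ({⟨∅⟩} : Set (Chain J)).indicator (fun _ => ∫⁻ x,
        ENNReal.ofReal (ξ ^ x.1.card) * ‖f x‖ₑ ^ 2 ∂fockMeasure J (Ioc 0 r) I) ρ
        ∂chainMeasure J (Ioi r) := by
        rw [lintegral_indicator_const measurableSet_singleton_empty, chainMeasure_singleton_empty,
          mul_one]
    _ ≤ _ := by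
        refine lintegral_mono fun ρ => ?_
        by_cases h : ρ = ⟨∅⟩
        · subst h
          rw [indicator_of_mem (mem_singleton _)]
          simp only [union_empty_chain, le_refl]
        · rw [indicator_of_notMem (by simpa using h)]
          exact bot_le

/-- The bounds of `X ⊗ I` are bounds of `X`. -/
theorem IsAmpliation.past_bound (hr : 0 ≤ r) {X : FockOp J (Ioc 0 r) I I'}
    {C : FockOp J (Ioi 0) I I'} (h : IsAmpliation G r X C) {ζ ξ : ℝ} (hζ : 1 < ζ)
    (u : FockPlus J (Ioc 0 r) I) :
    scaleNorm J (Ioc 0 r) I' ξ (X u).1 ≤ opNorm ζ ξ C * scaleNorm J (Ioc 0 r) I ζ u.1 := by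
  have hm := measurable_extendPast (r := r) u.1.measurable
  have hφ : FockFun.mk _ hm ∈ FockPlus J (Ioi 0) I := fun η hη => by
    rw [scaleNorm_congr η (FockFun.coe_mk _ hm)]
    exact (scaleNorm_extendPast_le hr u.1.measurable).trans_lt (u.2 η hη)
  -- `C` is applied to `u` times the future vacuum and read off over the empty future, where `embed`
  -- has no factor to act on and the image is `X u`.
  obtain ⟨u', hu', hXu'⟩ := of_ae_chainMeasure (h ⟨_, hφ⟩)
  have hpast : ∀ᵐ x ∂fockMeasure J (Ioc 0 r) I, ∀ p ∈ x.1.points, p.1 ≤ r :=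
    ae_fockMeasure_iff.2 fun i => by
      filter_upwards [ae_points_mem (J := J) (measurableSet_Ioc (a := 0) (b := r))] with τ hτ p hp
      exact (hτ p hp).2
  have hmk := of_ae_chainMeasure (ae_join hr (FockFun.coe_mk _ hm))
  have huu : u' = u := by
    refine Subtype.ext (FockFun.ext_ae ?_)
    filter_upwards [hu', hpast, hmk] with x h1 h2 h3
    rw [h1]
    simp only [union_empty_chain] at h3 ⊢
    rw [G.embed_of_le _ h2, h3]
    exact if_pos h2
  subst huu
  simp only [union_empty_chain] at hXu'
  rw [scaleNorm_congr ξ hXu']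
  refine (scaleNorm_restrict_le hr (C ⟨_, hφ⟩).1.measurable).trans
    ((scaleNorm_le_opNorm hζ C ⟨_, hφ⟩).trans ?_)
  refine mul_le_mul_right ?_ _
  exact (scaleNorm_congr ζ (FockFun.coe_mk _ hm)).le.trans
    (scaleNorm_extendPast_le hr u'.1.measurable)

end Past

/-! ### Tensor products with the identity of the future -/

section Tensor

variable {J : Type*} [MeasurableSpace J] [Countable J] [MeasurableSingletonClass J]
  {K : Type*} [NormedAddCommGroup K] [InnerProductSpace ℂ K] [CompleteSpace K]
  {G : GelfandField J K} {r : ℝ}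
  {I : Type*} [MeasurableSpace I] [Countable I] [MeasurableSingletonClass I]
  {I' : Type*} [MeasurableSpace I'] [Countable I'] [MeasurableSingletonClass I']
  {X : FockOp J (Ioc 0 r) I I'} {C : FockOp J (Ioi 0) I I'}

theorem IsTensor.congr (hr : 0 ≤ r) {Φ Φ' : Chain J × I → ℂ} {Ψ : FockFun J (Ioi 0) I'}
    (h : IsTensor r X Φ Ψ) (hΦ : Φ =ᵐ[fockMeasure J (Ioi 0) I] Φ') : IsTensor r X Φ' Ψ := by
  filter_upwards [h, ae_join hr hΦ] with ρ ⟨u, h1, h2⟩ h3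
  exact ⟨u, h1.trans h3, h2⟩

theorem IsTensor.unique (hr : 0 ≤ r) {Φ : Chain J × I → ℂ} {Ψ Ψ' : FockFun J (Ioi 0) I'}
    (h : IsTensor r X Φ Ψ) (h' : IsTensor r X Φ Ψ') : Ψ = Ψ' := by
  refine FockFun.ext_ae (ae_of_ae_join hr (measurableSet_eq_fun Ψ.measurable Ψ'.measurable) ?_)
  filter_upwards [h, h'] with ρ ⟨u, h1, h2⟩ ⟨u', h1', h2'⟩
  have : u = u' := Subtype.ext (FockFun.ext_ae (h1.trans h1'.symm))
  subst this
  exact h2.symm.trans h2'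

/-- The selected points lie after `r` and the points of `σ` do not, so summation and removal concern
`ρ` alone. This expresses that Itô increments act in the future factor. -/
theorem sum_union_future {M : Type*} [AddCommMonoid M] {σ ρ : Chain J} (hσ : ∀ p ∈ σ.points, p.1 ≤ r)
    {q : ℝ × J → Prop} [DecidablePred q] (hq : ∀ p, q p → r < p.1) (F : ℝ × J → Chain J → M) :
    ∑ p ∈ (σ.union ρ).points with q p, F p ((σ.union ρ).erase p) =
      ∑ p ∈ ρ.points with q p, F p (σ.union (ρ.erase p)) := by
  have hnot : ∀ p ∈ σ.points, ¬ q p := fun p hp h => absurd (hσ p hp) (not_le.2 (hq p h))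
  have h1 : ((σ.union ρ).points.filter q) = ρ.points.filter q := by
    show (σ.points ∪ ρ.points).filter q = _
    rw [Finset.filter_union, Finset.filter_eq_empty_iff.2 fun {p} hp => hnot p hp,
      Finset.empty_union]
  rw [h1]
  refine Finset.sum_congr rfl fun p hp => ?_
  congr 1
  refine Chain.ext_points ?_
  show (σ.points ∪ ρ.points).erase p = σ.points ∪ ρ.points.erase p
  rw [Finset.erase_union_distrib, Finset.erase_eq_of_notMem fun h =>
    hnot p h (Finset.mem_filter.1 hp).2]

theorem ae_fockMeasure_fst {B : Set ℝ} {P : Chain J → Prop} (h : ∀ᵐ τ ∂chainMeasure J B, P τ) :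
    ∀ᵐ x ∂fockMeasure J B I, P x.1 :=
  ae_fockMeasure_iff.2 fun _ => h

theorem ae_points_le (r : ℝ) :
    ∀ᵐ x ∂fockMeasure J (Ioc 0 r) I, ∀ p ∈ x.1.points, p.1 ≤ r := by
  refine ae_fockMeasure_fst (P := fun τ => ∀ p ∈ τ.points, p.1 ≤ r) ?_
  filter_upwards [ae_points_mem (J := J) (measurableSet_Ioc (a := 0) (b := r))] with τ hτ p hp
  exact (hτ p hp).2

theorem measurable_unionRight {F : ℝ → Chain J × I → ℂ} (hF : Measurable (Function.uncurry F)) :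
    Measurable (Function.uncurry fun (y : ℝ × Chain J) (x : Chain J × I) =>
      F y.1 (x.1.union y.2, x.2)) := by
  have h1 : Measurable fun y : (ℝ × Chain J) × Chain J × I => y.2.1.union y.1.2 :=
    Chain.measurable_union.comp
      (show Measurable fun y : (ℝ × Chain J) × Chain J × I => (y.2.1, y.1.2) by fun_prop)
  have h2 : Measurable fun y : (ℝ × Chain J) × Chain J × I =>
      (y.1.1, (y.2.1.union y.1.2, y.2.2)) :=
    (measurable_fst.comp measurable_fst).prodMk (h1.prodMk (measurable_snd.comp measurable_snd))
  exact hF.comp h2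

/-- Over a future chain `ρ` the sum has one term for each selected point `p` of `ρ`, and this term
is the fibre over `ρ \ p` of `X ⊗ I` applied at the instant of `p`. Linearity of `X` finishes the
proof, provided that the fibre relation holds at all selected points of almost every `ρ`. -/
theorem isTensor_sum (hr : 0 ≤ r) (h : IsAmpliation G r X C) (hC : IsContinuousOp C) {a b : ℝ}
    (hab : ∀ s, a < s → s ≤ b → r < s) {e : ℝ → Chain J × I → ℂ} {g : ℝ → Chain J × I' → ℂ}
    (he : Measurable (Function.uncurry e)) (hg : Measurable (Function.uncurry g))
    (hv : ∀ᵐ s ∂volume.restrict (Ioc a b), ∃ v : FockPlus J (Ioi 0) I,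
      v.1 =ᵐ[fockMeasure J (Ioi 0) I] e s ∧ g s =ᵐ[fockMeasure J (Ioi 0) I'] (C v).1) (j : J)
    {Ψ : FockFun J (Ioi 0) I'} (hΨ : Ψ =ᵐ[fockMeasure J (Ioi 0) I'] fun x =>
      ∑ p ∈ x.1.points with (a < p.1 ∧ p.1 ≤ b) ∧ p.2 = j, g p.1 (x.1.erase p, x.2)) :
    IsTensor r X (fun x => ∑ p ∈ x.1.points with (a < p.1 ∧ p.1 ≤ b) ∧ p.2 = j,
      G.embed r (e p.1) (x.1.erase p, x.2)) Ψ := by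
  obtain ⟨Good, hGood⟩ : ∃ Good : ℝ → Chain J → Prop, ∀ s ρ, Good s ρ ↔
      ∃ u : FockPlus J (Ioc 0 r) I,
        u.1 =ᵐ[fockMeasure J (Ioc 0 r) I] (fun x => G.embed r (e s) (x.1.union ρ, x.2)) ∧
        (X u).1 =ᵐ[fockMeasure J (Ioc 0 r) I'] (fun x => g s (x.1.union ρ, x.2)) :=
    ⟨_, fun _ _ => Iff.rfl⟩
  have he' : ∀ s, Measurable (e s) := fun s => he.comp (measurable_const.prodMk measurable_id)
  -- Needed to pass from almost every `s` and almost every `ρ` to the pairs `(p, ρ \ p)`; the bound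
  -- required for `X` is inherited from its ampliation.
  have hmG : MeasurableSet {y : ℝ × Chain J | Good y.1 y.2} := by
    simp only [hGood]
    obtain ⟨ζ, hζ, hfin⟩ := hC (1 / 2) half_mem
    have hE := measurable_unionRight (G.measurable_embed r he)
    have hg' := measurable_unionRight hg
    have hX : ∀ u, scaleNorm J (Ioc 0 r) I' (1 / 2) (X u).1 ≤
        opNorm ζ (1 / 2) C * scaleNorm J (Ioc 0 r) I ζ u.1 := fun u => h.past_bound hr hζ u
    exact measurableSet_graph_apply (Ω := ℝ × Chain J) hζ half_mem.1 half_mem.2 hfin hX hE hg'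
  have h1 : ∀ᵐ s ∂volume.restrict (Ioc a b), ∀ᵐ ρ ∂chainMeasure J (Ioi r), Good s ρ := by
    filter_upwards [hv] with s ⟨v, hv1, hv2⟩
    filter_upwards [(h v).congr hr (G.embed_congr r v.1.measurable (he' s) hv1), ae_join hr hv2]
      with ρ ⟨u, h1, h2⟩ h3
    refine (hGood _ _).2 ⟨u, h1, h2.trans ?_⟩
    filter_upwards [h3] with x hx using hx.symm
  have h2 : ∀ᵐ ρ ∂chainMeasure J (Ioi r), ∀ p ∈ ρ.points, p.1 ∈ Ioc a b → Good p.1 (ρ.erase p) := by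
    refine ae_points_of_ae_ae (A := Ioc a b) measurableSet_Ioc (P := fun s x => Good s x.1) ?_ ?_
    · have hm : Measurable fun y : ℝ × Chain J × J => (y.1, y.2.1) := by fun_prop
      exact hm hmG
    · filter_upwards [ae_restrict_of_ae_restrict_of_subset inter_subset_left h1] with s hs
      exact ae_fockMeasure_fst hs
  have hq : ∀ p : ℝ × J, ((a < p.1 ∧ p.1 ≤ b) ∧ p.2 = j) → r < p.1 := fun p hp =>
    hab _ hp.1.1 hp.1.2
  filter_upwards [h2, ae_join hr hΨ] with ρ hρ hΨρ
  let u : ℝ × J → FockPlus J (Ioc 0 r) I := fun p =>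
    if hp : Good p.1 (ρ.erase p) then ((hGood _ _).1 hp).choose else 0
  have hu : ∀ p ∈ ρ.points.filter fun p => (a < p.1 ∧ p.1 ≤ b) ∧ p.2 = j,
      (u p).1 =ᵐ[fockMeasure J (Ioc 0 r) I]
        (fun x => G.embed r (e p.1) (x.1.union (ρ.erase p), x.2)) ∧
      (X (u p)).1 =ᵐ[fockMeasure J (Ioc 0 r) I'] (fun x => g p.1 (x.1.union (ρ.erase p), x.2)) := by
    intro p hp
    obtain ⟨hp1, hp2, -⟩ := Finset.mem_filter.1 hp
    have hgood := hρ p hp1 hp2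
    simp only [u, dif_pos hgood]
    exact ((hGood _ _).1 hgood).choose_spec
  refine ⟨∑ p ∈ ρ.points with (a < p.1 ∧ p.1 ≤ b) ∧ p.2 = j, u p, ?_, ?_⟩
  · rw [Submodule.coe_sum]
    refine (FockFun.coe_sum _ _).trans ?_
    filter_upwards [ae_points_le r, (Filter.eventually_all_finset _).2 fun p hp => (hu p hp).1] with x hx hx'
    exact (Finset.sum_congr rfl hx').trans
      (sum_union_future hx hq fun p τ => G.embed r (e p.1) (τ, x.2)).symm
  · rw [map_sum, Submodule.coe_sum]
    refine (FockFun.coe_sum _ _).trans ?_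
    filter_upwards [ae_points_le r, hΨρ, (Filter.eventually_all_finset _).2 fun p hp => (hu p hp).2]
      with x hx h3 hx'
    exact (Finset.sum_congr rfl hx').trans
      ((sum_union_future hx hq fun p τ => g p.1 (τ, x.2)).symm.trans h3.symm)

end Tensor

/-! ### Operators and integrals -/

section ApplyIntegral

variable {J : Type*} [MeasurableSpace J] [Countable J] [MeasurableSingletonClass J] {B : Set ℝ}
  {I : Type*} [MeasurableSpace I] [Countable I] [MeasurableSingletonClass I]
  {I' : Type*} [MeasurableSpace I'] [Countable I'] [MeasurableSingletonClass I']

theorem measurable_integral {Ω : Type*} [MeasurableSpace Ω] (ν : Measure Ω) [SFinite ν]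
    {F : Ω → Chain J × I → ℂ} (hF : Measurable (Function.uncurry F)) :
    Measurable fun x => ∫ s, F s x ∂ν :=
  (StronglyMeasurable.integral_prod_left (f := F) hF.stronglyMeasurable).measurable

theorem integral_mul_integral_swap {Ω : Type*} [MeasurableSpace Ω] (ν : Measure Ω) [SFinite ν]
    {η : ℝ} (hη : 0 < η) {k : Chain J × I → ℂ} (hk : Measurable k)
    (hk' : scaleNorm J B I η⁻¹ k < ⊤) {F : Ω → Chain J × I → ℂ}
    (hF : Measurable (Function.uncurry F)) (hF' : ∫⁻ s, scaleNorm J B I η (F s) ∂ν < ⊤) :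
    ∫ x, k x * ∫ s, F s x ∂ν ∂fockMeasure J B I =
      ∫ s, ∫ x, k x * F s x ∂fockMeasure J B I ∂ν := by
  simp_rw [← integral_const_mul]
  have hm : Measurable fun y : (Chain J × I) × Ω => k y.1 * F y.2 y.1 :=
    (hk.comp measurable_fst).mul (hF.comp measurable_swap)
  refine integral_integral_swap (f := fun x s => k x * F s x) ⟨hm.aestronglyMeasurable, ?_⟩
  unfold HasFiniteIntegral
  rw [lintegral_prod_symm (fun y => ‖Function.uncurry (fun x s => k x * F s x) y‖ₑ)
    hm.enorm.aemeasurable]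
  have h1 : ∀ s, ∫⁻ x, ‖Function.uncurry (fun x s => k x * F s x) (x, s)‖ₑ ∂fockMeasure J B I ≤
      scaleNorm J B I η⁻¹ k * scaleNorm J B I η (F s) := by
    intro s
    refine le_trans (le_of_eq (lintegral_congr fun x => enorm_mul _ _))
      (lintegral_mul_le_scaleNorm hη hk (hF.comp (measurable_const.prodMk measurable_id)))
  refine (lintegral_mono h1).trans_lt ?_
  rw [lintegral_const_mul _ (measurable_scaleNorm _ hF)]
  exact ENNReal.mul_lt_top hk' hF'

/-- A continuous operator may be taken under the integral. -/
theorem IsContinuousOp.apply_integral {C : FockOp J B I I'} (hC : IsContinuousOp C)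
    {Ω : Type*} [MeasurableSpace Ω] (ν : Measure Ω) [SFinite ν]
    {e : Ω → Chain J × I → ℂ} {f : Ω → Chain J × I' → ℂ}
    (he : Measurable (Function.uncurry e)) (hf : Measurable (Function.uncurry f))
    (hv : ∀ᵐ s ∂ν, ∃ v : FockPlus J B I, v.1 =ᵐ[fockMeasure J B I] e s ∧
      f s =ᵐ[fockMeasure J B I'] (C v).1)
    (hint : ∀ ζ > 1, ∫⁻ s, scaleNorm J B I ζ (e s) ∂ν < ⊤) :
    ∃ Φ : FockPlus J B I, Φ.1 =ᵐ[fockMeasure J B I] (fun x => ∫ s, e s x ∂ν) ∧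
      (C Φ).1 =ᵐ[fockMeasure J B I'] fun x => ∫ s, f s x ∂ν := by
  -- Continuity of `C` carries the integrability of the norms of `e` over to `f`, so both integrals
  -- define elements of the respective scales.
  have hfint : ∀ ξ ∈ Ioo (0 : ℝ) 1, ∫⁻ s, scaleNorm J B I' ξ (f s) ∂ν < ⊤ := by
    intro ξ hξ
    obtain ⟨ζ, hζ, hfin⟩ := hC ξ hξ
    have h1 : ∫⁻ s, scaleNorm J B I' ξ (f s) ∂ν ≤
        ∫⁻ s, opNorm ζ ξ C * scaleNorm J B I ζ (e s) ∂ν := by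
      refine lintegral_mono_ae ?_
      filter_upwards [hv] with s ⟨v, h1, h2⟩
      rw [scaleNorm_congr ξ h2, ← scaleNorm_congr ζ h1]
      exact scaleNorm_le_opNorm hζ C v
    refine h1.trans_lt ?_
    rw [lintegral_const_mul _ (measurable_scaleNorm _ he)]
    exact ENNReal.mul_lt_top hfin (hint ζ hζ)
  have hme := measurable_integral ν he
  have hmf := measurable_integral ν hf
  have hΦ : FockFun.mk _ hme ∈ FockPlus J B I := fun η hη => by
    rw [scaleNorm_congr η (FockFun.coe_mk _ hme)]
    exact (scaleNorm_integral_le ν η he).trans_lt (hint η hη)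
  have hV : FockFun.mk _ hmf ∈ FockMinus J B I' := fun η hη => by
    rw [scaleNorm_congr η (FockFun.coe_mk _ hmf)]
    exact (scaleNorm_integral_le ν η hf).trans_lt (hfint η hη)
  refine ⟨⟨_, hΦ⟩, FockFun.coe_mk _ hme, ?_⟩
  suffices h : C ⟨_, hΦ⟩ = ⟨_, hV⟩ by
    rw [h]; exact FockFun.coe_mk _ hmf
  -- Equality in `𝒢₋` is tested against a separating family; since `u ↦ ⟨χ | C u⟩` has a kernel,
  -- both sides are reduced to Fubini's theorem.
  obtain ⟨χ, hχ⟩ := exists_separating J B I'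
  refine hχ _ _ fun n => ?_
  obtain ⟨ζ, hζ, hfin⟩ := hC (1 / 2) half_mem
  have hχn := (χ n).2 (1 / 2 : ℝ)⁻¹ (show (1 : ℝ) < _ by norm_num)
  obtain ⟨k, hkm, hk', hk⟩ := exists_kernel (S := Ioi 1) hζ (by linarith) (pairingHom (χ n) ∘ₗ C)
    (scaleNorm J B I' (1 / 2 : ℝ)⁻¹ (χ n).1 * opNorm ζ (1 / 2) C).toReal fun u => by
      rw [← ENNReal.toReal_mul, ← toReal_enorm]
      refine ENNReal.toReal_mono (ENNReal.mul_lt_top (ENNReal.mul_lt_top hχn hfin)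
        (u.2 ζ hζ)).ne ?_
      refine (enorm_pairing_le (η := 1 / 2) (by norm_num) (χ n) (C u)).trans ?_
      rw [mul_assoc]
      exact mul_le_mul_right (scaleNorm_le_opNorm hζ C u) _
  have hk : ∀ u, pairing (χ n) (C u) = ∫ x, k x * u.1 x ∂fockMeasure J B I := hk
  have hχm : Measurable fun x => starRingEnd ℂ ((χ n).1 x) :=
    Complex.continuous_conj.measurable.comp (χ n).1.measurable
  calc pairing (χ n) (C ⟨_, hΦ⟩) = ∫ x, k x * ∫ s, e s x ∂ν ∂fockMeasure J B I := by
        rw [hk]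
        refine integral_congr_ae ?_
        filter_upwards [FockFun.coe_mk (B := B) _ hme] with x hx
        rw [hx]
    _ = ∫ s, ∫ x, k x * e s x ∂fockMeasure J B I ∂ν :=
        integral_mul_integral_swap ν (by linarith) hkm hk' he (hint ζ hζ)
    _ = ∫ s, ∫ x, starRingEnd ℂ ((χ n).1 x) * f s x ∂fockMeasure J B I' ∂ν := by
        refine integral_congr_ae ?_
        filter_upwards [hv] with s ⟨v, h1, h2⟩
        refine Eq.trans (integral_congr_ae ?_) ((hk v).symm.trans (integral_congr_ae ?_))
        · filter_upwards [h1] with x hx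
          rw [hx]
        · filter_upwards [h2] with x hx
          rw [hx]
    _ = ∫ x, starRingEnd ℂ ((χ n).1 x) * ∫ s, f s x ∂ν ∂fockMeasure J B I' := by
        refine (integral_mul_integral_swap ν (η := 1 / 2) (by norm_num) hχm ?_ hf
          (hfint _ half_mem)).symm
        rw [scaleNorm_conj]
        exact hχn
    _ = pairing (χ n) ⟨_, hV⟩ := by
        refine integral_congr_ae ?_
        filter_upwards [FockFun.coe_mk (B := B) _ hmf] with x hx
        rw [hx]

theorem lintegral_slice_lt_top {a b : ℝ} (ha : 0 ≤ a) {ζ : ℝ} (hζ : 1 < ζ)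
    (φ : FockPlus J (Ioi 0) Unit) :
    ∫⁻ s in Ioc a b, scaleNorm J (Ioi 0) J ζ (sliceFun φ.1 s) < ⊤ := by
  have h1 := lintegral_mul_le_sqrt (volume.restrict (Ioc a b)) (f := fun _ => 1)
    (g := fun s => scaleNorm J (Ioi 0) J ζ (sliceFun φ.1 s)) measurable_const
    (measurable_scaleNorm _ (measurable_sliceFun φ.1.measurable))
  simp only [one_mul] at h1
  refine h1.trans_lt (ENNReal.mul_lt_top ?_ ?_)
  · refine ENNReal.rpow_lt_top_of_nonneg (by norm_num) ?_
    simp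
  · refine (ENNReal.rpow_le_rpow (lintegral_mono_set (Ioc_subset_Ioc_left ha))
      (by norm_num)).trans_lt ?_
    refine (lintegral_slice_sq_le hζ one_pos b φ).trans_lt (ENNReal.mul_lt_top
      (ENNReal.rpow_lt_top_of_nonneg (by norm_num) ENNReal.ofReal_ne_top)
      (φ.2 _ (show (1 : ℝ) < _ by linarith)))

end ApplyIntegral

/-! ### Itô sums -/

section Ito

variable {J : Type*}

theorem sum_points_sub {M : Type*} [AddCommGroup M] {a b : ℝ} (hab : a ≤ b) (s : Finset (ℝ × J))
    (q : ℝ × J → Prop) [DecidablePred q] (F : ℝ × J → M) :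
    (∑ p ∈ s with p.1 ≤ b ∧ q p, F p) - ∑ p ∈ s with p.1 ≤ a ∧ q p, F p =
      ∑ p ∈ s with (a < p.1 ∧ p.1 ≤ b) ∧ q p, F p := by
  rw [sub_eq_iff_eq_add, Finset.sum_filter, Finset.sum_filter, Finset.sum_filter,
    ← Finset.sum_add_distrib]
  refine Finset.sum_congr rfl fun p _ => ?_
  by_cases hq : q p
  · by_cases ha : p.1 ≤ a
    · simp [hq, ha, ha.trans hab, not_lt.2 ha]
    · simp [hq, ha, not_le.1 ha]
  · simp [hq]

theorem sum_points_sub' {M : Type*} [AddCommGroup M] {a b : ℝ} (hab : a ≤ b) (s : Finset (ℝ × J))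
    (F : ℝ × J → M) :
    (∑ p ∈ s with p.1 ≤ b, F p) - ∑ p ∈ s with p.1 ≤ a, F p =
      ∑ p ∈ s with a < p.1 ∧ p.1 ≤ b, F p := by
  simpa using sum_points_sub hab s (fun _ => True) F

/-- Every point carries exactly one mark, so the sum over marks has finitely many nonzero terms and
restores the sum over all points. -/
theorem tsum_sum_marks (s : Finset (ℝ × J)) (q : ℝ × J → Prop) [DecidablePred q] (F : ℝ × J → J → ℂ) :
    ∑' j, ∑ p ∈ s with q p ∧ p.2 = j, F p j = ∑ p ∈ s with q p, F p p.2 := by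
  have h1 : ∀ j, ∑ p ∈ s with q p ∧ p.2 = j, F p j =
      ∑ p ∈ s with q p, if j = p.2 then F p p.2 else 0 := by
    intro j
    rw [← Finset.filter_filter, Finset.sum_filter (p := fun p : ℝ × J => p.2 = j)]
    refine Finset.sum_congr rfl fun p _ => ?_
    by_cases h : p.2 = j
    · subst h; simp
    · simp [h, Ne.symm h]
  simp_rw [h1]
  rw [Summable.tsum_finsetSum fun p _ => summable_of_ne_finset_zero (s := {p.2}) fun j hj =>
    if_neg (by simpa using hj)]
  simp

theorem integralFun_sub {a b : ℝ} (ha : 0 ≤ a) (hab : a ≤ b) (f : ℝ → Chain J × Unit → ℂ)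
    (g : ℝ → Chain J × J → ℂ) {x : Chain J × Unit}
    (hint : IntegrableOn (fun s => f s x) (Ioc 0 b)) :
    integralFun b f g x - integralFun a f g x = (∫ s in Ioc a b, f s x) +
      ∑ p ∈ x.1.points with a < p.1 ∧ p.1 ≤ b, g p.1 (x.1.erase p, p.2) := by
  unfold integralFun
  rw [add_sub_add_comm, sum_points_sub' hab]
  congr 1
  rw [← Ioc_union_Ioc_eq_Ioc ha hab, setIntegral_union
    (Set.disjoint_left.2 fun x hx hx' => absurd hx.2 (not_le.2 hx'.1)) measurableSet_Ioc
    (hint.mono_set (Ioc_subset_Ioc_right hab)) (hint.mono_set (Ioc_subset_Ioc_left ha)),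
    add_sub_cancel_left]

variable [MeasurableSpace J] [Countable J] [MeasurableSingletonClass J]
  {K : Type*} [NormedAddCommGroup K] [InnerProductSpace ℂ K] [CompleteSpace K]
  {G : GelfandField J K}

theorem measurable_sum_mark {a b : ℝ} (j : J) {I : Type*} [MeasurableSpace I]
    {g : ℝ → Chain J × I → ℂ} (hg : Measurable (Function.uncurry g)) :
    Measurable fun x : Chain J × I =>
      ∑ p ∈ x.1.points with (a < p.1 ∧ p.1 ≤ b) ∧ p.2 = j, g p.1 (x.1.erase p, x.2) := by
  have hq : MeasurableSet {p : ℝ × J | (a < p.1 ∧ p.1 ≤ b) ∧ p.2 = j} :=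
    (measurable_fst measurableSet_Ioc).inter (measurable_snd (measurableSet_singleton j))
  have h := (Chain.measurable_sum_points (Y := I) (F := fun i p τ => g p.1 (τ, i)) hq
    (hg.comp (show Measurable fun y : I × (ℝ × J) × Chain J =>
      (y.2.1.1, (y.2.2, y.1)) by fun_prop))).comp measurable_swap
  refine (congrArg Measurable (funext fun x => ?_)).mp h
  refine Finset.sum_congr (Finset.ext fun p => ?_) fun _ _ => rfl
  simp only [Finset.mem_filter, Prod.snd_swap]

theorem measurable_annihilationProc (t : ℝ) {φ : Chain J × Unit → ℂ} (hφ : Measurable φ) :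
    Measurable (annihilationProc t φ) :=
  measurable_integral (volume.restrict (Ioc 0 t)) (measurable_sliceFun hφ)

theorem ae_annihilationProc_sub {a b : ℝ} (ha : 0 ≤ a) (hab : a ≤ b)
    (φ : FockPlus J (Ioi 0) Unit) :
    (fun x => ∫ s in Ioc a b, sliceFun φ.1 s x) =ᵐ[fockMeasure J (Ioi 0) J]
      fun x => annihilationProc b φ.1 x - annihilationProc a φ.1 x := by
  filter_upwards [ae_integrable_of_scaleNorm (volume.restrict (Ioc 0 b)) (by norm_num)
    (measurable_sliceFun φ.1.measurable) (lintegral_slice_lt_top le_rfl one_lt_two φ)] with x hx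
  have hx' : IntegrableOn (fun s => sliceFun φ.1 s x) (Ioc 0 b) := hx
  unfold annihilationProc
  rw [← Ioc_union_Ioc_eq_Ioc ha hab]
  refine ((congrArg (· - _) (setIntegral_union
    (Set.disjoint_left.2 fun x hx hx' => absurd hx.2 (not_le.2 hx'.1)) measurableSet_Ioc
    (hx'.mono_set (Ioc_subset_Ioc_right hab)) (hx'.mono_set (Ioc_subset_Ioc_left ha)))).trans
    ?_).symm
  exact add_sub_cancel_left _ _

variable {φ : FockPlus J (Ioi 0) Unit} {f₀ f₁ : ℝ → Chain J × Unit → ℂ}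
  {g₀ g₁ : ℝ → Chain J × J → ℂ}

/-- The integral of the ampliation of a constant is a term of an Itô sum. -/
theorem isItoTerm_of_parts {r a b : ℝ} (hr : 0 ≤ r) (ha : 0 ≤ a) (hab : a ≤ b)
    (hrab : ∀ s, a < s → s ≤ b → r < s) {P : QSMatrix J (Ioc 0 r)} {V : QSMatrix J (Ioi 0)}
    (hV : V.IsContinuous) (hA : V.IsAmpliationOf G r P)
    (hf₀ : Measurable (Function.uncurry f₀)) (hf₁ : Measurable (Function.uncurry f₁))
    (hg₀ : Measurable (Function.uncurry g₀)) (hg₁ : Measurable (Function.uncurry g₁))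
    (hae : ∀ᵐ s ∂volume.restrict (Ioc a b), ∃ φs, IsSlice φ s φs ∧
      f₀ s =ᵐ[fockMeasure J (Ioi 0) Unit] (V.drift φ).1 ∧
      f₁ s =ᵐ[fockMeasure J (Ioi 0) Unit] (V.annihilation φs).1 ∧
      g₀ s =ᵐ[fockMeasure J (Ioi 0) J] (V.creation φ).1 ∧
      g₁ s =ᵐ[fockMeasure J (Ioi 0) J] (V.number φs).1)
    (hint : ∀ᵐ x ∂fockMeasure J (Ioi 0) Unit, IntegrableOn (fun s => f₀ s x + f₁ s x) (Ioc 0 b))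
    {ψ : FockFun J (Ioi 0) Unit} (hψ : ψ =ᵐ[fockMeasure J (Ioi 0) Unit] fun x =>
      integralFun b (fun s x => f₀ s x + f₁ s x) (fun s x => g₀ s x + g₁ s x) x -
        integralFun a (fun s x => f₀ s x + f₁ s x) (fun s x => g₀ s x + g₁ s x) x) :
    IsItoTerm G r P a b φ ψ := by
  -- `Φ` is the integral of `φ°_s` over `]a, b]`, the increment of the annihilation process; its
  -- image under the coefficient is the integral of `f₁`.
  obtain ⟨Φ, hΦ, hVΦ⟩ := hV.2.2.1.apply_integral (volume.restrict (Ioc a b))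
    (measurable_sliceFun φ.1.measurable) hf₁ (by
      filter_upwards [hae] with s ⟨φs, h0, _, h1, _⟩
      exact ⟨φs, h0, h1⟩) fun ζ hζ => lintegral_slice_lt_top ha hζ φ
  have hφm : Measurable (Function.uncurry fun (_ : ℝ) => (φ.1 : Chain J × Unit → ℂ)) :=
    φ.1.measurable.comp measurable_snd
  -- The creation and number components for a mark `j` are the parts of the point sum coming from
  -- the points with that mark.
  refine ⟨(V.drift (((b - a : ℝ) : ℂ) • φ)).1, (V.annihilation Φ).1,
    fun j => FockFun.mk _ (measurable_sum_mark (a := a) (b := b) j hg₀),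
    fun j => FockFun.mk _ (measurable_sum_mark (a := a) (b := b) j hg₁), ?_, ?_, ?_, ?_, ?_⟩
  · refine (hA.1 (((b - a : ℝ) : ℂ) • φ)).congr hr ?_
    refine (G.embed_congr r (FockFun.measurable _) (φ.1.measurable.const_mul ((b - a : ℝ) : ℂ))
      (FockFun.coe_smul _ _)).trans ?_
    exact Eventually.of_forall fun x => G.embed_const_mul r _ _ _
  · refine (hA.2.2.1 Φ).congr hr (G.embed_congr r Φ.1.measurable ?_
      (hΦ.trans (ae_annihilationProc_sub ha hab φ)))
    exact (measurable_annihilationProc b φ.1.measurable).sub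
      (measurable_annihilationProc a φ.1.measurable)
  · intro j
    have h := isTensor_sum hr hA.2.1 hV.2.1 hrab hφm hg₀ (by
      filter_upwards [hae] with s ⟨φs, _, _, _, h1, _⟩
      exact ⟨φ, EventuallyEq.rfl, h1⟩) j (FockFun.coe_mk _ (measurable_sum_mark j hg₀))
    have heq : (fun x => creationProc b j (G.embed r φ.1) x - creationProc a j (G.embed r φ.1) x) =
        fun x : Chain J × Unit => ∑ p ∈ x.1.points with (a < p.1 ∧ p.1 ≤ b) ∧ p.2 = j,
          G.embed r φ.1 (x.1.erase p, x.2) :=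
      funext fun x => sum_points_sub hab _ (fun p => p.2 = j) fun p => G.embed r φ.1 (x.1.erase p, ())
    rw [heq]
    exact h
  · intro j
    have h := isTensor_sum hr hA.2.2.2 hV.2.2.2 hrab (measurable_sliceFun φ.1.measurable) hg₁ (by
      filter_upwards [hae] with s ⟨φs, h0, _, _, _, h1⟩
      exact ⟨φs, h0, h1⟩) j (FockFun.coe_mk _ (measurable_sum_mark j hg₁))
    have heq : (fun x => numberProc G r b j φ.1 x - numberProc G r a j φ.1 x) =
        fun x : Chain J × J => ∑ p ∈ x.1.points with (a < p.1 ∧ p.1 ≤ b) ∧ p.2 = j,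
          G.embed r (sliceFun φ.1 p.1) (x.1.erase p, x.2) :=
      funext fun x => sum_points_sub hab _ (fun p => p.2 = j)
        fun p => G.embed r (sliceFun φ.1 p.1) (x.1.erase p, x.2)
    rw [heq]
    exact h
  · have h1 : ∀ᵐ x ∂fockMeasure J (Ioi 0) Unit, ∀ᵐ s ∂volume.restrict (Ioc a b),
        f₀ s x = (V.drift φ).1 x := by
      refine (Measure.ae_ae_comm (p := fun s x => f₀ s x = (V.drift φ).1 x)
        (measurableSet_eq_fun hf₀ ((V.drift φ).1.measurable.comp measurable_snd))).1 ?_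
      filter_upwards [hae] with s ⟨φs, _, h1, _⟩ using h1
    have h2 : ∀ᵐ τ ∂chainMeasure J (Ioi 0), ∀ j,
        (FockFun.mk _ (measurable_sum_mark (a := a) (b := b) j hg₀) : FockFun J (Ioi 0) J) (τ, j) =
        ∑ p ∈ τ.points with (a < p.1 ∧ p.1 ≤ b) ∧ p.2 = j, g₀ p.1 (τ.erase p, j) :=
      ae_all_iff.2 fun j => ae_fockMeasure_iff.1 (FockFun.coe_mk _ (measurable_sum_mark j hg₀)) j
    have h3 : ∀ᵐ τ ∂chainMeasure J (Ioi 0), ∀ j,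
        (FockFun.mk _ (measurable_sum_mark (a := a) (b := b) j hg₁) : FockFun J (Ioi 0) J) (τ, j) =
        ∑ p ∈ τ.points with (a < p.1 ∧ p.1 ≤ b) ∧ p.2 = j, g₁ p.1 (τ.erase p, j) :=
      ae_all_iff.2 fun j => ae_fockMeasure_iff.1 (FockFun.coe_mk _ (measurable_sum_mark j hg₁)) j
    filter_upwards [h2, h3, ae_fockMeasure_unit.1 h1, ae_fockMeasure_unit.1 hint,
      ae_fockMeasure_unit.1 hψ, ae_fockMeasure_unit.1 hVΦ, ae_fockMeasure_unit.1
        (FockFun.coe_smul ((b - a : ℝ) : ℂ) (V.drift φ).1)] with τ h2 h3 h1 hint hψ hVΦ h4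
    rw [hψ, integralFun_sub ha hab _ _ hint, tsum_congr h2, tsum_congr h3,
      tsum_sum_marks _ _ fun p j => g₀ p.1 (τ.erase p, j),
      tsum_sum_marks _ _ fun p j => g₁ p.1 (τ.erase p, j), Finset.sum_add_distrib, hVΦ]
    have h5 : (V.drift (((b - a : ℝ) : ℂ) • φ)).1 (τ, ()) =
        ((b - a : ℝ) : ℂ) * (V.drift φ).1 (τ, ()) := by
      rw [map_smul]; exact h4
    have h6 : ∫ s in Ioc a b, (f₀ s (τ, ()) + f₁ s (τ, ())) =
        ((b - a : ℝ) : ℂ) * (V.drift φ).1 (τ, ()) + ∫ s in Ioc a b, f₁ s (τ, ()) := by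
      have hc : Integrable (fun _ : ℝ => (V.drift φ).1 (τ, ())) (volume.restrict (Ioc a b)) :=
        integrable_const _
      have hab' : Integrable (fun s => f₀ s (τ, ()) + f₁ s (τ, ())) (volume.restrict (Ioc a b)) :=
        hint.mono_set (Ioc_subset_Ioc_left ha)
      -- Only `f₀ + f₁` is known to be integrable here; `f₀` is constant in `s` for this chain, so
      -- `f₁` is integrable as a difference.
      have hf : Integrable (fun s => f₁ s (τ, ())) (volume.restrict (Ioc a b)) := by
        refine (hab'.sub hc).congr ?_
        filter_upwards [h1] with s hs
        simp [hs]
      have : ∫ s in Ioc a b, (f₀ s (τ, ()) + f₁ s (τ, ())) =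
          ∫ s in Ioc a b, ((V.drift φ).1 (τ, ()) + f₁ s (τ, ())) :=
        integral_congr_ae (by filter_upwards [h1] with s hs; rw [hs])
      rw [this, integral_add hc hf, setIntegral_const]
      simp [Measure.real, hab]
    rw [h5, h6]
    simp only [add_assoc]

theorem IsItoTerm.unique {r a b : ℝ} (hr : 0 ≤ r) {P : QSMatrix J (Ioc 0 r)}
    {ψ ψ' : FockFun J (Ioi 0) Unit} (h : IsItoTerm G r P a b φ ψ)
    (h' : IsItoTerm G r P a b φ ψ') : ψ = ψ' := by
  obtain ⟨ψ₀, ψ₁, ψ₂, ψ₃, h0, h1, h2, h3, h4⟩ := h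
  obtain ⟨ψ₀', ψ₁', ψ₂', ψ₃', h0', h1', h2', h3', h4'⟩ := h'
  obtain rfl := h0.unique hr h0'
  obtain rfl := h1.unique hr h1'
  obtain rfl : ψ₂ = ψ₂' := funext fun j => (h2 j).unique hr (h2' j)
  obtain rfl : ψ₃ = ψ₃' := funext fun j => (h3 j).unique hr (h3' j)
  refine FockFun.ext_ae (ae_fockMeasure_unit.2 ?_)
  filter_upwards [h4, h4'] with τ hτ hτ'
  rw [hτ, hτ']

theorem SimpleAdapted.time_castSucc_nonneg (S : SimpleAdapted G) (l : Fin (S.n + 1)) :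
    0 ≤ S.time l :=
  S.time_nonneg.trans (S.time_strictMono.monotone (Fin.zero_le l))

theorem SimpleAdapted.IsItoSum.unique {S : SimpleAdapted G} {t : ℝ}
    {T T' : FockOp J (Ioi 0) Unit Unit} (h : S.IsItoSum t T) (h' : S.IsItoSum t T') : T = T' := by
  ext1 φ
  obtain ⟨ψ, h1, h2⟩ := h φ
  obtain ⟨ψ', h1', h2'⟩ := h' φ
  obtain rfl : ψ = ψ' := funext fun l => (h1 l).unique (S.time_castSucc_nonneg _) (h1' l)
  exact Subtype.ext (h2.trans h2'.symm)

end Ito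

/-! ### The QS-integral of a simple adapted process -/

section SimpleIntegral

variable {J : Type*} [MeasurableSpace J] [Countable J] [MeasurableSingletonClass J]
  {K : Type*} [NormedAddCommGroup K] [InnerProductSpace ℂ K] [CompleteSpace K]
  {G : GelfandField J K}

/-- Reconciles the intervals `[t_l, t_{l+1}[` of the simple process with the intervals `]a, b]` of
integration. -/
theorem ae_Ioc_ne {a b : ℝ} (c : ℝ) : ∀ᵐ s ∂volume.restrict (Ioc a b), s ≠ c :=
  ae_restrict_of_ae (by simp [ae_iff])

theorem sum_fin_sub {M : Type*} [AddCommGroup M] {n : ℕ} (H : Fin (n + 1) → M) :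
    ∑ l : Fin n, (H l.succ - H l.castSucc) = H (Fin.last n) - H 0 := by
  rw [Finset.sum_sub_distrib]
  have h1 := Fin.sum_univ_succ H
  rw [Fin.sum_univ_castSucc] at h1
  rw [sub_eq_sub_iff_add_eq_add, add_comm (H (Fin.last n)), h1, add_comm]

/-- The value of the process on the `l`-th interval. -/
theorem SimpleAdapted.process_eq (S : SimpleAdapted G) {s : ℝ} (l : Fin S.n)
    (hs : s ∈ Ico (S.time l.castSucc) (S.time l.succ)) : S.process s = S.value l := by
  have h : ∀ m, s ∈ Ico (S.time m.castSucc) (S.time m.succ) ↔ m = l := by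
    refine fun m => ⟨fun hm => ?_, fun h => h ▸ hs⟩
    have h1 := S.time_strictMono.lt_iff_lt.1 (hs.1.trans_lt hm.2)
    have h2 := S.time_strictMono.lt_iff_lt.1 (hm.1.trans_lt hs.2)
    rw [Fin.castSucc_lt_succ_iff] at h1 h2
    exact le_antisymm h2 h1
  simp [SimpleAdapted.process, h]

theorem SimpleAdapted.process_eq_zero (S : SimpleAdapted G) {s : ℝ}
    (hs : s < S.time 0 ∨ S.time (Fin.last S.n) ≤ s) :
    (S.process s).drift = 0 ∧ (S.process s).creation = 0 ∧ (S.process s).annihilation = 0 ∧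
      (S.process s).number = 0 := by
  have h : ∀ m : Fin S.n, s ∉ Ico (S.time m.castSucc) (S.time m.succ) := by
    intro m hm
    rcases hs with hs | hs
    · exact absurd (hs.trans_le (S.time_strictMono.monotone (Fin.zero_le m.castSucc)))
        (not_lt.2 hm.1)
    · exact absurd (hm.2.trans_le (S.time_strictMono.monotone (Fin.le_last m.succ)))
        (not_lt.2 hs)
  simp [SimpleAdapted.process, h]

theorem ae_integralFun_eq {c d : ℝ} (hc : 0 ≤ c) (hcd : c ≤ d) {f : ℝ → Chain J × Unit → ℂ}
    {g : ℝ → Chain J × J → ℂ} (hf : Measurable (Function.uncurry f))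
    (hg : Measurable (Function.uncurry g))
    (hint : ∀ᵐ x ∂fockMeasure J (Ioi 0) Unit, IntegrableOn (fun s => f s x) (Ioc 0 d))
    (hf0 : ∀ᵐ s ∂volume.restrict (Ioc c d), f s =ᵐ[fockMeasure J (Ioi 0) Unit] 0)
    (hg0 : ∀ᵐ s ∂volume.restrict (Ioc c d), g s =ᵐ[fockMeasure J (Ioi 0) J] 0) :
    integralFun d f g =ᵐ[fockMeasure J (Ioi 0) Unit] integralFun c f g := by
  have h1 : ∀ᵐ x ∂fockMeasure J (Ioi 0) Unit, ∀ᵐ s ∂volume.restrict (Ioc c d), f s x = 0 :=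
    (Measure.ae_ae_comm (p := fun s x => f s x = 0)
      (measurableSet_eq_fun hf measurable_const)).1 hf0
  have h2 : ∀ᵐ τ ∂chainMeasure J (Ioi 0), ∀ p ∈ τ.points, p.1 ∈ Ioc c d →
      g p.1 (τ.erase p, p.2) = 0 := by
    refine ae_points_of_ae_ae (A := Ioc c d) measurableSet_Ioc (P := fun s x => g s x = 0)
      (measurableSet_eq_fun hg measurable_const) ?_
    exact ae_restrict_of_ae_restrict_of_subset inter_subset_left hg0
  have h2' : ∀ᵐ x ∂fockMeasure J (Ioi 0) Unit, ∀ p ∈ x.1.points, p.1 ∈ Ioc c d →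
      g p.1 (x.1.erase p, p.2) = 0 := ae_fockMeasure_fst h2
  filter_upwards [hint, h1, h2'] with x hx h1 h2
  rw [← sub_eq_zero, integralFun_sub hc hcd f g hx, integral_congr_ae h1, integral_zero, zero_add]
  exact Finset.sum_eq_zero fun p hp => h2 p (Finset.mem_filter.1 hp).1 (Finset.mem_filter.1 hp).2

theorem ae_integralFun_zero (f : ℝ → Chain J × Unit → ℂ) (g : ℝ → Chain J × J → ℂ) :
    integralFun 0 f g =ᵐ[fockMeasure J (Ioi 0) Unit] 0 := by
  have h1 : ∀ᵐ x ∂fockMeasure J (Ioi 0) Unit, ∀ p ∈ x.1.points, p.1 ∈ Ioi (0 : ℝ) :=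
    ae_fockMeasure_fst (P := fun τ => ∀ p ∈ τ.points, p.1 ∈ Ioi (0 : ℝ))
      (ae_points_mem (J := J) measurableSet_Ioi)
  filter_upwards [h1] with x hx
  unfold integralFun
  rw [Finset.filter_false_of_mem fun p hp => not_le.2 (hx p hp)]
  simp

theorem QSProcess.IsParts.ae_zero {C : QSProcess J} {t : ℝ} {φ : FockPlus J (Ioi 0) Unit}
    {f₀ f₁ : ℝ → Chain J × Unit → ℂ} {g₀ g₁ : ℝ → Chain J × J → ℂ}
    (h : C.IsParts t φ f₀ f₁ g₀ g₁) {c d : ℝ} (hc : 0 ≤ c) (hd : d ≤ t)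
    (h0 : ∀ᵐ s ∂volume.restrict (Ioc c d), (C s).drift = 0 ∧ (C s).creation = 0 ∧
      (C s).annihilation = 0 ∧ (C s).number = 0) :
    (∀ᵐ s ∂volume.restrict (Ioc c d),
      (fun x => f₀ s x + f₁ s x) =ᵐ[fockMeasure J (Ioi 0) Unit] 0) ∧
    ∀ᵐ s ∂volume.restrict (Ioc c d),
      (fun x => g₀ s x + g₁ s x) =ᵐ[fockMeasure J (Ioi 0) J] 0 := by
  have hae := ae_restrict_of_ae_restrict_of_subset (Ioc_subset_Ioc hc hd) h.ae
  constructor <;>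
  · filter_upwards [hae, h0] with s hs h0
    obtain ⟨e1, e2, e3, e4⟩ := h0
    obtain ⟨φs, -, h1, h2, h3, h4⟩ := hs
    rw [e1] at h1
    rw [e3] at h2
    rw [e2] at h3
    rw [e4] at h4
    first
    | filter_upwards [h1.trans FockFun.coe_zero, h2.trans FockFun.coe_zero] with x h1 h2
      simp [h1, h2]
    | filter_upwards [h3.trans FockFun.coe_zero, h4.trans FockFun.coe_zero] with x h1 h2
      simp [h1, h2]

/-- The QS-integral of a simple adapted process is its Itô sum. -/
theorem SimpleAdapted.isItoSum_of_isIntegral (S : SimpleAdapted G) {t : ℝ} (ht : 0 < t)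
    {T : FockOp J (Ioi 0) Unit Unit} (hT : S.process.IsIntegral t T) : S.IsItoSum t T := by
  intro φ
  obtain ⟨f₀, f₁, g₀, g₁, h⟩ := S.locallyQSIntegrable.exists_isParts ht φ
  obtain ⟨hf, hg, -⟩ := h.isVersion
  have hTφ := (hT φ).ae_eq h.isVersion
  have hint : ∀ d ≤ t, ∀ᵐ x ∂fockMeasure J (Ioi 0) Unit,
      IntegrableOn (fun s => f₀ s x + f₁ s x) (Ioc 0 d) := fun d hd => by
    filter_upwards [hTφ] with x hx using hx.1.mono_set (Ioc_subset_Ioc_right hd)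
  -- The integral as a function of its upper limit; the terms of the Itô sum are its increments, and
  -- their sum telescopes.
  let H : ℝ → Chain J × Unit → ℂ := fun c =>
    integralFun c (fun s x => f₀ s x + f₁ s x) fun s x => g₀ s x + g₁ s x
  have hH : ∀ c, Measurable (H c) := fun c => measurable_integralFun hf hg
  have htime := fun l => S.time_castSucc_nonneg l
  have hmin : ∀ l, 0 ≤ min (S.time l) t := fun l => le_min (htime l) ht.le
  refine ⟨fun l => FockFun.mk (fun x => H (min (S.time l.succ) t) x -
    H (min (S.time l.castSucc) t) x) ((hH _).sub (hH _)), fun l => ?_, ?_⟩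
  · have hlt : S.time l.castSucc < S.time l.succ := S.time_strictMono Fin.castSucc_lt_succ
    -- For `t ≤ t_l` the interval is empty and the condition is vacuous.
    have hr : ∀ s, min (S.time l.castSucc) t < s → s ≤ min (S.time l.succ) t →
        S.time l.castSucc < s := by
      intro s h1 h2
      rcases min_lt_iff.1 h1 with h | h
      · exact h
      · exact absurd (h2.trans (min_le_right _ _)) (not_le.2 h)
    refine isItoTerm_of_parts (htime _) (hmin _) (min_le_min_right t hlt.le) hr
      (S.continuous l) (S.adapted l) h.measurable_drift h.measurable_annihilation
      h.measurable_creation h.measurable_number ?_ (hint _ (min_le_right _ _))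
      (FockFun.coe_mk _ _)
    filter_upwards [ae_restrict_of_ae_restrict_of_subset
      (Ioc_subset_Ioc (hmin l.castSucc) (min_le_right (S.time l.succ) t)) h.ae,
      ae_restrict_mem measurableSet_Ioc, ae_Ioc_ne (S.time l.succ)] with s hs hs' hne
    rwa [S.process_eq l ⟨(hr s hs'.1 hs'.2).le,
      lt_of_le_of_ne (hs'.2.trans (min_le_left _ _)) hne⟩] at hs
  -- The process vanishes before `t_0` and from `t_n` on, so the two ends of the telescoping sum are
  -- `0` and the full integral up to `t`.
  · have h0 : H (min (S.time 0) t) =ᵐ[fockMeasure J (Ioi 0) Unit] 0 := by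
      have hz := h.ae_zero le_rfl (min_le_right (S.time 0) t) (by
        filter_upwards [ae_restrict_mem measurableSet_Ioc, ae_Ioc_ne (S.time 0)] with s hs hne
        exact S.process_eq_zero (Or.inl (lt_of_le_of_ne (hs.2.trans (min_le_left _ _)) hne)))
      exact (ae_integralFun_eq le_rfl (hmin 0) hf hg (hint _ (min_le_right _ _)) hz.1 hz.2).trans
        (ae_integralFun_zero _ _)
    have h1 : H t =ᵐ[fockMeasure J (Ioi 0) Unit] H (min (S.time (Fin.last S.n)) t) := by
      have hz := h.ae_zero (hmin (Fin.last S.n)) le_rfl (by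
        filter_upwards [ae_restrict_mem measurableSet_Ioc] with s hs
        refine S.process_eq_zero (Or.inr ?_)
        rcases min_lt_iff.1 hs.1 with h | h
        · exact h.le
        · exact absurd hs.2 (not_le.2 h))
      exact ae_integralFun_eq (hmin _) (min_le_right _ _) hf hg (hint _ le_rfl) hz.1 hz.2
    refine FockFun.ext_ae ?_
    have h2 : ∀ᵐ x ∂fockMeasure J (Ioi 0) Unit, ∀ l : Fin S.n,
        (FockFun.mk (fun x => H (min (S.time l.succ) t) x - H (min (S.time l.castSucc) t) x)
          ((hH _).sub (hH _)) : FockFun J (Ioi 0) Unit) x =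
        H (min (S.time l.succ) t) x - H (min (S.time l.castSucc) t) x :=
      ae_all_iff.2 fun l => FockFun.coe_mk _ _
    filter_upwards [hTφ, h0, h1, h2, FockFun.coe_sum Finset.univ fun l : Fin S.n =>
      (FockFun.mk (fun x => H (min (S.time l.succ) t) x - H (min (S.time l.castSucc) t) x)
          ((hH _).sub (hH _)) : FockFun J (Ioi 0) Unit)] with x hx h0 h1 h2 h3
    refine Eq.trans ?_ h3.symm
    rw [Finset.sum_congr rfl fun l _ => h2 l, sum_fin_sub fun l => H (min (S.time l) t) x, h0,
      ← h1, hx.2]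
    simp [H]

/-- The Itô sum needs no construction of its own: the QS-integral is one, and Itô sums are unique
because each tensor product in their terms is determined fibrewise. -/
theorem SimpleAdapted.exists_integral (S : SimpleAdapted G) {t : ℝ} (ht : 0 < t) :
    ∃ T : FockOp J (Ioi 0) Unit Unit,
      (∀ T', S.process.IsIntegral t T' ↔ T' = T) ∧ (∀ T', S.IsItoSum t T' ↔ T' = T) := by
  obtain ⟨T, hT⟩ := QSProcess.exists_unique_integral
    fun φ => S.locallyQSIntegrable.exists_isIntegralAt ht φ
  have h1 := S.isItoSum_of_isIntegral ht ((hT T).2 rfl)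
  exact ⟨T, hT, fun T' => ⟨fun h => h.unique h1, fun h => h ▸ h1⟩⟩

end SimpleIntegral

/-! ### Approximation of the QS-integral -/

section Approximation

variable {J : Type*} [MeasurableSpace J] [Countable J] [MeasurableSingletonClass J]
  {C D : QSProcess J} {t : ℝ}

theorem FockFun.ae_eq_sub {B : Set ℝ} {I : Type*} [MeasurableSpace I] {F F' : Chain J × I → ℂ}
    {ψ ψ' : FockFun J B I} (h : F =ᵐ[fockMeasure J B I] ψ) (h' : F' =ᵐ[fockMeasure J B I] ψ') :
    (fun x => F x - F' x) =ᵐ[fockMeasure J B I] (ψ - ψ' : FockFun J B I) := by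
  filter_upwards [h, h', FockFun.coe_sub ψ ψ'] with x h1 h2 h3
  rw [h1, h2]
  exact h3.symm

theorem QSProcess.IsParts.sub {φ : FockPlus J (Ioi 0) Unit}
    {f₀ f₁ f₀' f₁' : ℝ → Chain J × Unit → ℂ} {g₀ g₁ g₀' g₁' : ℝ → Chain J × J → ℂ}
    (h : C.IsParts t φ f₀ f₁ g₀ g₁) (h' : D.IsParts t φ f₀' f₁' g₀' g₁') :
    (C.sub D).IsParts t φ (fun s x => f₀ s x - f₀' s x) (fun s x => f₁ s x - f₁' s x)
      (fun s x => g₀ s x - g₀' s x) (fun s x => g₁ s x - g₁' s x) where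
  measurable_drift := h.measurable_drift.sub h'.measurable_drift
  measurable_annihilation := h.measurable_annihilation.sub h'.measurable_annihilation
  measurable_creation := h.measurable_creation.sub h'.measurable_creation
  measurable_number := h.measurable_number.sub h'.measurable_number
  ae := by
    filter_upwards [h.ae, h'.ae] with s ⟨φs, h0, h1, h2, h3, h4⟩ ⟨φs', h0', h1', h2', h3', h4'⟩
    obtain rfl := h0.unique h0'
    exact ⟨φs, h0, FockFun.ae_eq_sub h1 h1', FockFun.ae_eq_sub h2 h2', FockFun.ae_eq_sub h3 h3',
      FockFun.ae_eq_sub h4 h4'⟩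

/-- The basic estimate for the difference of two QS-integrals. -/
theorem opNorm_sub_le (hC : C.LocallyQSIntegrable) (hD : D.LocallyQSIntegrable) (ht : 0 < t)
    {L T : FockOp J (Ioi 0) Unit Unit} (hL : C.IsIntegral t L) (hT : D.IsIntegral t T)
    {ζ ξ ε : ℝ} (hζ : 1 < ζ) (hε : 0 < ε) (hεξ : ε < ξ) :
    opNorm (ζ + ε) (ξ - ε) (T - L) ≤ estimateConst ζ ξ ε * (C.sub D).normSum t ζ ξ := by
  refine opNorm_le fun φ => ?_
  obtain ⟨f₀, f₁, g₀, g₁, h⟩ := hC.exists_isParts ht φ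
  obtain ⟨f₀', f₁', g₀', g₁', h'⟩ := hD.exists_isParts ht φ
  refine le_trans (le_of_eq ?_) ((h.sub h').estimate hζ hε hεξ)
  -- The integral of `C - D` is `L - T`, the negative of the operator to be estimated, which has the
  -- same norm.
  refine eLpNorm_congr_norm_ae ((scaleMeasure_ac _).ae_le ?_)
  filter_upwards [(hL φ).ae_eq h.isVersion, (hT φ).ae_eq h'.isVersion,
    FockFun.coe_sub (T φ).1 (L φ).1] with x hx hx' h1
  have h2 : ((T - L) φ).1 x = (T φ).1 x - (L φ).1 x := h1
  have h3 : integralFun t (fun s x => f₀ s x - f₀' s x + (f₁ s x - f₁' s x))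
      (fun s x => g₀ s x - g₀' s x + (g₁ s x - g₁' s x)) x = (L φ).1 x - (T φ).1 x := by
    rw [hx.2, hx'.2]
    unfold integralFun
    rw [add_sub_add_comm, ← integral_sub hx.1 hx'.1, ← Finset.sum_sub_distrib]
    congr 1
    · exact integral_congr_ae (Eventually.of_forall fun s => sub_add_sub_comm _ _ _ _)
    · exact Finset.sum_congr rfl fun p _ => sub_add_sub_comm _ _ _ _
  rw [h2, h3, norm_sub_rev]

theorem ApproximatesAt.tendsto_normSum {D : ℕ → QSProcess J} {ξ ζ : ℝ}
    (h : ApproximatesAt D C t ξ ζ) :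
    Tendsto (fun n => (C.sub (D n)).normSum t ζ ξ) atTop (𝓝 0) := by
  simpa [QSProcess.normSum] using ((h.1.add h.2.1).add h.2.2.1).add h.2.2.2

theorem tendsto_opNorm_sub (hC : C.LocallyQSIntegrable) {D : ℕ → QSProcess J}
    (hD : ∀ n, (D n).LocallyQSIntegrable) (ht : 0 < t) {L : FockOp J (Ioi 0) Unit Unit}
    {T : ℕ → FockOp J (Ioi 0) Unit Unit} (hL : C.IsIntegral t L)
    (hT : ∀ n, (D n).IsIntegral t (T n)) {ξ ζ : ℝ} (hζ : 1 < ζ)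
    (h : ApproximatesAt D C t ξ ζ) {ε : ℝ} (hε : ε ∈ Ioo 0 ξ) {η₁ : ℝ} (hη₁ : η₁ ∈ Ioc 0 (ξ - ε))
    {η₂ : ℝ} (hη₂ : η₂ ≥ ζ + ε) : Tendsto (fun n => opNorm η₂ η₁ (T n - L)) atTop (𝓝 0) := by
  have h1 := ENNReal.Tendsto.const_mul (a := estimateConst ζ ξ ε) h.tendsto_normSum
    (Or.inr (estimateConst_lt_top ζ ξ ε).ne)
  rw [mul_zero] at h1
  refine tendsto_of_tendsto_of_tendsto_of_le_of_le tendsto_const_nhds h1 (fun n => bot_le) fun n => ?_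
  exact (opNorm_mono (by linarith [hε.1]) hη₂ hη₁.1.le hη₁.2 _).trans
    (opNorm_sub_le hC (hD n) ht hL (hT n) hζ hε.1 hε.2)

end Approximation

end

/-! ### The QS-integral as the limit of Itô sums -/

theorem corollary1 {J : Type*} [Countable J] [MeasurableSpace J] [MeasurableSingletonClass J]
    {K : Type*} [NormedAddCommGroup K] [InnerProductSpace ℂ K] [CompleteSpace K]
    (G : GelfandField J K) :
    -- for simple adapted processes, the QS-integral is the Itô sum
    (∀ (S : SimpleAdapted G) (t : ℝ), 0 < t →
      ∃ T : FockOp J (Ioi 0) Unit Unit,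
        (∀ T', S.process.IsIntegral t T' ↔ T' = T) ∧ (∀ T', S.IsItoSum t T' ↔ T' = T)) ∧
    -- the QS-integral is the limit of the Itô sums of the approximating simple adapted processes
    (∀ (C : QSProcess J), C.LocallyQSIntegrable → ∀ (t : ℝ), 0 < t →
      ∀ (S : ℕ → SimpleAdapted G),
      ∃ (L : FockOp J (Ioi 0) Unit Unit) (T : ℕ → FockOp J (Ioi 0) Unit Unit),
        (∀ L', C.IsIntegral t L' ↔ L' = L) ∧
        (∀ n T', (S n).IsItoSum t T' ↔ T' = T n) ∧
        (∀ ξ ∈ Ioo (0 : ℝ) 1, ∀ ζ > 1, ApproximatesAt (fun n => (S n).process) C t ξ ζ →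
          ∀ ε ∈ Ioo 0 ξ, ∀ η₁ ∈ Ioc 0 (ξ - ε), ∀ η₂ ≥ ζ + ε,
            Tendsto (fun n => opNorm η₂ η₁ (T n - L)) atTop (𝓝 0)) ∧
        ((∀ ξ ∈ Ioo (0 : ℝ) 1, ∃ ζ > 1, ApproximatesAt (fun n => (S n).process) C t ξ ζ) →
          TendstoInductive T L)) := by
  refine ⟨fun S t ht => S.exists_integral ht, fun C hC t ht S => ?_⟩
  obtain ⟨L, hL⟩ := QSProcess.exists_unique_integral fun φ => hC.exists_isIntegralAt ht φ
  choose T hT hT' using fun n => (S n).exists_integral ht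
  have key : ∀ ξ ∈ Ioo (0 : ℝ) 1, ∀ ζ > 1, ApproximatesAt (fun n => (S n).process) C t ξ ζ →
      ∀ ε ∈ Ioo 0 ξ, ∀ η₁ ∈ Ioc 0 (ξ - ε), ∀ η₂ ≥ ζ + ε,
        Tendsto (fun n => opNorm η₂ η₁ (T n - L)) atTop (𝓝 0) :=
    fun ξ _ ζ hζ h ε hε η₁ hη₁ η₂ hη₂ =>
      tendsto_opNorm_sub hC (fun n => (S n).locallyQSIntegrable) ht ((hL L).2 rfl)
        (fun n => (hT n (T n)).2 rfl) hζ h hε hη₁ hη₂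
  refine ⟨L, T, hL, hT', key, fun h η₁ hη₁ => ?_⟩
  obtain ⟨h0, h1⟩ := hη₁
  -- With `ξ = (1 + η₁)/2` and `ε = (1 - η₁)/2` one has `ξ - ε = η₁`, so `η₂ = ζ + ε` is admissible.
  obtain ⟨ζ, hζ, h2⟩ := h ((1 + η₁) / 2) ⟨by linarith, by linarith⟩
  refine ⟨ζ + (1 - η₁) / 2, by linarith, key _ ⟨by linarith, by linarith⟩ ζ hζ h2
    ((1 - η₁) / 2) ⟨by linarith, by linarith⟩ η₁ ⟨h0, by linarith⟩ _ le_rfl⟩
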